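/- **Proposition 3.1.** Let $N\ge 1$, $\gamma>1$, let $\Omega\subset\mathbb R^N$ be a bounded domain with smooth ($C^\infty$) boundary, with outward unit normal $\nu$ and surface measure $\sigma$ on $\partial\Omega$, and let $g,G\in C^1(\overline\Omega\times\mathbb R)$ satisfy $\partial_mG(x,m)=g(x,m)$ for all $x,m$. Let $u\in C^2(\overline\Omega)$ and $m\in W^{1,1}(\Omega)$ be a solution of $$-\Delta u+\tfrac1\gamma|\nabla u|^\gamma=g(x,m(x)),\qquad -\Delta m-\operatorname{div}\big(|\nabla u|^{\gamma-2}\nabla u\,m\big)=0\qquad\text{in }\Omega,$$ the first equation holding almost everywhere and the second one in the weak sense, i.e. $\int_\Omega \big(\nabla m+|\nabla u|^{\gamma-2}\nabla u\,m\big)\cdot\nabla\varphi\,dx=0$ for all $\varphi\in C_c^\infty(\Omega)$ (where $|\nabla u|^{\gamma-2}\nabla u:=0$ at the points where $\nabla u=0$). Suppose that the quantities below are meaningful, that is: $G(\cdot,m)$ and $\nabla_xG(\cdot,m)$ belong to $L^1(\Omega)$, and $\nabla m$ has a trace on $\partial\Omega$. Here $f_b\in L^1(\partial\Omega,\sigma)$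 is called the trace of a function or vector field $f$ on $\Omega$ if $$\lim_{r\to0^+}\int_{\partial\Omega}\frac1{|\Omega\cap B_r(x)|}\int_{\Omega\cap B_r(x)}|f(y)-f_b(x)|\,dy\,d\sigma(x)=0$$ (for $m\in W^{1,1}(\Omega)$ this is the usual trace; for $f\in C(\overline\Omega)$ it is $f|_{\partial\Omega}$). Then $$N\int_\Omega G(x,m)\,dx+\int_\Omega\nabla_xG(x,m)\cdot x\,dx+\Big(1-\frac N\gamma\Big)\int_\Omega|\nabla u|^\gamma m\,dx+(2-N)\int_\Omega\nabla u\cdot\nabla m\,dx=I_{\partial\Omega},$$ where $$I_{\partial\Omega}=\int_{\partial\Omega}\Big(G(x,m)-\nabla u\cdot\nabla m-\frac1\gamma|\nabla u|^\gamma m\Big)\,x\cdot\nu\,d\sigma+\int_{\partial\Omega}\Big((\nabla u\cdot\nu)(\nabla m\cdot x)+(\nabla m\cdot\nu)(\nabla u\cdot x)+|\nabla u|^{\gamma-2}(\nabla u\cdot\nu)(\nabla u\cdot x)\,m\Big)\,d\sigma;$$ here $m,\nabla m$ on $\partial\Omega$ are the traces of $m,\nabla m$, and both integrands are $\sigma$-integrable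 on $\partial\Omega$. -/

import Mathlib

open MeasureTheory Set Filter Topology
open scoped ContDiff InnerProductSpace

namespace MFGPohozaev

noncomputable section

/-- `ρ` is a smooth local defining function of `Ω` on the open set `U`: its gradient does not
vanish on `U`, and `Ω ∩ U = {ρ < 0}`. -/
structure IsLocalDefiningFunction {N : ℕ} (Ω U : Set (EuclideanSpace ℝ (Fin N)))
    (ρ : EuclideanSpace ℝ (Fin N) → ℝ) : Prop where
  isOpen : IsOpen U
  smooth : ContDiffOn ℝ ∞ ρ U
  gradient_ne_zero : ∀ x ∈ U, gradient ρ x ≠ 0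
  mem_iff : ∀ x ∈ U, x ∈ Ω ↔ ρ x < 0

/-- Bounded smooth domain of `ℝ^N`: bounded, open, (nonempty and) connected, with a smooth
boundary, the domain lying locally on one side of it. -/
structure IsBoundedSmoothDomain {N : ℕ} (Ω : Set (EuclideanSpace ℝ (Fin N))) : Prop where
  isOpen : IsOpen Ω
  isConnected : IsConnected Ω
  isBounded : Bornology.IsBounded Ω
  smooth_boundary : ∀ x ∈ frontier Ω, ∃ U ρ, x ∈ U ∧ IsLocalDefiningFunction Ω U ρ

/-- `n` is the outward unit normal of `Ω` at the boundary point `x`. -/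
def IsOuterUnitNormal {N : ℕ} (Ω : Set (EuclideanSpace ℝ (Fin N)))
    (x n : EuclideanSpace ℝ (Fin N)) : Prop :=
  ∃ U ρ, x ∈ U ∧ IsLocalDefiningFunction Ω U ρ ∧ n = ‖gradient ρ x‖⁻¹ • gradient ρ x

/-- The outward unit normal field `ν` of a smooth domain (only used at boundary points, where
exactly one vector satisfies `IsOuterUnitNormal Ω x`). -/
def outerNormal {N : ℕ} (Ω : Set (EuclideanSpace ℝ (Fin N))) (x : EuclideanSpace ℝ (Fin N)) :
    EuclideanSpace ℝ (Fin N) :=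
  Classical.epsilon (IsOuterUnitNormal Ω x)

/-- The surface measure `σ` of `∂Ω`: the `(N-1)`-dimensional Hausdorff measure, normalised so that
it is the Lebesgue measure on hyperplanes, restricted to `∂Ω`. -/
def surfaceMeasure {N : ℕ} (Ω : Set (EuclideanSpace ℝ (Fin N))) :
    Measure (EuclideanSpace ℝ (Fin N)) :=
  (Measure.euclideanHausdorffMeasure (N - 1)).restrict (frontier Ω)

/-- Test functions: `φ ∈ C_c^∞(Ω)`. -/
structure IsTestFunction {N : ℕ} (Ω : Set (EuclideanSpace ℝ (Fin N)))
    (φ : EuclideanSpace ℝ (Fin N) → ℝ) : Prop where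
  smooth : ContDiff ℝ ∞ φ
  hasCompactSupport : HasCompactSupport φ
  tsupport_subset : tsupport φ ⊆ Ω

/-- `m ∈ W^{1,1}(Ω)`, with weak gradient `Dm`. -/
structure MemW11 {N : ℕ} (Ω : Set (EuclideanSpace ℝ (Fin N)))
    (m : EuclideanSpace ℝ (Fin N) → ℝ)
    (Dm : EuclideanSpace ℝ (Fin N) → EuclideanSpace ℝ (Fin N)) : Prop where
  integrableOn : IntegrableOn m Ω
  integrableOn_grad : IntegrableOn Dm Ω
  weak_gradient : ∀ φ, IsTestFunction Ω φ →
    ∫ x in Ω, m x • gradient φ x = -∫ x in Ω, φ x • Dm x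

/-- `fb ∈ L¹(∂Ω)` is the trace on `∂Ω` of the function (or vector field) `f` on `Ω`:
`∫_{∂Ω} ⨍_{Ω ∩ B_r(x)} |f(y) - fb(x)| dy dσ(x) → 0` as `r → 0+`.
For `f ∈ W^{1,1}(Ω)` this is the usual trace, and for `f` continuous on the closure of `Ω`
it is the restriction of `f` to `∂Ω`. -/
def HasTrace {N : ℕ} {F : Type*} [NormedAddCommGroup F] (Ω : Set (EuclideanSpace ℝ (Fin N)))
    (f fb : EuclideanSpace ℝ (Fin N) → F) : Prop :=
  Integrable fb (surfaceMeasure Ω) ∧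
    Tendsto
      (fun r : ℝ => ∫⁻ x, laverage (volume.restrict (Ω ∩ Metric.ball x r)) (fun y => ‖f y - fb x‖ₑ)
        ∂(surfaceMeasure Ω))
      (𝓝[>] 0) (𝓝 0)

/-- The gradient, up to the boundary, of a function of class `C¹` on the closure of `Ω`
(the usual gradient at the points of the open set `Ω`). -/
def grad {N : ℕ} (Ω : Set (EuclideanSpace ℝ (Fin N))) (u : EuclideanSpace ℝ (Fin N) → ℝ)
    (x : EuclideanSpace ℝ (Fin N)) : EuclideanSpace ℝ (Fin N) :=
  gradientWithin u (closure Ω) x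

/-- `m`, with weak gradient `Dm`, is a weak solution in `Ω` of
`-Δm - div(|∇u|^{γ-2} ∇u m) = 0`. The field `|∇u|^{γ-2} ∇u` is `0` where `∇u = 0`. -/
def IsWeakKolmogorovSolution {N : ℕ} (Ω : Set (EuclideanSpace ℝ (Fin N))) (γ : ℝ)
    (u m : EuclideanSpace ℝ (Fin N) → ℝ)
    (Dm : EuclideanSpace ℝ (Fin N) → EuclideanSpace ℝ (Fin N)) : Prop :=
  ∀ φ, IsTestFunction Ω φ →
    ∫ x in Ω, (⟪Dm x, gradient φ x⟫_ℝ
      + ‖grad Ω u x‖ ^ (γ - 2) * ⟪grad Ω u x, gradient φ x⟫_ℝ * m x) = 0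

/-- First integrand of the boundary term:
`(G(x,m) - ∇u·∇m - (1/γ)|∇u|^γ m) x·ν`, with the boundary values `mb` of `m` and `Db` of `∇m`. -/
def boundaryIntegrand₁ {N : ℕ} (Ω : Set (EuclideanSpace ℝ (Fin N))) (γ : ℝ)
    (G : EuclideanSpace ℝ (Fin N) → ℝ → ℝ) (u mb : EuclideanSpace ℝ (Fin N) → ℝ)
    (Db : EuclideanSpace ℝ (Fin N) → EuclideanSpace ℝ (Fin N))
    (x : EuclideanSpace ℝ (Fin N)) : ℝ :=
  (G x (mb x) - ⟪grad Ω u x, Db x⟫_ℝ - 1 / γ * ‖grad Ω u x‖ ^ γ * mb x)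
    * ⟪x, outerNormal Ω x⟫_ℝ

/-- Second integrand of the boundary term:
`(∇u·ν)(∇m·x) + (∇m·ν)(∇u·x) + |∇u|^{γ-2}(∇u·ν)(∇u·x) m`. -/
def boundaryIntegrand₂ {N : ℕ} (Ω : Set (EuclideanSpace ℝ (Fin N))) (γ : ℝ)
    (u mb : EuclideanSpace ℝ (Fin N) → ℝ)
    (Db : EuclideanSpace ℝ (Fin N) → EuclideanSpace ℝ (Fin N))
    (x : EuclideanSpace ℝ (Fin N)) : ℝ :=
  ⟪grad Ω u x, outerNormal Ω x⟫_ℝ * ⟪Db x, x⟫_ℝ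
    + ⟪Db x, outerNormal Ω x⟫_ℝ * ⟪grad Ω u x, x⟫_ℝ
    + ‖grad Ω u x‖ ^ (γ - 2) * ⟪grad Ω u x, outerNormal Ω x⟫_ℝ * ⟪grad Ω u x, x⟫_ℝ * mb x

end

end MFGPohozaev

namespace MFGPohozaev

noncomputable section

/-! Write w = ∇u. The identity is the divergence theorem for G(x,m) x + T, where T = (∇m·x) w +
(w·x) ∇m + (w·x) m |w|^{γ-2} w - (w·∇m) x - (1/γ) |w|^γ m x; its normal component on ∂Ω is the sum
of the two boundary integrands. The field T is the sum of -(1/γ)|w|^γ m x, of the antisymmetric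
field (∇m·x) w - (∇m·w) x, and of w·x times the flux ∇m + |w|^{γ-2} w m, which the second equation
makes divergence free. Second derivatives of m cancel in the antisymmetric field and are absent from
the flux term by the equation, so m ∈ W^{1,1} is enough. The terms in D²u cancel because the Hessian
is symmetric. What remains of div T is (Δu - |w|^γ/γ) ∇m·x + (1 - N/γ)|w|^γ m + (2 - N) w·∇m
(`hasWeakDiv_stress`). By the first equation its first term is -g(x,m) ∇m·x, which the term g(x,m)
∇m·x of div(G(x,m) x) compensates.

The work lies in the low regularity, at three places.

(a) Gauss-Green for smooth nonnegative ψ and the Hausdorff measure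
(`IsBoundedSmoothDomain.gaussGreen`). In a chart where ∇ρ is ε-close to a unit vector e, all the
quantities involved are compared up to a relative error O(ε): the boundary is a graph over the
hyperplane orthogonal to e, Lipschitz bounds compare its Hausdorff measure with Lebesgue measure,
and the normal is close to e. The error is proportional to ∫ψ dσ, hence additive over a partition of
unity, and ε is arbitrary; no area formula enters.

(b) The divergence theorem for a field Y ∈ L¹ with weak divergence f ∈ L¹ and a trace in the
averaged sense (`HasWeakDiv.integral_eq_integral_normal`). In a chart take a kernel ζ_r concentrated
near -2re, so that y ↦ ζ_r(y - x) is supported in Ω for x in the closure of Ω near the chart point.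
Testing the weak divergence with it, integrating over x ∈ Ω and applying (a) in x gives ∫_Ω ∫_{∂Ω}
ζ_r(y - x) ν(x)·Y(y) dσ(x) dy = ∫_Ω ∫_Ω ζ_r(y - x) f(y) dx dy. As r → 0 the right side tends to ∫ f,
and the definition of the trace allows Y(y) to be replaced by its boundary value at x.

(c) The field G(x,m) x, although only G(x,m) and ∇ₓG(x,m) are known to be integrable. The first
equation bounds g(x,m), since u is C² up to the boundary; so ∇ₓG + g ∇m is integrable. For bounded Z
with |Z'| ≤ 1 the chain rule puts Z(G(x,m)) in W^{1,1} (`IsAdmissible.memW11_comp`), and (b) applies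
to it. Letting Z tend to √(1+t²), Fatou's lemma gives the integrability of G(x,m) on ∂Ω
(`IsAdmissible.integrable_boundary`); letting Z tend to the identity gives the formula. -/

/-- The Euclidean space `ℝ^N`. -/
abbrev Space (N : ℕ) := EuclideanSpace ℝ (Fin N)

set_option linter.unusedSectionVars false

variable {N : ℕ} {Ω : Set (Space N)}

section

open scoped Convolution Manifold

/-! ### Cutoff functions, partitions of unity, mollifiers -/

theorem contDiff_of_contDiffOn_of_tsupport_subset {E F : Type*} [NormedAddCommGroup E]
    [NormedSpace ℝ E] [NormedAddCommGroup F] [NormedSpace ℝ F] {n : WithTop ℕ∞} {U : Set E}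
    {f : E → F} (hU : IsOpen U) (hf : ContDiffOn ℝ n f U) (h : tsupport f ⊆ U) :
    ContDiff ℝ n f := by
  rw [contDiff_iff_contDiffAt]
  intro x
  by_cases hx : x ∈ tsupport f
  · exact hf.contDiffAt (hU.mem_nhds (h hx))
  · have : f =ᶠ[𝓝 x] fun _ => 0 := notMem_tsupport_iff_eventuallyEq.1 hx
    exact contDiffAt_const.congr_of_eventuallyEq this

/-- The value 1 is taken on a whole neighbourhood of `K`, so that the gradient of the cutoff
vanishes on `K` as well. -/
theorem exists_cutoff {K U : Set (Space N)} (hK : IsCompact K) (hU : IsOpen U) (hKU : K ⊆ U) :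
    ∃ χ : Space N → ℝ, ContDiff ℝ ∞ χ ∧ HasCompactSupport χ ∧ tsupport χ ⊆ U ∧
      (∀ x, 0 ≤ χ x ∧ χ x ≤ 1) ∧ ∀ᶠ x in 𝓝ˢ K, χ x = 1 := by
  obtain ⟨L, hL, hKL, hLU⟩ := exists_compact_between hK hU hKU
  obtain ⟨f, h1, h0, hf⟩ := exists_contMDiffMap_one_nhds_of_subset_interior (n := (⊤ : ℕ∞))
    𝓘(ℝ, Space N) hK.isClosed hKL
  have hs : tsupport f ⊆ L := by
    refine closure_minimal (fun x hx => ?_) hL.isClosed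
    by_contra hxL
    exact hx (h0 x hxL)
  refine ⟨f, f.contMDiff.contDiff, hL.of_isClosed_subset (isClosed_tsupport _) hs, hs.trans hLU,
    fun x => hf x, h1⟩

theorem exists_finite_partition {K : Set (Space N)} (hK : IsCompact K) (U : Space N → Set (Space N))
    (hU : ∀ x ∈ K, U x ∈ 𝓝 x) :
    ∃ (t : Finset (Space N)) (χ : Space N → Space N → ℝ), (∀ i ∈ t, i ∈ K) ∧
      (∀ i ∈ t, ContDiff ℝ ∞ (χ i) ∧ HasCompactSupport (χ i) ∧ tsupport (χ i) ⊆ U i ∧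
        ∀ x, 0 ≤ χ i x) ∧ ∀ x ∈ K, ∑ i ∈ t, χ i x = 1 := by
  -- Intersecting with a unit ball makes the supports compact.
  let V : K → Set (Space N) := fun i => interior (U i) ∩ Metric.ball i 1
  obtain ⟨f, hf⟩ := SmoothPartitionOfUnity.exists_isSubordinate 𝓘(ℝ, Space N) hK.isClosed V
    (fun i => isOpen_interior.inter Metric.isOpen_ball)
    (fun x hx => mem_iUnion.2 ⟨⟨x, hx⟩, mem_interior_iff_mem_nhds.2 (hU x hx),
      Metric.mem_ball_self one_pos⟩)
  have hfin := f.locallyFinite.finite_nonempty_inter_compact hK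
  classical
  let t : Finset K := hfin.toFinset
  refine ⟨t.image Subtype.val, fun i x => if h : i ∈ K then f ⟨i, h⟩ x else 0, ?_, ?_, ?_⟩
  · intro i hi
    obtain ⟨j, -, rfl⟩ := Finset.mem_image.1 hi
    exact j.2
  · intro i hi
    obtain ⟨j, -, rfl⟩ := Finset.mem_image.1 hi
    have : (fun x => if h : (j : Space N) ∈ K then f ⟨j, h⟩ x else 0) = f j := by
      ext x; simp
    simp only [this]
    have hj := hf j
    refine ⟨(f j).contMDiff.contDiff, ?_, fun x hx => interior_subset (hj hx).1,
      fun x => by simpa using f.nonneg j x⟩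
    refine (isCompact_closedBall (j : Space N) 1).of_isClosed_subset (isClosed_tsupport _)
      fun x hx => Metric.ball_subset_closedBall (hj hx).2
  · intro x hx
    rw [Finset.sum_image (fun a _ b _ h => Subtype.ext h)]
    have h1 := f.sum_eq_one hx
    rw [finsum_eq_sum_of_support_subset (s := t)] at h1
    · simpa using h1
    · intro i hi
      simp only [t, Finite.coe_toFinset, mem_ofPred_eq]
      exact ⟨x, hi, hx⟩

/-- A sequence of bump functions at the origin, with radii tending to `0`. -/
def bump (N k : ℕ) : ContDiffBump (0 : Space N) where
  rIn := 1 / (2 * ((k : ℝ) + 1))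
  rOut := 1 / ((k : ℝ) + 1)
  rIn_pos := by positivity
  rIn_lt_rOut := by
    apply one_div_lt_one_div_of_lt <;> nlinarith [Nat.cast_nonneg (α := ℝ) k]

/-- A bounded ratio of the radii is what Lebesgue differentiation needs in `ae_tendsto_mollify`. -/
theorem bump_rOut_le (N k : ℕ) : (bump N k).rOut ≤ 2 * (bump N k).rIn := by
  simp only [bump]
  apply le_of_eq
  field_simp

theorem tendsto_bump_rOut (N : ℕ) : Tendsto (fun k => (bump N k).rOut) atTop (𝓝 0) :=
  tendsto_one_div_add_atTop_nhds_zero_nat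

/-- The mollification of `f` at scale `1 / (k + 1)`. -/
def mollify {F : Type*} [NormedAddCommGroup F] [NormedSpace ℝ F] (k : ℕ) (f : Space N → F) :
    Space N → F :=
  (bump N k).normed volume ⋆[ContinuousLinearMap.lsmul ℝ ℝ, volume] f

section Mollify

variable {F : Type*} [NormedAddCommGroup F] [NormedSpace ℝ F] [CompleteSpace F]

theorem mollify_apply (k : ℕ) (f : Space N → F) (x : Space N) :
    mollify k f x = ∫ t, (bump N k).normed volume (x - t) • f t :=
  convolution_eq_swap _

theorem contDiff_mollify (k : ℕ) {f : Space N → F}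
    (hf : LocallyIntegrable f) : ContDiff ℝ ∞ (mollify k f) :=
  ((bump N k).hasCompactSupport_normed).contDiff_convolution_left _
    (bump N k).contDiff_normed hf

theorem tsupport_mollify_subset (k : ℕ) (f : Space N → F) :
    tsupport (mollify k f) ⊆ Metric.cthickening (bump N k).rOut (tsupport f) := by
  refine closure_minimal (fun x hx => ?_) Metric.isClosed_cthickening
  have h := support_convolution_subset _ hx
  obtain ⟨a, ha, b, hb, rfl⟩ := h
  rw [(bump N k).support_normed_eq] at ha
  refine Metric.mem_cthickening_of_dist_le _ b _ _ (subset_tsupport _ hb) ?_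
  have := (mem_ball_zero_iff.1 ha).le
  simpa [dist_eq_norm] using this

/-- The oscillation of `f` is at most 2C, and C more bounds `f x` itself. The factor 3 is not sharp;
only a bound uniform in `k` is wanted, for dominated convergence. -/
theorem norm_mollify_le (k : ℕ) {f : Space N → F} {C : ℝ} (hf : AEStronglyMeasurable f)
    (hC : ∀ x, ‖f x‖ ≤ C) (x : Space N) : ‖mollify k f x‖ ≤ 3 * C := by
  have h := (bump N k).dist_normed_convolution_le (μ := volume) (x₀ := x) (ε := 2 * C) hf
    (fun y _ => by
      rw [dist_eq_norm]; linarith [norm_sub_le (f y) (f x), hC x, hC y])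
  rw [dist_eq_norm] at h
  have := norm_le_norm_sub_add (mollify k f x) (f x)
  simp only [mollify] at *
  linarith [hC x]

theorem tendsto_mollify {f : Space N → F} (hf : Continuous f) (x : Space N) :
    Tendsto (fun k => mollify k f x) atTop (𝓝 (f x)) :=
  ContDiffBump.convolution_tendsto_right_of_continuous (tendsto_bump_rOut N) hf x

theorem ae_tendsto_mollify {f : Space N → F} (hf : LocallyIntegrable f) :
    ∀ᵐ x, Tendsto (fun k => mollify k f x) atTop (𝓝 (f x)) :=
  ContDiffBump.ae_convolution_tendsto_right_of_locallyIntegrable (K := 2) (tendsto_bump_rOut N)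
    (Eventually.of_forall fun k => bump_rOut_le N k) hf

theorem fderiv_mollify (k : ℕ) {f : Space N → F} (hf : ContDiff ℝ 1 f)
    (hc : HasCompactSupport f) (x : Space N) :
    fderiv ℝ (mollify k f) x = mollify k (fderiv ℝ f) x := by
  have h := hc.hasFDerivAt_convolution_right (ContinuousLinearMap.lsmul ℝ ℝ) (μ := volume)
    ((bump N k).continuous_normed (μ := volume)).locallyIntegrable hf x
  have := h.fderiv
  simp only [mollify]
  rw [this]
  congr 1

theorem integrable_mollify (k : ℕ) {f : Space N → F} (hf : Integrable f) :
    Integrable (mollify k f) :=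
  Integrable.integrable_convolution _ (bump N k).integrable_normed hf

theorem mollify_add (k : ℕ) {f g : Space N → F} (hf : LocallyIntegrable f)
    (hg : LocallyIntegrable g) : mollify k (f + g) = mollify k f + mollify k g := by
  refine ConvolutionExists.distrib_add ?_ ?_
  · exact (bump N k).hasCompactSupport_normed.convolutionExists_left _
      (bump N k).continuous_normed hf
  · exact (bump N k).hasCompactSupport_normed.convolutionExists_left _
      (bump N k).continuous_normed hg

theorem integral_norm_mollify_le (k : ℕ) {f : Space N → F} (hf : Integrable f) :
    ∫ x, ‖mollify k f x‖ ≤ ∫ x, ‖f x‖ := by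
  have h1 : ∫ x, mollify k (fun x => ‖f x‖) x = ∫ x, ‖f x‖ := by
    have := integral_convolution (μ := volume) (ν := volume) (ContinuousLinearMap.lsmul ℝ ℝ)
      ((bump N k).integrable_normed (μ := volume)) hf.norm
    simp only [mollify]
    rw [this]
    simp [(bump N k).integral_normed]
  rw [← h1]
  refine integral_mono (integrable_mollify k hf).norm (integrable_mollify k hf.norm) fun x => ?_
  simp only [mollify_apply]
  refine (norm_integral_le_integral_norm _).trans (le_of_eq ?_)
  congr 1
  ext t
  rw [norm_smul, Real.norm_of_nonneg ((bump N k).nonneg_normed _), smul_eq_mul]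

theorem tendsto_integral_norm_mollify_sub_of_continuous {f : Space N → F}
    (hf : Continuous f) (hc : HasCompactSupport f) :
    Tendsto (fun k => ∫ x, ‖mollify k f x - f x‖) atTop (𝓝 0) := by
  obtain ⟨C, hC⟩ := hf.bounded_above_of_compact_support hc
  have hK : IsCompact (Metric.cthickening 1 (tsupport f)) := hc.isCompact.cthickening
  have h0 : (0 : ℝ) = ∫ x : Space N, (0 : ℝ) := by simp
  rw [h0]
  refine tendsto_integral_of_dominated_convergence
    ((Metric.cthickening 1 (tsupport f)).indicator fun _ => 4 * C) ?_ ?_ ?_ ?_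
  · intro k
    exact ((contDiff_mollify k hf.locallyIntegrable).continuous.sub hf).norm.aestronglyMeasurable
  · exact (integrable_indicator_iff hK.measurableSet).2
      (integrableOn_const hK.measure_lt_top.ne)
  · intro k
    refine Eventually.of_forall fun x => ?_
    rw [norm_norm]
    by_cases hx : x ∈ Metric.cthickening 1 (tsupport f)
    · rw [indicator_of_mem hx]
      have := norm_mollify_le k hf.aestronglyMeasurable hC x
      linarith [norm_sub_le (mollify k f x) (f x), hC x]
    · rw [indicator_of_notMem hx]
      have h1 : f x = 0 := image_eq_zero_of_notMem_tsupport fun h =>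
        hx (Metric.self_subset_cthickening _ h)
      have h2 : mollify k f x = 0 := image_eq_zero_of_notMem_tsupport fun h =>
        hx (Metric.cthickening_mono (by
          simp only [bump]; rw [div_le_one (by positivity)]; linarith [Nat.cast_nonneg (α := ℝ) k])
          _ (tsupport_mollify_subset k f h))
      simp [h1, h2]
  · refine Eventually.of_forall fun x => ?_
    have := (tendsto_mollify hf x).sub_const (f x)
    simpa using this.norm

/-- Mollification contracts the L¹ norm, so the case of continuous functions with compact support
extends by density. -/
theorem tendsto_integral_norm_mollify_sub {f : Space N → F}
    (hf : Integrable f) : Tendsto (fun k => ∫ x, ‖mollify k f x - f x‖) atTop (𝓝 0) := by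
  rw [Metric.tendsto_atTop]
  intro ε hε
  obtain ⟨g, hgc, hg, hgcont, hgi⟩ := hf.exists_hasCompactSupport_integral_sub_le
    (ε := ε / 4) (by positivity)
  obtain ⟨n, hn⟩ := Metric.tendsto_atTop.1
    (tendsto_integral_norm_mollify_sub_of_continuous hgcont hgc) (ε / 4) (by positivity)
  refine ⟨n, fun k hk => ?_⟩
  have h1 := hn k hk
  rw [Real.dist_0_eq_abs, abs_of_nonneg (integral_nonneg fun _ => norm_nonneg _)] at h1 ⊢
  have hfg : Integrable (f - g) := hf.sub hgi
  have hd : mollify k f = mollify k (f - g) + mollify k g := by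
    rw [← mollify_add k hfg.locallyIntegrable hgi.locallyIntegrable, sub_add_cancel]
  have i1 := (integrable_mollify k hfg).norm
  have i2 := ((integrable_mollify k hgi).sub hgi).norm
  calc ∫ x, ‖mollify k f x - f x‖
      ≤ ∫ x, (‖mollify k (f - g) x‖ + ‖mollify k g x - g x‖ + ‖f x - g x‖) := by
        refine integral_mono ((integrable_mollify k hf).sub hf).norm
          ((i1.add i2).add hfg.norm) fun x => ?_
        have : mollify k f x - f x
            = mollify k (f - g) x + (mollify k g x - g x) - (f x - g x) := by
          rw [hd]; simp only [Pi.add_apply]; abel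
        simp only [this]
        exact (norm_sub_le _ _).trans (add_le_add_left (norm_add_le _ _) _)
    _ = (∫ x, ‖mollify k (f - g) x‖) + (∫ x, ‖mollify k g x - g x‖) + ∫ x, ‖f x - g x‖ := by
        have := integral_add (i1.add i2) hfg.norm
        simp only [Pi.add_apply, Pi.sub_apply] at this
        rw [this]
        congr 1
        exact integral_add i1 i2
    _ < ε := by
        have := integral_norm_mollify_le k hfg
        simp only [Pi.sub_apply] at this
        linarith

end Mollify

end

section

open scoped Convolution Manifold

/-! ### Weak divergence -/

theorem integrable_clm_apply {α E F : Type*} [MeasurableSpace α] {μ : Measure α}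
    [NormedAddCommGroup E] [NormedSpace ℝ E] [NormedAddCommGroup F] [NormedSpace ℝ F]
    {A : α → E →L[ℝ] F} {X : α → E} {C : ℝ} (hX : Integrable X μ) (hA : AEStronglyMeasurable A μ)
    (hC : ∀ᵐ x ∂μ, ‖A x‖ ≤ C) : Integrable (fun x => A x (X x)) μ := by
  refine Integrable.mono' (hX.norm.const_mul C) ?_ ?_
  · exact (ContinuousLinearMap.id ℝ (E →L[ℝ] F)).aestronglyMeasurable_comp₂ hA
      hX.aestronglyMeasurable
  · filter_upwards [hC] with x hx
    exact ((A x).le_opNorm _).trans (by gcongr)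

/-- `f ∈ L¹(Ω)` is the weak divergence of the vector field `X ∈ L¹(Ω)`. -/
structure HasWeakDiv (Ω : Set (Space N)) (X : Space N → Space N) (f : Space N → ℝ) : Prop where
  integrableOn : IntegrableOn X Ω
  integrableOn_div : IntegrableOn f Ω
  integral_eq : ∀ φ, IsTestFunction Ω φ →
    ∫ x in Ω, fderiv ℝ φ x (X x) = -∫ x in Ω, φ x * f x

theorem norm_fderiv_bounded {φ : Space N → ℝ} (hφ : ContDiff ℝ 1 φ) (hc : HasCompactSupport φ) :
    ∃ C, ∀ x, ‖fderiv ℝ φ x‖ ≤ C :=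
  (hφ.continuous_fderiv one_ne_zero).bounded_above_of_compact_support (hc.fderiv ℝ)

theorem integrable_fderiv_apply {μ : Measure (Space N)} {φ : Space N → ℝ} {X : Space N → Space N}
    (hφ : ContDiff ℝ 1 φ) (hc : HasCompactSupport φ) (hX : Integrable X μ) :
    Integrable (fun x => fderiv ℝ φ x (X x)) μ := by
  obtain ⟨C, hC⟩ := norm_fderiv_bounded hφ hc
  exact integrable_clm_apply hX (hφ.continuous_fderiv one_ne_zero).aestronglyMeasurable
    (Eventually.of_forall hC)

theorem integrable_mul_of_hasCompactSupport {μ : Measure (Space N)} {φ : Space N → ℝ}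
    {f : Space N → ℝ} (hφ : Continuous φ) (hc : HasCompactSupport φ) (hf : Integrable f μ) :
    Integrable (fun x => φ x * f x) μ := by
  obtain ⟨C, hC⟩ := hφ.bounded_above_of_compact_support hc
  exact hf.bdd_mul hφ.aestronglyMeasurable (Eventually.of_forall hC)

theorem eventually_isTestFunction_mollify (hΩ : IsOpen Ω) {φ : Space N → ℝ}
    (hφ : Continuous φ) (hc : HasCompactSupport φ) (hs : tsupport φ ⊆ Ω) :
    ∀ᶠ k in atTop, IsTestFunction Ω (mollify k φ) := by
  obtain ⟨δ, hδ, hδΩ⟩ := hc.isCompact.exists_cthickening_subset_open hΩ hs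
  filter_upwards [(tendsto_bump_rOut N).eventually (gt_mem_nhds hδ)] with k hk
  have h := (tsupport_mollify_subset k φ).trans (Metric.cthickening_mono hk.le _)
  exact ⟨contDiff_mollify k hφ.locallyIntegrable,
    hc.isCompact.cthickening.of_isClosed_subset (isClosed_tsupport _) h, h.trans hδΩ⟩

namespace HasWeakDiv

variable {X Y : Space N → Space N} {f g : Space N → ℝ}

/-- Mollifications of φ are test functions for large `k` and converge to φ, with bounded
derivatives. The extension to C¹ is needed because the product of a test function and a C¹
coefficient is only C¹. -/
theorem integral_eq_of_contDiff_one (h : HasWeakDiv Ω X f) (hΩ : IsOpen Ω) {φ : Space N → ℝ}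
    (hφ : ContDiff ℝ 1 φ) (hc : HasCompactSupport φ) (hs : tsupport φ ⊆ Ω) :
    ∫ x in Ω, fderiv ℝ φ x (X x) = -∫ x in Ω, φ x * f x := by
  have hev := eventually_isTestFunction_mollify hΩ hφ.continuous hc hs
  obtain ⟨C, hC⟩ := norm_fderiv_bounded hφ hc
  obtain ⟨C', hC'⟩ := hφ.continuous.bounded_above_of_compact_support hc
  have hcont := hφ.continuous_fderiv one_ne_zero
  have h1 : Tendsto (fun k => ∫ x in Ω, fderiv ℝ (mollify k φ) x (X x)) atTop
      (𝓝 (∫ x in Ω, fderiv ℝ φ x (X x))) := by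
    refine tendsto_integral_of_dominated_convergence (fun x => 3 * C * ‖X x‖) ?_
      (h.integrableOn.norm.const_mul _) ?_ ?_
    · intro k
      exact (ContinuousLinearMap.id ℝ (Space N →L[ℝ] ℝ)).aestronglyMeasurable_comp₂
        (((contDiff_mollify k hφ.continuous.locallyIntegrable).of_le
          (by exact_mod_cast le_top)).continuous_fderiv one_ne_zero).aestronglyMeasurable
        h.integrableOn.aestronglyMeasurable
    · intro k
      refine Eventually.of_forall fun x => ?_
      rw [fderiv_mollify k hφ hc]
      exact (ContinuousLinearMap.le_opNorm _ _).trans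
        (mul_le_mul_of_nonneg_right (norm_mollify_le k hcont.aestronglyMeasurable hC x)
          (norm_nonneg _))
    · refine Eventually.of_forall fun x => ?_
      simp_rw [fderiv_mollify _ hφ hc]
      exact ((ContinuousLinearMap.apply ℝ ℝ (X x)).continuous.tendsto _).comp
        (tendsto_mollify hcont x)
  have h2 : Tendsto (fun k => ∫ x in Ω, mollify k φ x * f x) atTop
      (𝓝 (∫ x in Ω, φ x * f x)) := by
    refine tendsto_integral_of_dominated_convergence (fun x => 3 * C' * ‖f x‖) ?_
      (h.integrableOn_div.norm.const_mul _) ?_ ?_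
    · intro k
      exact (contDiff_mollify k hφ.continuous.locallyIntegrable).continuous.aestronglyMeasurable.mul
        h.integrableOn_div.aestronglyMeasurable
    · intro k
      refine Eventually.of_forall fun x => ?_
      rw [norm_mul]
      exact mul_le_mul_of_nonneg_right (norm_mollify_le k hφ.continuous.aestronglyMeasurable hC' x)
          (norm_nonneg _)
    · exact Eventually.of_forall fun x => (tendsto_mollify hφ.continuous x).mul_const _
  refine tendsto_nhds_unique h1 (h2.neg.congr' ?_)
  filter_upwards [hev] with k hk
  exact (h.integral_eq _ hk).symm

theorem add (hX : HasWeakDiv Ω X f) (hY : HasWeakDiv Ω Y g) :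
    HasWeakDiv Ω (fun x => X x + Y x) (fun x => f x + g x) where
  integrableOn := hX.integrableOn.add hY.integrableOn
  integrableOn_div := hX.integrableOn_div.add hY.integrableOn_div
  integral_eq φ hφ := by
    have h1 : ContDiff ℝ 1 φ := hφ.smooth.of_le (by exact_mod_cast le_top)
    simp_rw [map_add, mul_add]
    rw [integral_add (integrable_fderiv_apply h1 hφ.hasCompactSupport hX.integrableOn)
      (integrable_fderiv_apply h1 hφ.hasCompactSupport hY.integrableOn),
      integral_add
        (integrable_mul_of_hasCompactSupport h1.continuous hφ.hasCompactSupport hX.integrableOn_div)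
        (integrable_mul_of_hasCompactSupport h1.continuous hφ.hasCompactSupport
          hY.integrableOn_div), hX.integral_eq φ hφ, hY.integral_eq φ hφ]
    ring

theorem const_smul (c : ℝ) (hX : HasWeakDiv Ω X f) :
    HasWeakDiv Ω (fun x => c • X x) (fun x => c * f x) where
  integrableOn := hX.integrableOn.smul c
  integrableOn_div := hX.integrableOn_div.const_mul c
  integral_eq φ hφ := by
    simp_rw [map_smul, mul_left_comm _ c, smul_eq_mul]
    rw [integral_const_mul, integral_const_mul, hX.integral_eq φ hφ]
    ring

theorem zero : HasWeakDiv Ω (fun _ => 0) (fun _ => 0) where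
  integrableOn := integrableOn_zero
  integrableOn_div := integrableOn_zero
  integral_eq φ _ := by simp

theorem sum {ι : Type*} (s : Finset ι) {X : ι → Space N → Space N} {f : ι → Space N → ℝ}
    (h : ∀ i ∈ s, HasWeakDiv Ω (X i) (f i)) :
    HasWeakDiv Ω (fun x => ∑ i ∈ s, X i x) (fun x => ∑ i ∈ s, f i x) := by
  classical
  induction s using Finset.induction_on with
  | empty => simpa using zero
  | insert a s ha ih =>
    simp_rw [Finset.sum_insert ha]
    exact (h a (Finset.mem_insert_self a s)).add
      (ih fun i hi => h i (Finset.mem_insert_of_mem hi))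

theorem congr (hX : HasWeakDiv Ω X f) (h1 : ∀ᵐ x ∂(volume.restrict Ω), X x = Y x)
    (h2 : ∀ᵐ x ∂(volume.restrict Ω), f x = g x) : HasWeakDiv Ω Y g where
  integrableOn := Integrable.congr hX.integrableOn h1
  integrableOn_div := Integrable.congr hX.integrableOn_div h2
  integral_eq φ hφ := by
    have e1 : ∫ x in Ω, fderiv ℝ φ x (Y x) = ∫ x in Ω, fderiv ℝ φ x (X x) :=
      integral_congr_ae (by filter_upwards [h1] with x hx; rw [hx])
    have e2 : ∫ x in Ω, φ x * g x = ∫ x in Ω, φ x * f x :=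
      integral_congr_ae (by filter_upwards [h2] with x hx; rw [hx])
    rw [e1, e2, hX.integral_eq φ hφ]

end HasWeakDiv

/-! ### Bounded C¹ coefficients -/

/-- `h` is of class `C¹` on `Ω` and bounded there, together with its derivative. -/
structure IsC1Bounded {F : Type*} [NormedAddCommGroup F] [NormedSpace ℝ F] (Ω : Set (Space N))
    (h : Space N → F) : Prop where
  contDiffOn : ContDiffOn ℝ 1 h Ω
  bounded : ∃ C, ∀ x ∈ Ω, ‖h x‖ ≤ C
  bounded_fderiv : ∃ C, ∀ x ∈ Ω, ‖fderiv ℝ h x‖ ≤ C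

namespace IsC1Bounded

variable {F : Type*} [NormedAddCommGroup F] [NormedSpace ℝ F] {h : Space N → F}

theorem differentiableAt (hh : IsC1Bounded Ω h) (hΩ : IsOpen Ω) {x : Space N} (hx : x ∈ Ω) :
    DifferentiableAt ℝ h x :=
  (hh.contDiffOn.contDiffAt (hΩ.mem_nhds hx)).differentiableAt one_ne_zero

theorem id (hb : Bornology.IsBounded Ω) :
    IsC1Bounded Ω (fun x : Space N => x) where
  contDiffOn := contDiffOn_id
  bounded := hb.exists_norm_le
  bounded_fderiv := ⟨1, fun x _ => by simpa using ContinuousLinearMap.norm_id_le⟩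

theorem fderiv_inner_left (hΩ : IsOpen Ω) {a : Space N → Space N} (ha : IsC1Bounded Ω a)
    (c : Space N) {x : Space N} (hx : x ∈ Ω) (v : Space N) :
    fderiv ℝ (fun x => ⟪c, a x⟫_ℝ) x v = ⟪c, fderiv ℝ a x v⟫_ℝ := by
  have := ((innerSL ℝ c).hasFDerivAt.comp x (ha.differentiableAt hΩ hx).hasFDerivAt).fderiv
  have h2 : (fun x => ⟪c, a x⟫_ℝ) = (innerSL ℝ c) ∘ a := by ext; simp
  rw [h2, this]
  simp

theorem inner_left (hΩ : IsOpen Ω) {a : Space N → Space N} (ha : IsC1Bounded Ω a) (c : Space N) :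
    IsC1Bounded Ω (fun x => ⟪c, a x⟫_ℝ) where
  contDiffOn := contDiffOn_const.inner ℝ ha.contDiffOn
  bounded := by
    obtain ⟨C, hC⟩ := ha.bounded
    exact ⟨‖c‖ * C, fun x hx => (norm_inner_le_norm _ _).trans (by gcongr; exact hC x hx)⟩
  bounded_fderiv := by
    obtain ⟨C, hC⟩ := ha.bounded_fderiv
    refine ⟨‖c‖ * C, fun x hx => ?_⟩
    have hC0 : 0 ≤ C := (norm_nonneg _).trans (hC x hx)
    refine ContinuousLinearMap.opNorm_le_bound _ (by positivity) fun v => ?_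
    rw [fderiv_inner_left hΩ ha c hx, mul_assoc]
    refine (norm_inner_le_norm _ _).trans ?_
    gcongr
    exact (ContinuousLinearMap.le_opNorm _ _).trans (by gcongr; exact hC x hx)

theorem fderiv_inner (hΩ : IsOpen Ω) {a b : Space N → Space N} (ha : IsC1Bounded Ω a)
    (hb : IsC1Bounded Ω b) {x : Space N} (hx : x ∈ Ω) (v : Space N) :
    fderiv ℝ (fun x => ⟪a x, b x⟫_ℝ) x v
      = ⟪a x, fderiv ℝ b x v⟫_ℝ + ⟪fderiv ℝ a x v, b x⟫_ℝ :=
  fderiv_inner_apply ℝ (ha.differentiableAt hΩ hx) (hb.differentiableAt hΩ hx) v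

theorem inner (hΩ : IsOpen Ω) {a b : Space N → Space N} (ha : IsC1Bounded Ω a)
    (hb : IsC1Bounded Ω b) : IsC1Bounded Ω (fun x => ⟪a x, b x⟫_ℝ) where
  contDiffOn := ha.contDiffOn.inner ℝ hb.contDiffOn
  bounded := by
    obtain ⟨A, hA⟩ := ha.bounded
    obtain ⟨B, hB⟩ := hb.bounded
    exact ⟨A * B, fun x hx => (norm_inner_le_norm _ _).trans
      (mul_le_mul (hA x hx) (hB x hx) (norm_nonneg _) ((norm_nonneg _).trans (hA x hx)))⟩
  bounded_fderiv := by
    obtain ⟨A, hA⟩ := ha.bounded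
    obtain ⟨B, hB⟩ := hb.bounded
    obtain ⟨A', hA'⟩ := ha.bounded_fderiv
    obtain ⟨B', hB'⟩ := hb.bounded_fderiv
    refine ⟨A * B' + A' * B, fun x hx => ?_⟩
    have a0 := (norm_nonneg _).trans (hA x hx)
    have b0 := (norm_nonneg _).trans (hB x hx)
    have a1 := (norm_nonneg _).trans (hA' x hx)
    have b1 := (norm_nonneg _).trans (hB' x hx)
    refine ContinuousLinearMap.opNorm_le_bound _ (by positivity) fun v => ?_
    rw [fderiv_inner hΩ ha hb hx]
    have h1 := (fderiv ℝ a x).le_of_opNorm_le (hA' x hx) v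
    have h2 := (fderiv ℝ b x).le_of_opNorm_le (hB' x hx) v
    calc ‖⟪a x, fderiv ℝ b x v⟫_ℝ + ⟪fderiv ℝ a x v, b x⟫_ℝ‖
        ≤ ‖a x‖ * ‖fderiv ℝ b x v‖ + ‖fderiv ℝ a x v‖ * ‖b x‖ :=
          (norm_add_le _ _).trans (add_le_add (norm_inner_le_norm _ _) (norm_inner_le_norm _ _))
      _ ≤ A * (B' * ‖v‖) + (A' * ‖v‖) * B := by
          gcongr
          · exact hA x hx
          · exact hB x hx
      _ = _ := by ring

end IsC1Bounded

theorem IsTestFunction.isC1Bounded {φ : Space N → ℝ} (hφ : ContDiff ℝ ∞ φ)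
    (hc : HasCompactSupport φ) : IsC1Bounded Ω φ where
  contDiffOn := (hφ.of_le (by exact_mod_cast le_top)).contDiffOn
  bounded := by
    obtain ⟨C, hC⟩ := hφ.continuous.bounded_above_of_compact_support hc
    exact ⟨C, fun x _ => hC x⟩
  bounded_fderiv := by
    obtain ⟨C, hC⟩ := norm_fderiv_bounded (hφ.of_le (by exact_mod_cast le_top)) hc
    exact ⟨C, fun x _ => hC x⟩

/-- The product `h * φ` is C¹ with compact support in `Ω`, so it may be tested against `X`; the
product rule does the rest. -/
theorem HasWeakDiv.smul {X : Space N → Space N} {f h : Space N → ℝ} (hX : HasWeakDiv Ω X f)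
    (hΩ : IsOpen Ω) (hh : IsC1Bounded Ω h) :
    HasWeakDiv Ω (fun x => h x • X x) (fun x => h x * f x + fderiv ℝ h x (X x)) := by
  obtain ⟨C, hC⟩ := hh.bounded
  obtain ⟨C', hC'⟩ := hh.bounded_fderiv
  have hm : AEStronglyMeasurable h (volume.restrict Ω) :=
    hh.contDiffOn.continuousOn.aestronglyMeasurable hΩ.measurableSet
  have hbd : ∀ᵐ x ∂(volume.restrict Ω), ‖h x‖ ≤ C :=
    (ae_restrict_iff' hΩ.measurableSet).2 (Eventually.of_forall hC)
  have hbd' : ∀ᵐ x ∂(volume.restrict Ω), ‖fderiv ℝ h x‖ ≤ C' :=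
    (ae_restrict_iff' hΩ.measurableSet).2 (Eventually.of_forall hC')
  have i1 : IntegrableOn (fun x => h x * f x) Ω := hX.integrableOn_div.bdd_mul hm hbd
  have i2 : IntegrableOn (fun x => fderiv ℝ h x (X x)) Ω :=
    integrable_clm_apply hX.integrableOn (measurable_fderiv ℝ h).aestronglyMeasurable hbd'
  refine ⟨hX.integrableOn.bdd_smul C hm hbd, i1.add i2, fun φ hφ => ?_⟩
  have h1 : ContDiff ℝ 1 φ := hφ.smooth.of_le (by exact_mod_cast le_top)
  have hts : tsupport (fun x => h x * φ x) ⊆ tsupport φ := tsupport_mul_subset_right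
  have hhφ : ContDiff ℝ 1 (fun x => h x * φ x) :=
    contDiff_of_contDiffOn_of_tsupport_subset hΩ (hh.contDiffOn.mul h1.contDiffOn)
      (hts.trans hφ.tsupport_subset)
  have hcomp : HasCompactSupport (fun x => h x * φ x) :=
    hφ.hasCompactSupport.of_isClosed_subset (isClosed_tsupport _) hts
  have key := hX.integral_eq_of_contDiff_one hΩ hhφ hcomp (hts.trans hφ.tsupport_subset)
  have hd : ∀ x ∈ Ω, fderiv ℝ (fun x => h x * φ x) x (X x)
      = fderiv ℝ φ x (h x • X x) + φ x * fderiv ℝ h x (X x) := by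
    intro x hx
    rw [fderiv_fun_mul (hh.differentiableAt hΩ hx) (h1.differentiable one_ne_zero x)]
    simp
  have hadd := integral_add (integrable_fderiv_apply h1 hφ.hasCompactSupport
      (hX.integrableOn.bdd_smul C hm hbd))
      (integrable_mul_of_hasCompactSupport h1.continuous hφ.hasCompactSupport i2)
  simp only [Pi.smul_apply'] at hadd
  rw [setIntegral_congr_fun hΩ.measurableSet hd, hadd] at key
  simp_rw [mul_add]
  rw [integral_add (integrable_mul_of_hasCompactSupport h1.continuous hφ.hasCompactSupport i1)
    (integrable_mul_of_hasCompactSupport h1.continuous hφ.hasCompactSupport i2)]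
  have : ∫ x in Ω, φ x * (h x * f x) = ∫ x in Ω, h x * φ x * f x := by
    congr 1; ext x; ring
  rw [this]
  linarith

/-! ### Vector fields built from a Sobolev function -/

theorem weak_gradient_iff {m : Space N → ℝ} {Dm : Space N → Space N}
    (h1 : IntegrableOn m Ω) (h2 : IntegrableOn Dm Ω) {φ : Space N → ℝ} (hφ : IsTestFunction Ω φ) :
    (∫ x in Ω, m x • gradient φ x = -∫ x in Ω, φ x • Dm x) ↔
      ∀ c, ∫ x in Ω, m x * fderiv ℝ φ x c = -∫ x in Ω, φ x * ⟪Dm x, c⟫_ℝ := by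
  have hd : ContDiff ℝ 1 φ := hφ.smooth.of_le (by exact_mod_cast le_top)
  obtain ⟨C, hC⟩ := norm_fderiv_bounded hd hφ.hasCompactSupport
  obtain ⟨C', hC'⟩ := hd.continuous.bounded_above_of_compact_support hφ.hasCompactSupport
  have e : gradient φ = fun x => (InnerProductSpace.toDual ℝ (Space N)).symm (fderiv ℝ φ x) := rfl
  have hgc : Continuous (gradient φ) := by
    rw [e]
    exact (InnerProductSpace.toDual ℝ (Space N)).symm.continuous.comp
      (hd.continuous_fderiv one_ne_zero)
  have i1 : Integrable (fun x => m x • gradient φ x) (volume.restrict Ω) := by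
    refine h1.smul_bdd C hgc.aestronglyMeasurable (Eventually.of_forall fun x => ?_)
    rw [e]; simpa using hC x
  have i2 : Integrable (fun x => φ x • Dm x) (volume.restrict Ω) :=
    h2.bdd_smul C' hd.continuous.aestronglyMeasurable (Eventually.of_forall hC')
  have e1 : ∀ x c, ⟪c, gradient φ x⟫_ℝ = fderiv ℝ φ x c := fun x c => by
    rw [real_inner_comm, inner_gradient_left]
  have e2 : ∀ c, ⟪c, ∫ x in Ω, m x • gradient φ x⟫_ℝ = ∫ x in Ω, m x * fderiv ℝ φ x c := by
    intro c
    rw [← integral_inner i1]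
    simp only [inner_smul_right, e1]
  have e3 : ∀ c, ⟪c, -∫ x in Ω, φ x • Dm x⟫_ℝ = -∫ x in Ω, φ x * ⟪Dm x, c⟫_ℝ := by
    intro c
    rw [inner_neg_right, ← integral_inner i2]
    simp only [inner_smul_right, real_inner_comm]
  constructor
  · intro h c
    rw [← e2, ← e3, h]
  · intro h
    exact ext_inner_left ℝ fun c => by rw [e2, e3, h c]

theorem MemW11.integral_mul_fderiv {m : Space N → ℝ} {Dm : Space N → Space N}
    (hm : MemW11 Ω m Dm) {φ : Space N → ℝ} (hφ : IsTestFunction Ω φ) (c : Space N) :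
    ∫ x in Ω, m x * fderiv ℝ φ x c = -∫ x in Ω, φ x * ⟪Dm x, c⟫_ℝ :=
  (weak_gradient_iff hm.integrableOn hm.integrableOn_grad hφ).1 (hm.weak_gradient φ hφ) c

theorem MemW11.hasWeakDiv_smul_const {m : Space N → ℝ} {Dm : Space N → Space N}
    (hm : MemW11 Ω m Dm) (c : Space N) :
    HasWeakDiv Ω (fun x => m x • c) (fun x => ⟪Dm x, c⟫_ℝ) where
  integrableOn := hm.integrableOn.smul_const c
  integrableOn_div := hm.integrableOn_grad.inner_const c
  integral_eq φ hφ := by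
    simpa only [map_smul, smul_eq_mul] using hm.integral_mul_fderiv hφ c

/-- The position vector is the sum of its coordinates times the basis vectors, which reduces the
claim to constant directions with C¹ coefficients. The term `N * m x` is m times the divergence of
the position vector. -/
theorem MemW11.hasWeakDiv_smul_id {m : Space N → ℝ} {Dm : Space N → Space N}
    (hm : MemW11 Ω m Dm) (hΩ : IsOpen Ω) (hb : Bornology.IsBounded Ω) :
    HasWeakDiv Ω (fun x => m x • x) (fun x => ⟪Dm x, x⟫_ℝ + N * m x) := by
  let b := EuclideanSpace.basisFun (Fin N) ℝ
  have hid : IsC1Bounded Ω (fun x : Space N => x) := IsC1Bounded.id hb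
  have h := HasWeakDiv.sum Finset.univ fun i _ =>
    (hm.hasWeakDiv_smul_const (b i)).smul hΩ (hid.inner_left hΩ (b i))
  refine h.congr (Eventually.of_forall fun x => ?_) ?_
  · simp only [smul_comm _ (m x)]
    rw [← Finset.smul_sum, b.sum_repr' x]
  · refine (ae_restrict_iff' hΩ.measurableSet).2 (Eventually.of_forall fun x hx => ?_)
    simp only [Finset.sum_add_distrib]
    congr 1
    · have := b.sum_inner_mul_inner (Dm x) x
      rw [← this]
      exact Finset.sum_congr rfl fun i _ => mul_comm _ _
    · simp only [hid.fderiv_inner_left hΩ _ hx]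
      simp [inner_smul_right]

/-- The trace of an endomorphism of `ℝ^N`, computed in the standard basis. -/
def tr (A : Space N →L[ℝ] Space N) : ℝ :=
  ∑ i, ⟪EuclideanSpace.basisFun (Fin N) ℝ i, A (EuclideanSpace.basisFun (Fin N) ℝ i)⟫_ℝ

theorem sum_inner_apply_mul (b : OrthonormalBasis (Fin N) ℝ (Space N))
    (A : Space N →L[ℝ] Space N) (v w : Space N) :
    ∑ i, ⟪b i, v⟫_ℝ * ⟪w, A (b i)⟫_ℝ = ⟪w, A v⟫_ℝ := by
  conv_rhs => rw [← b.sum_repr' v, map_sum, inner_sum]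
  simp [inner_smul_right]

theorem contDiff_fderiv_apply_const {φ : Space N → ℝ} (hφ : ContDiff ℝ ∞ φ) (c : Space N) :
    ContDiff ℝ ∞ (fun x => fderiv ℝ φ x c) :=
  (hφ.fderiv_right (m := ∞) (by simp)).clm_apply contDiff_const

theorem IsTestFunction.fderiv_apply {φ : Space N → ℝ} (hφ : IsTestFunction Ω φ) (c : Space N) :
    IsTestFunction Ω (fun x => fderiv ℝ φ x c) where
  smooth := contDiff_fderiv_apply_const hφ.smooth c
  hasCompactSupport := hφ.hasCompactSupport.fderiv_apply ℝ c
  tsupport_subset := (tsupport_fderiv_apply_subset ℝ c).trans hφ.tsupport_subset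

theorem fderiv_fderiv_apply_comm {φ : Space N → ℝ} (hφ : ContDiff ℝ ∞ φ) (a c x : Space N) :
    fderiv ℝ (fun y => fderiv ℝ φ y c) x a = fderiv ℝ (fun y => fderiv ℝ φ y a) x c := by
  have hs : IsSymmSndFDerivAt ℝ φ x :=
    hφ.contDiffAt.isSymmSndFDerivAt (by simpa using ENat.LEInfty.out)
  have hd : DifferentiableAt ℝ (fderiv ℝ φ) x :=
    ((hφ.fderiv_right (m := ∞) (by simp)).differentiable (by simp)) x
  have h : ∀ u v : Space N, fderiv ℝ (fun y => fderiv ℝ φ y u) x v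
      = fderiv ℝ (fderiv ℝ φ) x v u := by
    intro u v
    rw [fderiv_clm_apply hd (differentiableAt_const u)]
    simp
  rw [h, h]
  exact hs a c

/-- Formally the divergence is ∂_c∂_a m - ∂_a∂_c m. Weakly, both derivatives are moved to the test
function, whose Hessian is symmetric; no second derivative of m is needed. -/
theorem MemW11.hasWeakDiv_antisymm_const {m : Space N → ℝ} {Dm : Space N → Space N}
    (hm : MemW11 Ω m Dm) (a c : Space N) :
    HasWeakDiv Ω (fun x => ⟪Dm x, a⟫_ℝ • c - ⟪Dm x, c⟫_ℝ • a) (fun _ => 0) where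
  integrableOn := ((hm.integrableOn_grad.inner_const a).smul_const c).sub
    ((hm.integrableOn_grad.inner_const c).smul_const a)
  integrableOn_div := integrableOn_zero
  integral_eq φ hφ := by
    have i1 : ∀ a c, IntegrableOn (fun x => fderiv ℝ φ x c * ⟪Dm x, a⟫_ℝ) Ω := fun a c =>
      integrable_mul_of_hasCompactSupport (hφ.fderiv_apply c).smooth.continuous
        (hφ.fderiv_apply c).hasCompactSupport (hm.integrableOn_grad.inner_const a)
    have h1 := hm.integral_mul_fderiv (hφ.fderiv_apply c) a
    have h2 := hm.integral_mul_fderiv (hφ.fderiv_apply a) c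
    simp_rw [fderiv_fderiv_apply_comm hφ.smooth a c] at h1
    rw [h2, neg_inj] at h1
    simp only [map_sub, map_smul, smul_eq_mul, mul_zero, integral_zero, neg_zero]
    simp_rw [mul_comm ⟪Dm _, _⟫_ℝ]
    rw [integral_sub (i1 a c) (i1 c a), h1, sub_self]

/-- Expanding `a` in the standard basis reduces to constant fields; derivatives fall on the
coefficients of `a` only. The same device for `c` gives `MemW11.hasWeakDiv_antisymm`. -/
theorem MemW11.hasWeakDiv_antisymm_left {m : Space N → ℝ} {Dm : Space N → Space N}
    (hm : MemW11 Ω m Dm) (hΩ : IsOpen Ω) {a : Space N → Space N} (ha : IsC1Bounded Ω a)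
    (c : Space N) :
    HasWeakDiv Ω (fun x => ⟪Dm x, a x⟫_ℝ • c - ⟪Dm x, c⟫_ℝ • a x)
      (fun x => ⟪Dm x, fderiv ℝ a x c⟫_ℝ - tr (fderiv ℝ a x) * ⟪Dm x, c⟫_ℝ) := by
  let b := EuclideanSpace.basisFun (Fin N) ℝ
  have h := HasWeakDiv.sum Finset.univ fun i _ =>
    (hm.hasWeakDiv_antisymm_const (b i) c).smul hΩ (ha.inner_left hΩ (b i))
  refine h.congr (Eventually.of_forall fun x => ?_) ?_
  · simp only [smul_sub, Finset.sum_sub_distrib, smul_smul]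
    congr 1
    · rw [← Finset.sum_smul, ← b.sum_inner_mul_inner (Dm x) (a x)]
      simp only [mul_comm]
    · conv_rhs => rw [← b.sum_repr' (a x), Finset.smul_sum]
      simp only [smul_smul, mul_comm]
  · refine (ae_restrict_iff' hΩ.measurableSet).2 (Eventually.of_forall fun x hx => ?_)
    simp only [ha.fderiv_inner_left hΩ _ hx, map_sub, map_smul, inner_sub_right, inner_smul_right,
      mul_zero, zero_add, Finset.sum_sub_distrib]
    congr 1
    · rw [← b.sum_inner_mul_inner]
    · rw [← Finset.mul_sum, mul_comm, tr]

theorem MemW11.hasWeakDiv_antisymm {m : Space N → ℝ} {Dm : Space N → Space N}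
    (hm : MemW11 Ω m Dm) (hΩ : IsOpen Ω) {a c : Space N → Space N} (ha : IsC1Bounded Ω a)
    (hc : IsC1Bounded Ω c) :
    HasWeakDiv Ω (fun x => ⟪Dm x, a x⟫_ℝ • c x - ⟪Dm x, c x⟫_ℝ • a x)
      (fun x => ⟪Dm x, fderiv ℝ a x (c x)⟫_ℝ - tr (fderiv ℝ a x) * ⟪Dm x, c x⟫_ℝ
        + ⟪Dm x, a x⟫_ℝ * tr (fderiv ℝ c x) - ⟪Dm x, fderiv ℝ c x (a x)⟫_ℝ) := by
  let b := EuclideanSpace.basisFun (Fin N) ℝ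
  have h := HasWeakDiv.sum Finset.univ fun i _ =>
    (hm.hasWeakDiv_antisymm_left hΩ ha (b i)).smul hΩ (hc.inner_left hΩ (b i))
  refine h.congr (Eventually.of_forall fun x => ?_) ?_
  · simp only [smul_sub, Finset.sum_sub_distrib, smul_smul]
    congr 1
    · conv_rhs => rw [← b.sum_repr' (c x), Finset.smul_sum]
      simp only [smul_smul, mul_comm]
    · rw [← Finset.sum_smul, ← b.sum_inner_mul_inner (Dm x) (c x)]
      simp only [mul_comm]
  · refine (ae_restrict_iff' hΩ.measurableSet).2 (Eventually.of_forall fun x hx => ?_)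
    simp only [hc.fderiv_inner_left hΩ _ hx, map_sub, map_smul, inner_sub_right, inner_smul_right,
      mul_sub, Finset.sum_add_distrib, Finset.sum_sub_distrib]
    have e1 := sum_inner_apply_mul b (fderiv ℝ a x) (c x) (Dm x)
    have e2 := b.sum_inner_mul_inner (Dm x) (c x)
    have e3 := b.sum_inner_mul_inner (Dm x) (fderiv ℝ c x (a x))
    rw [e1, e3, ← Finset.mul_sum]
    have e4 : ∑ i, ⟪b i, c x⟫_ℝ * (tr (fderiv ℝ a x) * ⟪Dm x, b i⟫_ℝ)
        = tr (fderiv ℝ a x) * ⟪Dm x, c x⟫_ℝ := by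
      rw [← e2, Finset.mul_sum]
      exact Finset.sum_congr rfl fun i _ => by ring
    have e5 : ∑ i, ⟪b i, fderiv ℝ c x (b i)⟫_ℝ = tr (fderiv ℝ c x) := rfl
    rw [e4, e5]
    ring

end

section

open scoped Convolution Manifold

/-! ### The chain rule for Sobolev functions -/

theorem gradient_eq_zero_of_notMem_tsupport {ζ : Space N → ℝ} {x : Space N} (hx : x ∉ tsupport ζ) :
    gradient ζ x = 0 := by
  have : fderiv ℝ ζ x = 0 := image_eq_zero_of_notMem_tsupport fun h =>
    hx (tsupport_fderiv_subset ℝ h)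
  simp [gradient, this]

theorem continuous_gradient {ζ : Space N → ℝ} (hζ : ContDiff ℝ 1 ζ) : Continuous (gradient ζ) :=
  (InnerProductSpace.toDual ℝ (Space N)).symm.continuous.comp
    (hζ.continuous_fderiv one_ne_zero)

theorem norm_gradient (ζ : Space N → ℝ) (x : Space N) : ‖gradient ζ x‖ = ‖fderiv ℝ ζ x‖ := by
  simp [gradient]

/-- After a cutoff the function belongs to W^{1,1} of the whole space, where it can be mollified
without regard to ∂Ω. -/
theorem MemW11.cutoff {m ζ : Space N → ℝ} {Dm : Space N → Space N} (hm : MemW11 Ω m Dm)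
    (hζ : IsTestFunction Ω ζ) :
    MemW11 univ (fun x => ζ x * m x) (fun x => ζ x • Dm x + m x • gradient ζ x) := by
  have hd : ContDiff ℝ 1 ζ := hζ.smooth.of_le (by exact_mod_cast le_top)
  obtain ⟨C, hC⟩ := norm_fderiv_bounded hd hζ.hasCompactSupport
  obtain ⟨C', hC'⟩ := hd.continuous.bounded_above_of_compact_support hζ.hasCompactSupport
  have z1 : ∀ x, x ∉ Ω → ζ x = 0 := fun x hx =>
    image_eq_zero_of_notMem_tsupport fun h => hx (hζ.tsupport_subset h)
  have z2 : ∀ x, x ∉ Ω → gradient ζ x = 0 := fun x hx =>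
    gradient_eq_zero_of_notMem_tsupport fun h => hx (hζ.tsupport_subset h)
  have i1 : IntegrableOn (fun x => ζ x * m x) Ω :=
    integrable_mul_of_hasCompactSupport hd.continuous hζ.hasCompactSupport hm.integrableOn
  have i2 : IntegrableOn (fun x => ζ x • Dm x) Ω :=
    hm.integrableOn_grad.bdd_smul C' hd.continuous.aestronglyMeasurable (Eventually.of_forall hC')
  have i3 : IntegrableOn (fun x => m x • gradient ζ x) Ω :=
    hm.integrableOn.smul_bdd C (continuous_gradient hd).aestronglyMeasurable
      (Eventually.of_forall fun x => by rw [norm_gradient]; exact hC x)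
  have j1 : Integrable (fun x => ζ x * m x) :=
    i1.integrable_of_forall_notMem_eq_zero fun x hx => by simp [z1 x hx]
  have j2 : Integrable (fun x => ζ x • Dm x + m x • gradient ζ x) :=
    (i2.add i3).integrable_of_forall_notMem_eq_zero fun x hx => by simp [z1 x hx, z2 x hx]
  refine ⟨j1.integrableOn, j2.integrableOn, fun φ hφ =>
    (weak_gradient_iff j1.integrableOn j2.integrableOn hφ).2 fun c => ?_⟩
  have hφ1 : ContDiff ℝ 1 φ := hφ.smooth.of_le (by exact_mod_cast le_top)
  have ht : IsTestFunction Ω (fun x => ζ x * φ x) :=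
    ⟨hζ.smooth.mul hφ.smooth, hζ.hasCompactSupport.mul_right,
      tsupport_mul_subset_left.trans hζ.tsupport_subset⟩
  have key := hm.integral_mul_fderiv ht c
  have e : ∀ x, m x * fderiv ℝ (fun x => ζ x * φ x) x c
      = fderiv ℝ φ x c * (ζ x * m x) + φ x * (m x * fderiv ℝ ζ x c) := by
    intro x
    rw [fderiv_fun_mul (hd.differentiable one_ne_zero x) (hφ1.differentiable one_ne_zero x)]
    simp only [add_apply, smul_apply, smul_eq_mul]
    ring
  have k1 : IntegrableOn (fun x => fderiv ℝ φ x c * (ζ x * m x)) Ω :=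
    integrable_mul_of_hasCompactSupport (hφ.fderiv_apply c).smooth.continuous
      (hφ.fderiv_apply c).hasCompactSupport i1
  have eg : ∀ x, ⟪m x • gradient ζ x, c⟫_ℝ = m x * fderiv ℝ ζ x c := by
    intro x
    rw [real_inner_smul_left, inner_gradient_left]
  have k2 : IntegrableOn (fun x => φ x * (m x * fderiv ℝ ζ x c)) Ω := by
    refine integrable_mul_of_hasCompactSupport hφ1.continuous hφ.hasCompactSupport ?_
    refine (i3.inner_const c).congr (Eventually.of_forall fun x => eg x)
  have k3 : IntegrableOn (fun x => φ x * (ζ x * ⟪Dm x, c⟫_ℝ)) Ω := by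
    refine integrable_mul_of_hasCompactSupport hφ1.continuous hφ.hasCompactSupport ?_
    refine (i2.inner_const c).congr (Eventually.of_forall fun x => ?_)
    simp only [real_inner_smul_left]
  simp_rw [e] at key
  rw [integral_add k1 k2] at key
  have o1 : ∫ x in univ, ζ x * m x * fderiv ℝ φ x c
      = ∫ x in Ω, fderiv ℝ φ x c * (ζ x * m x) := by
    rw [setIntegral_univ, setIntegral_eq_integral_of_forall_compl_eq_zero]
    · congr 1; ext x; ring
    · intro x hx; simp [z1 x hx]
  have o2 : ∫ x in univ, φ x * ⟪ζ x • Dm x + m x • gradient ζ x, c⟫_ℝ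
      = ∫ x in Ω, (φ x * (ζ x * ⟪Dm x, c⟫_ℝ) + φ x * (m x * fderiv ℝ ζ x c)) := by
    rw [setIntegral_univ, setIntegral_eq_integral_of_forall_compl_eq_zero]
    · congr 1; ext x; rw [inner_add_left, eg, real_inner_smul_left]; ring
    · intro x hx; rw [← eg]; simp [z1 x hx, z2 x hx]
  rw [o1, o2, integral_add k3 k2]
  have o3 : ∫ x in Ω, ζ x * φ x * ⟪Dm x, c⟫_ℝ = ∫ x in Ω, φ x * (ζ x * ⟪Dm x, c⟫_ℝ) := by
    congr 1; ext x; ring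
  linarith

/-- The derivative is put on the kernel, and t ↦ η(x - t) serves as a test function. The sign from
differentiating x - t cancels the one in the definition of the weak gradient. -/
theorem MemW11.fderiv_mollify {M : Space N → ℝ} {DM : Space N → Space N} (hM : MemW11 univ M DM)
    (k : ℕ) (x c : Space N) :
    fderiv ℝ (mollify k M) x c = ⟪mollify k DM x, c⟫_ℝ := by
  have iM : Integrable M := by simpa using hM.integrableOn
  have iD : Integrable DM := by simpa using hM.integrableOn_grad
  set η := (bump N k).normed (volume : Measure (Space N)) with hη
  have hηd : ContDiff ℝ ∞ η := (bump N k).contDiff_normed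
  have hηc : HasCompactSupport η := (bump N k).hasCompactSupport_normed
  have h := hηc.hasFDerivAt_convolution_left (ContinuousLinearMap.lsmul ℝ ℝ) (μ := volume)
    (hηd.of_le (by exact_mod_cast le_top)) iM.locallyIntegrable x
  have hφ : IsTestFunction univ (fun t => η (x - t)) := by
    refine ⟨hηd.comp (contDiff_const.sub contDiff_id), ?_, subset_univ _⟩
    exact hηc.comp_homeomorph (Homeomorph.subLeft x)
  have key := hM.integral_mul_fderiv hφ c
  have e : ∀ t, fderiv ℝ (fun t => η (x - t)) t c = -fderiv ℝ η (x - t) c := by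
    intro t
    have := ((hηd.differentiable (by simp) (x - t)).hasFDerivAt.comp t
      ((hasFDerivAt_id t).const_sub x)).fderiv
    have h2 : (fun t => η (x - t)) = η ∘ (HSub.hSub x) := rfl
    rw [h2, this]; simp
  simp_rw [e] at key
  simp only [mul_neg, integral_neg, neg_inj, setIntegral_univ] at key
  have h1 : fderiv ℝ (mollify k M) x c
      = ∫ t, M t * fderiv ℝ η (x - t) c := by
    simp only [mollify]
    rw [h.fderiv, convolution_eq_swap, ContinuousLinearMap.integral_apply]
    · simp [ContinuousLinearMap.precompL_apply, mul_comm]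
    · have := (hηc.fderiv ℝ).convolutionExists_left
        ((ContinuousLinearMap.lsmul ℝ ℝ).precompL (Space N)) (μ := volume)
        ((hηd.of_le (by exact_mod_cast le_top)).continuous_fderiv one_ne_zero)
        iM.locallyIntegrable x
      exact (convolutionExistsAt_iff_integrable_swap).1 this
  have h2 : ⟪mollify k DM x, c⟫_ℝ = ∫ t, η (x - t) * ⟪DM t, c⟫_ℝ := by
    rw [real_inner_comm, mollify_apply, ← integral_inner]
    · simp only [inner_smul_right, real_inner_comm]; rfl
    · have := hηc.convolutionExists_left (ContinuousLinearMap.lsmul ℝ ℝ) (μ := volume)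
        hηd.continuous iD.locallyIntegrable x
      exact (convolutionExistsAt_iff_integrable_swap).1 this
  rw [h1, key, h2]

theorem continuous_of_continuousOn_of_tsupport_subset {U : Set (Space N)} {f : Space N → ℝ}
    (hU : IsOpen U) (hf : ContinuousOn f U) (h : tsupport f ⊆ U) : Continuous f :=
  contDiff_zero.1 (contDiff_of_contDiffOn_of_tsupport_subset hU (contDiffOn_zero.2 hf) h)

theorem IsTestFunction.integrable_mul {φ : Space N → ℝ} (hφ : IsTestFunction Ω φ) (hΩ : IsOpen Ω)
    {p q : Space N → ℝ} (hp : ContinuousOn p Ω) (hq : Continuous q)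
    (hs : tsupport q ⊆ tsupport φ) : Integrable fun x => p x * q x := by
  have h1 : tsupport (fun x => p x * q x) ⊆ tsupport φ := tsupport_mul_subset_right.trans hs
  exact (continuous_of_continuousOn_of_tsupport_subset hΩ (hp.mul hq.continuousOn)
    (h1.trans hφ.tsupport_subset)).integrable_of_hasCompactSupport
    (hφ.hasCompactSupport.of_isClosed_subset (isClosed_tsupport _) h1)

theorem IsTestFunction.integral_mul_fderiv {φ f : Space N → ℝ} (hφ : IsTestFunction Ω φ)
    (hΩ : IsOpen Ω) (hf : ContDiffOn ℝ 1 f Ω) (c : Space N) :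
    ∫ x, f x * fderiv ℝ φ x c = -∫ x, φ x * fderiv ℝ f x c := by
  have hφ1 : ContDiff ℝ 1 φ := hφ.smooth.of_le (by exact_mod_cast le_top)
  have hcf : ContinuousOn (fun x => fderiv ℝ f x c) Ω :=
    (hf.continuousOn_fderiv_of_isOpen hΩ le_rfl).clm_apply continuousOn_const
  rw [integral_mul_fderiv_eq_neg_fderiv_mul_of_integrable
    (hφ.integrable_mul hΩ hcf hφ1.continuous subset_rfl)
    (hφ.integrable_mul hΩ hf.continuousOn (hφ.fderiv_apply c).smooth.continuous
      (tsupport_fderiv_apply_subset ℝ c))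
    (hφ.integrable_mul hΩ hf.continuousOn hφ1.continuous subset_rfl)
    (fun x hx => (hf.contDiffAt (hΩ.mem_nhds (hφ.tsupport_subset hx))).differentiableAt
      one_ne_zero) (fun x _ => hφ1.differentiable one_ne_zero x)]
  simp only [mul_comm]

theorem fderiv_partial_left {H : Space N → ℝ → ℝ} {x : Space N} {s : ℝ}
    (h : DifferentiableAt ℝ (Function.uncurry H) (x, s)) (c : Space N) :
    fderiv ℝ (fun y => H y s) x c = fderiv ℝ (Function.uncurry H) (x, s) (c, 0) := by
  have := (HasFDerivAt.comp (f := fun y => (y, s)) x h.hasFDerivAt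
    (hasFDerivAt_prodMk_left x s)).fderiv
  have h2 : (fun y => H y s) = Function.uncurry H ∘ fun y => (y, s) := rfl
  rw [h2, this]
  simp

theorem deriv_partial_right {H : Space N → ℝ → ℝ} {x : Space N} {s : ℝ}
    (h : DifferentiableAt ℝ (Function.uncurry H) (x, s)) :
    deriv (H x) s = fderiv ℝ (Function.uncurry H) (x, s) (0, 1) := by
  have h3 : HasDerivAt (fun t : ℝ => (x, id t)) (0, 1) s :=
    (hasDerivAt_const s x).prodMk (hasDerivAt_id s)
  have := (h.hasFDerivAt.comp_hasDerivAt s h3).deriv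
  have h2 : H x = Function.uncurry H ∘ Prod.mk x := rfl
  rw [h2, this]

/-- A continuous function on `Ω × ℝ` which vanishes for large values of the second variable is
bounded on `K × ℝ`, for each compact `K ⊆ Ω`. -/
theorem exists_bound_of_eq_zero {F : Type*} [NormedAddCommGroup F] {K : Set (Space N)}
    (hK : IsCompact K) {P : Space N × ℝ → F} (hP : ContinuousOn P (K ×ˢ univ)) {R : ℝ}
    (h0 : ∀ x ∈ K, ∀ s, R < |s| → P (x, s) = 0) :
    ∃ C, 0 ≤ C ∧ ∀ x ∈ K, ∀ s, ‖P (x, s)‖ ≤ C := by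
  have hc : IsCompact (K ×ˢ Icc (-R) R) := hK.prod isCompact_Icc
  obtain ⟨C, hC⟩ := hc.exists_bound_of_continuousOn
    (hP.mono (prod_mono subset_rfl (subset_univ _)))
  refine ⟨max C 0, le_max_right _ _, fun x hx s => ?_⟩
  by_cases hs : R < |s|
  · rw [h0 x hx s hs, norm_zero]; exact le_max_right _ _
  · exact (hC (x, s) ⟨hx, abs_le.1 (not_lt.1 hs)⟩).trans (le_max_left _ _)

section ChainRule

variable {H : Space N → ℝ → ℝ}

theorem contDiffOn_comp_graph (hH : ContDiffOn ℝ 1 (Function.uncurry H) (Ω ×ˢ univ))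
    {M : Space N → ℝ} (hM : ContDiff ℝ 1 M) : ContDiffOn ℝ 1 (fun x => H x (M x)) Ω :=
  hH.comp (contDiff_id.prodMk hM).contDiffOn fun _ hx => ⟨hx, mem_univ _⟩

theorem fderiv_comp_graph (hΩ : IsOpen Ω)
    (hH : ContDiffOn ℝ 1 (Function.uncurry H) (Ω ×ˢ univ)) {M : Space N → ℝ}
    (hM : ContDiff ℝ 1 M) {x : Space N} (hx : x ∈ Ω) (c : Space N) :
    fderiv ℝ (fun x => H x (M x)) x c
      = fderiv ℝ (Function.uncurry H) (x, M x) (c, fderiv ℝ M x c) := by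
  have hd : DifferentiableAt ℝ (Function.uncurry H) (x, M x) :=
    (hH.contDiffAt ((hΩ.prod isOpen_univ).mem_nhds ⟨hx, mem_univ _⟩)).differentiableAt one_ne_zero
  have := (hd.hasFDerivAt.comp x ((hasFDerivAt_id x).prodMk
    (hM.differentiable one_ne_zero x).hasFDerivAt)).fderiv
  have h2 : (fun x => H x (M x)) = Function.uncurry H ∘ fun y => (id y, M y) := rfl
  rw [h2, this]
  simp

theorem integral_comp_graph_mul_fderiv (hΩ : IsOpen Ω)
    (hH : ContDiffOn ℝ 1 (Function.uncurry H) (Ω ×ˢ univ)) {M : Space N → ℝ}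
    (hM : ContDiff ℝ 1 M) {φ : Space N → ℝ} (hφ : IsTestFunction Ω φ) (c : Space N) :
    ∫ x, H x (M x) * fderiv ℝ φ x c
      = -∫ x, φ x * fderiv ℝ (Function.uncurry H) (x, M x) (c, fderiv ℝ M x c) := by
  have hfd := contDiffOn_comp_graph hH hM
  rw [hφ.integral_mul_fderiv hΩ hfd]
  congr 2
  ext x
  by_cases hx : x ∈ Ω
  · rw [fderiv_comp_graph hΩ hH hM hx]
  · rw [image_eq_zero_of_notMem_tsupport fun h => hx (hφ.tsupport_subset h)]; ring

/-- The classical chain rule is applied to mollifications of `M`. Since `H` vanishes for large s,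
the functions `H` and `P` are bounded over the compact support of φ. Thus the coefficients converge
boundedly almost everywhere, while the gradients converge in L¹. -/
theorem integral_comp_graph_mul_fderiv_of_memW11 (hΩ : IsOpen Ω)
    (hH : ContDiffOn ℝ 1 (Function.uncurry H) (Ω ×ˢ univ)) {R : ℝ}
    (hR : ∀ x ∈ Ω, ∀ s, R < |s| → H x s = 0) {M : Space N → ℝ} {DM : Space N → Space N}
    (hM : MemW11 univ M DM) {φ : Space N → ℝ} (hφ : IsTestFunction Ω φ) (c : Space N) :
    ∫ x, H x (M x) * fderiv ℝ φ x c
      = -∫ x, φ x * fderiv ℝ (Function.uncurry H) (x, M x) (c, ⟪DM x, c⟫_ℝ) := by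
  have iM : Integrable M := by simpa using hM.integrableOn
  have iD : Integrable DM := by simpa using hM.integrableOn_grad
  have hφ1 : ContDiff ℝ 1 φ := hφ.smooth.of_le (by exact_mod_cast le_top)
  have hopen : IsOpen (Ω ×ˢ (univ : Set ℝ)) := hΩ.prod isOpen_univ
  set P := fderiv ℝ (Function.uncurry H) with hPdef
  have hP : ContinuousOn P (Ω ×ˢ univ) := hH.continuousOn_fderiv_of_isOpen hopen le_rfl
  have hP0 : ∀ x ∈ Ω, ∀ s, R < |s| → P (x, s) = 0 := by
    intro x hx s hs
    have : Function.uncurry H =ᶠ[𝓝 (x, s)] fun _ => 0 := by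
      have ho : IsOpen (Ω ×ˢ {s : ℝ | R < |s|}) :=
        hΩ.prod (isOpen_lt continuous_const continuous_abs)
      filter_upwards [ho.mem_nhds ⟨hx, hs⟩] with p hp
      exact hR p.1 hp.1 p.2 hp.2
    rw [hPdef, this.fderiv_eq]
    simp
  have hKc : IsCompact (tsupport φ) := hφ.hasCompactSupport.isCompact
  have hKΩ := hφ.tsupport_subset
  obtain ⟨CH, hCH0, hCH⟩ := exists_bound_of_eq_zero hKc
    (hH.continuousOn.mono (prod_mono hKΩ subset_rfl)) (R := R) fun x hx => hR x (hKΩ hx)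
  obtain ⟨CP, hCP0, hCP⟩ := exists_bound_of_eq_zero hKc
    (hP.mono (prod_mono hKΩ subset_rfl)) fun x hx => hP0 x (hKΩ hx)
  obtain ⟨Cφ, hCφ⟩ := hφ1.continuous.bounded_above_of_compact_support hφ.hasCompactSupport
  have z : ∀ x, x ∉ tsupport φ → φ x = 0 := fun x hx => image_eq_zero_of_notMem_tsupport hx
  have z' : ∀ x, x ∉ tsupport φ → fderiv ℝ φ x c = 0 := fun x hx =>
    image_eq_zero_of_notMem_tsupport (f := fun x => fderiv ℝ φ x c) fun h =>
      hx (tsupport_fderiv_apply_subset ℝ c h)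
  have hMk : ∀ k, ContDiff ℝ 1 (mollify k M) := fun k =>
    (contDiff_mollify k iM.locallyIntegrable).of_le (by exact_mod_cast le_top)
  have haeM := ae_tendsto_mollify iM.locallyIntegrable
  have hgraph : ∀ {x}, x ∈ Ω → Tendsto (fun k => mollify k M x) atTop (𝓝 (M x)) →
      Tendsto (fun k => (x, mollify k M x)) atTop (𝓝 (x, M x)) := fun hx h =>
    tendsto_const_nhds.prodMk_nhds h
  have hcg : ∀ k, Continuous fun x => (x, mollify k M x) := fun k =>
    continuous_id.prodMk (hMk k).continuous
  have hL : Tendsto (fun k => ∫ x, H x (mollify k M x) * fderiv ℝ φ x c) atTop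
      (𝓝 (∫ x, H x (M x) * fderiv ℝ φ x c)) := by
    refine tendsto_integral_of_dominated_convergence (fun x => CH * ‖fderiv ℝ φ x c‖) ?_ ?_ ?_ ?_
    · intro k
      have hs : tsupport (fun x => H x (mollify k M x) * fderiv ℝ φ x c) ⊆ tsupport φ :=
        tsupport_mul_subset_right.trans (tsupport_fderiv_apply_subset ℝ c)
      exact (continuous_of_continuousOn_of_tsupport_subset hΩ
        ((contDiffOn_comp_graph hH (hMk k)).continuousOn.mul
          (hφ.fderiv_apply c).smooth.continuous.continuousOn)
        (hs.trans hKΩ)).aestronglyMeasurable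
    · exact (((hφ.fderiv_apply c).smooth.continuous.integrable_of_hasCompactSupport
        (hφ.fderiv_apply c).hasCompactSupport).norm).const_mul _
    · intro k
      refine Eventually.of_forall fun x => ?_
      by_cases hx : x ∈ tsupport φ
      · rw [norm_mul]; gcongr; exact hCH x hx _
      · simp [z' x hx]
    · filter_upwards [haeM] with x hx
      by_cases hxK : x ∈ tsupport φ
      · refine Tendsto.mul_const _ ?_
        exact ((hH.continuousOn.continuousAt (hopen.mem_nhds ⟨hKΩ hxK, mem_univ _⟩)).tendsto).comp
          (hgraph (hKΩ hxK) hx)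
      · simp [z' x hxK]
  -- the coefficients of the two parts of the derivative
  have hcont : ∀ (v : Space N × ℝ) k, Continuous fun x => φ x * P (x, mollify k M x) v := by
    intro v k
    have hs : tsupport (fun x => φ x * P (x, mollify k M x) v) ⊆ tsupport φ :=
      tsupport_mul_subset_left
    refine continuous_of_continuousOn_of_tsupport_subset hΩ (hφ1.continuous.continuousOn.mul ?_)
      (hs.trans hKΩ)
    exact (hP.comp (hcg k).continuousOn fun x hx => ⟨hx, mem_univ _⟩).clm_apply continuousOn_const
  have hbd : ∀ (v : Space N × ℝ) (s : ℝ) x, ‖φ x * P (x, s) v‖ ≤ Cφ * (CP * ‖v‖) := by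
    intro v s x
    have hCφ0 : 0 ≤ Cφ := (norm_nonneg _).trans (hCφ x)
    by_cases hx : x ∈ tsupport φ
    · rw [norm_mul]
      gcongr
      · exact hCφ x
      · exact (P (x, s)).le_of_opNorm_le (hCP x hx s) v
    · rw [z x hx]; simp; positivity
  have hbd' : ∀ (v : Space N × ℝ) (s : ℝ) x, ‖φ x * P (x, s) v‖ ≤ ‖φ x‖ * (CP * ‖v‖) := by
    intro v s x
    by_cases hx : x ∈ tsupport φ
    · rw [norm_mul]
      gcongr
      exact (P (x, s)).le_of_opNorm_le (hCP x hx s) v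
    · rw [z x hx]; simp
  have hlim : ∀ v : Space N × ℝ, ∀ᵐ x, Tendsto (fun k => φ x * P (x, mollify k M x) v) atTop
      (𝓝 (φ x * P (x, M x) v)) := by
    intro v
    filter_upwards [haeM] with x hx
    by_cases hxK : x ∈ tsupport φ
    · refine Tendsto.const_mul _ ?_
      have := ((hP.continuousAt (hopen.mem_nhds ⟨hKΩ hxK, mem_univ (M x)⟩)).tendsto).comp
          (hgraph (hKΩ hxK) hx)
      exact ((ContinuousLinearMap.apply ℝ ℝ v).continuous.tendsto _).comp this
    · simp [z x hxK]
  -- Only the second part carries the gradient of `M`, for which there is convergence in L¹ and no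
  -- pointwise domination.
  have hsplit : ∀ x s t, φ x * P (x, s) (c, t) = φ x * P (x, s) (c, 0) + φ x * P (x, s) (0, 1) * t := by
    intro x s t
    have : ((c, t) : Space N × ℝ) = (c, 0) + t • (0, 1) := by simp
    rw [this, map_add, map_smul, smul_eq_mul]
    ring
  have iφ : Integrable fun x => ‖φ x‖ :=
    (hφ1.continuous.integrable_of_hasCompactSupport hφ.hasCompactSupport).norm
  have iDc : Integrable (fun x => ⟪DM x, c⟫_ℝ) := iD.inner_const c
  have hL1 : Tendsto (fun k => ∫ x, (φ x * P (x, mollify k M x) (c, 0)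
      + φ x * P (x, mollify k M x) (0, 1) * ⟪DM x, c⟫_ℝ)) atTop
      (𝓝 (∫ x, (φ x * P (x, M x) (c, 0) + φ x * P (x, M x) (0, 1) * ⟪DM x, c⟫_ℝ))) := by
    refine tendsto_integral_of_dominated_convergence (fun x => ‖φ x‖ * (CP * ‖((c, 0) : Space N × ℝ)‖)
      + Cφ * (CP * ‖((0, 1) : Space N × ℝ)‖) * ‖⟪DM x, c⟫_ℝ‖) ?_ ?_ ?_ ?_
    · intro k
      exact (hcont _ k).aestronglyMeasurable.add
        ((hcont _ k).aestronglyMeasurable.mul iDc.aestronglyMeasurable)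
    · exact (iφ.mul_const _).add (iDc.norm.const_mul _)
    · intro k
      refine Eventually.of_forall fun x => (norm_add_le _ _).trans (add_le_add (hbd' _ _ _) ?_)
      rw [norm_mul]
      gcongr
      exact hbd _ _ _
    · filter_upwards [hlim (c, 0), hlim (0, 1)] with x h1 h2
      exact h1.add (h2.mul_const _)
  -- The gradient of the mollification is written as `DM` plus an error; the error, tending to zero
  -- in L¹, is multiplied by a bounded coefficient.
  have hL2 : Tendsto (fun k => ∫ x, φ x * P (x, mollify k M x) (0, 1)
      * ⟪mollify k DM x - DM x, c⟫_ℝ) atTop (𝓝 0) := by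
    have h0 := (tendsto_integral_norm_mollify_sub iD).const_mul
      (Cφ * (CP * ‖((0, 1) : Space N × ℝ)‖) * ‖c‖)
    rw [mul_zero] at h0
    refine squeeze_zero_norm (fun k => ?_) h0
    rw [← integral_const_mul]
    refine (norm_integral_le_integral_norm _).trans (integral_mono_of_nonneg
      (Eventually.of_forall fun x => norm_nonneg _)
      ((((integrable_mollify k iD).sub iD).norm).const_mul _) (Eventually.of_forall fun x => ?_))
    simp only [norm_mul (φ x * _)]
    have h1 := hbd (0, 1) (mollify k M x) x
    have h2 : ‖⟪mollify k DM x - DM x, c⟫_ℝ‖ ≤ ‖mollify k DM x - DM x‖ * ‖c‖ :=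
      norm_inner_le_norm _ _
    calc _ ≤ (Cφ * (CP * ‖((0, 1) : Space N × ℝ)‖)) * (‖mollify k DM x - DM x‖ * ‖c‖) :=
          mul_le_mul h1 h2 (norm_nonneg _) ((norm_nonneg _).trans h1)
      _ = _ := by ring
  have key : ∀ k, ∫ x, H x (mollify k M x) * fderiv ℝ φ x c
      = -((∫ x, (φ x * P (x, mollify k M x) (c, 0)
        + φ x * P (x, mollify k M x) (0, 1) * ⟪DM x, c⟫_ℝ))
        + ∫ x, φ x * P (x, mollify k M x) (0, 1) * ⟪mollify k DM x - DM x, c⟫_ℝ) := by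
    intro k
    rw [integral_comp_graph_mul_fderiv hΩ hH (hMk k) hφ c, ← integral_add]
    · congr 2
      ext x
      rw [hM.fderiv_mollify, hsplit, inner_sub_left]
      ring
    · refine ((iφ.mul_const (CP * ‖((c, 0) : Space N × ℝ)‖)).mono'
        (hcont _ k).aestronglyMeasurable (Eventually.of_forall fun x => hbd' _ _ _)).add ?_
      exact iDc.bdd_mul (hcont _ k).aestronglyMeasurable
        (Eventually.of_forall fun x => hbd _ _ _)
    · exact (((integrable_mollify k iD).sub iD).inner_const c).bdd_mul
        (hcont _ k).aestronglyMeasurable (Eventually.of_forall fun x => hbd _ _ _)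
  have hR := (hL1.add hL2).neg
  rw [add_zero] at hR
  have := tendsto_nhds_unique hL (hR.congr fun k => (key k).symm)
  rw [this]
  congr 2
  ext x
  exact (hsplit _ _ _).symm

/-- Chain rule: composition of a `W^{1,1}` function with a `C¹` function `H(x, s)` vanishing for
large `s`. -/
theorem MemW11.comp {m : Space N → ℝ} {Dm : Space N → Space N} (hm : MemW11 Ω m Dm)
    (hΩ : IsOpen Ω) (hH : ContDiffOn ℝ 1 (Function.uncurry H) (Ω ×ˢ univ)) {R : ℝ}
    (hR : ∀ x ∈ Ω, ∀ s, R < |s| → H x s = 0)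
    (h1 : IntegrableOn (fun x => H x (m x)) Ω)
    (h2 : IntegrableOn (fun x => gradient (fun y => H y (m x)) x + deriv (H x) (m x) • Dm x) Ω) :
    MemW11 Ω (fun x => H x (m x))
      (fun x => gradient (fun y => H y (m x)) x + deriv (H x) (m x) • Dm x) := by
  refine ⟨h1, h2, fun φ hφ => (weak_gradient_iff h1 h2 hφ).2 fun c => ?_⟩
  -- Since ζ = 1 near the support of φ, replacing m by ζ m changes neither side.
  obtain ⟨ζ, hζ, hζc, hζs, -, hζ1⟩ := exists_cutoff hφ.hasCompactSupport.isCompact hΩ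
    hφ.tsupport_subset
  have key := integral_comp_graph_mul_fderiv_of_memW11 hΩ hH hR
    (hm.cutoff ⟨hζ, hζc, hζs⟩) hφ c
  have z : ∀ x, x ∉ tsupport φ → φ x = 0 := fun x hx => image_eq_zero_of_notMem_tsupport hx
  have z' : ∀ x, x ∉ tsupport φ → fderiv ℝ φ x c = 0 := fun x hx =>
    image_eq_zero_of_notMem_tsupport (f := fun x => fderiv ℝ φ x c) fun h =>
      hx (tsupport_fderiv_apply_subset ℝ c h)
  have hz : ∀ x ∈ tsupport φ, ζ x = 1 ∧ gradient ζ x = 0 := by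
    intro x hx
    have h := hζ1.filter_mono (nhds_le_nhdsSet hx)
    refine ⟨h.self_of_nhds, ?_⟩
    have h' : ζ =ᶠ[𝓝 x] fun _ => 1 := h
    simp [gradient, h'.fderiv_eq]
  rw [setIntegral_eq_integral_of_forall_compl_eq_zero (fun x hx => by
      rw [z' x fun h => hx (hφ.tsupport_subset h), mul_zero]),
    setIntegral_eq_integral_of_forall_compl_eq_zero (fun x hx => by
      rw [z x fun h => hx (hφ.tsupport_subset h), zero_mul])]
  have e1 : ∫ x, H x (m x) * fderiv ℝ φ x c = ∫ x, H x (ζ x * m x) * fderiv ℝ φ x c := by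
    congr 1; ext x
    by_cases hx : x ∈ tsupport φ
    · rw [(hz x hx).1, one_mul]
    · rw [z' x hx]; simp
  rw [e1, key]
  congr 2; ext x
  by_cases hx : x ∈ tsupport φ
  · have hd : DifferentiableAt ℝ (Function.uncurry H) (x, m x) :=
      (hH.contDiffAt ((hΩ.prod isOpen_univ).mem_nhds
        ⟨hφ.tsupport_subset hx, mem_univ _⟩)).differentiableAt one_ne_zero
    rw [(hz x hx).1, (hz x hx).2]
    simp only [one_mul, one_smul, smul_zero, add_zero]
    rw [inner_add_left, inner_gradient_left, fderiv_partial_left hd,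
      real_inner_smul_left, deriv_partial_right hd]
    have : ((c, ⟪Dm x, c⟫_ℝ) : Space N × ℝ) = (c, 0) + ⟪Dm x, c⟫_ℝ • (0, 1) := by simp
    rw [this, map_add, map_smul, smul_eq_mul, mul_comm ⟪Dm x, c⟫_ℝ]
  · rw [z x hx]; simp

end ChainRule

end

/-! ### Boundary charts and the outer normal -/

theorem gradient_const_smul (ρ : Space N → ℝ) (c : ℝ) (x : Space N) :
    gradient (fun y => c * ρ y) x = c • gradient ρ x := by
  have : fderiv ℝ (fun y => c * ρ y) x = c • fderiv ℝ ρ x := congrFun (fderiv_const_smul_field (f := ρ) c) x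
  simp [gradient, this]

theorem norm_fderiv_sub_innerSL (ρ : Space N → ℝ) (x e : Space N) :
    ‖fderiv ℝ ρ x - innerSL ℝ e‖ = ‖gradient ρ x - e‖ := by
  rw [← (InnerProductSpace.toDual ℝ (Space N)).norm_map (gradient ρ x - e), map_sub,
    toDual_gradient]
  rfl

namespace IsLocalDefiningFunction

variable {U : Set (Space N)} {ρ : Space N → ℝ}

theorem continuousOn_gradient (h : IsLocalDefiningFunction Ω U ρ) :
    ContinuousOn (gradient ρ) U :=
  (InnerProductSpace.toDual ℝ (Space N)).symm.continuous.comp_continuousOn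
    (h.smooth.continuousOn_fderiv_of_isOpen h.isOpen (by exact_mod_cast le_top))

theorem differentiableAt (h : IsLocalDefiningFunction Ω U ρ) {x : Space N} (hx : x ∈ U) :
    DifferentiableAt ℝ ρ x :=
  (h.smooth.contDiffAt (h.isOpen.mem_nhds hx)).differentiableAt (by simp)

theorem eq_zero (h : IsLocalDefiningFunction Ω U ρ) (hΩ : IsOpen Ω) {x : Space N} (hx : x ∈ U)
    (hf : x ∈ frontier Ω) : ρ x = 0 := by
  rw [hΩ.frontier_eq] at hf
  refine le_antisymm ?_ (not_lt.1 fun h0 => hf.2 ((h.mem_iff x hx).2 h0))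
  by_contra! hpos
  have hev : ∀ᶠ y in 𝓝 x, y ∉ Ω := by
    filter_upwards [(h.differentiableAt hx).continuousAt.eventually (lt_mem_nhds hpos),
      h.isOpen.mem_nhds hx] with y hy hyU hyΩ
    exact absurd ((h.mem_iff y hyU).1 hyΩ) (not_lt.2 (le_of_lt hy))
  exact (mem_closure_iff_frequently.1 hf.1) hev

theorem hasDerivAt_line (h : IsLocalDefiningFunction Ω U ρ) {x : Space N} (hx : x ∈ U)
    (z : Space N) : HasDerivAt (fun t : ℝ => ρ (x + t • z)) ⟪gradient ρ x, z⟫_ℝ 0 := by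
  rw [inner_gradient_left]
  have h1 : HasDerivAt (fun t : ℝ => x + t • z) z 0 := by
    simpa using ((hasDerivAt_id (0 : ℝ)).smul_const z).const_add x
  have h2 : HasFDerivAt ρ (fderiv ℝ ρ x) (x + (0 : ℝ) • z) := by
    simpa using (h.differentiableAt hx).hasFDerivAt
  exact h2.comp_hasDerivAt (0 : ℝ) h1

theorem eventually_neg {f : ℝ → ℝ} {f' : ℝ} (hf : HasDerivAt f f' 0) (h0 : f 0 = 0) (h : f' < 0) :
    ∀ᶠ t in 𝓝[>] (0 : ℝ), f t < 0 := by
  have := hf.tendsto_slope_zero_right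
  filter_upwards [this.eventually (gt_mem_nhds h), self_mem_nhdsWithin] with t ht ht0
  simp only [zero_add, h0, sub_zero, smul_eq_mul] at ht
  have ht0' : (0 : ℝ) < t := ht0
  by_contra! hc
  exact absurd ht (not_lt.2 (mul_nonneg (inv_nonneg.2 ht0'.le) hc))

theorem eventually_mem_nhds_line {V : Set (Space N)} (hV : IsOpen V) {x : Space N} (hx : x ∈ V)
    (z : Space N) : ∀ᶠ t in 𝓝[>] (0 : ℝ), x + t • z ∈ V := by
  have hc : Continuous fun t : ℝ => x + t • z := by fun_prop
  have : Tendsto (fun t : ℝ => x + t • z) (𝓝[>] 0) (𝓝 x) := by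
    have h := (hc.tendsto 0).mono_left (nhdsWithin_le_nhds (s := Ioi 0))
    simpa using h
  exact this (hV.mem_nhds hx)

end IsLocalDefiningFunction

theorem norm_of_isOuterUnitNormal {x n : Space N} (h : IsOuterUnitNormal Ω x n) : ‖n‖ = 1 := by
  obtain ⟨U, ρ, hxU, hρ, rfl⟩ := h
  have := norm_ne_zero_iff.2 (hρ.gradient_ne_zero x hxU)
  rw [norm_smul, norm_inv, norm_norm, inv_mul_cancel₀ this]

/-- If n ≠ n', moving from x in the direction n' - n decreases ρ and increases ρ'. For small times
the point would lie in Ω according to ρ and outside according to ρ'. -/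
theorem isOuterUnitNormal_unique (hΩ : IsOpen Ω) {x n n' : Space N} (hx : x ∈ frontier Ω)
    (h : IsOuterUnitNormal Ω x n) (h' : IsOuterUnitNormal Ω x n') : n = n' := by
  have hn := norm_of_isOuterUnitNormal h
  have hn' := norm_of_isOuterUnitNormal h'
  by_contra hne
  have hlt : ⟪n, n'⟫_ℝ < 1 := inner_lt_one_iff_real_of_norm_eq_one hn hn' |>.2 hne
  obtain ⟨U, ρ, hxU, hρ, hnρ⟩ := h
  obtain ⟨U', ρ', hxU', hρ', hnρ'⟩ := h'
  have g1 : 0 < ‖gradient ρ x‖ := norm_pos_iff.2 (hρ.gradient_ne_zero x hxU)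
  have g2 : 0 < ‖gradient ρ' x‖ := norm_pos_iff.2 (hρ'.gradient_ne_zero x hxU')
  have e1 : gradient ρ x = ‖gradient ρ x‖ • n := by
    rw [hnρ, smul_smul, mul_inv_cancel₀ g1.ne', one_smul]
  have e2 : gradient ρ' x = ‖gradient ρ' x‖ • n' := by
    rw [hnρ', smul_smul, mul_inv_cancel₀ g2.ne', one_smul]
  have d1 : ⟪gradient ρ x, n' - n⟫_ℝ < 0 := by
    rw [e1, real_inner_smul_left, inner_sub_right, real_inner_self_eq_norm_sq, hn]
    nlinarith
  have d2 : 0 < ⟪gradient ρ' x, n' - n⟫_ℝ := by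
    rw [e2, real_inner_smul_left, inner_sub_right, real_inner_self_eq_norm_sq, hn',
      real_inner_comm]
    have : 0 < 1 - ⟪n, n'⟫_ℝ := by linarith
    simpa using mul_pos g2 this
  have h1 := IsLocalDefiningFunction.eventually_neg (hρ.hasDerivAt_line hxU (n' - n))
    (by simpa using hρ.eq_zero hΩ hxU hx) d1
  have h2 := IsLocalDefiningFunction.eventually_neg (hρ'.hasDerivAt_line hxU' (n' - n)).neg
    (by simpa using hρ'.eq_zero hΩ hxU' hx) (by linarith)
  have h3 := IsLocalDefiningFunction.eventually_mem_nhds_line hρ.isOpen hxU (n' - n)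
  have h4 := IsLocalDefiningFunction.eventually_mem_nhds_line hρ'.isOpen hxU' (n' - n)
  obtain ⟨t, ht1, ht2, ht3, ht4⟩ := (h1.and (h2.and (h3.and h4))).exists
  have hin := (hρ.mem_iff _ ht3).2 ht1
  have := (hρ'.mem_iff _ ht4).1 hin
  simp only [Pi.neg_apply] at ht2
  linarith

theorem IsBoundedSmoothDomain.isOuterUnitNormal (hΩ : IsBoundedSmoothDomain Ω) {x : Space N}
    (hx : x ∈ frontier Ω) : IsOuterUnitNormal Ω x (outerNormal Ω x) := by
  obtain ⟨U, ρ, hxU, hρ⟩ := hΩ.smooth_boundary x hx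
  exact Classical.epsilon_spec (p := IsOuterUnitNormal Ω x) ⟨_, U, ρ, hxU, hρ, rfl⟩

theorem IsBoundedSmoothDomain.norm_outerNormal (hΩ : IsBoundedSmoothDomain Ω) {x : Space N}
    (hx : x ∈ frontier Ω) : ‖outerNormal Ω x‖ = 1 :=
  norm_of_isOuterUnitNormal (hΩ.isOuterUnitNormal hx)

theorem IsBoundedSmoothDomain.outerNormal_eq (hΩ : IsBoundedSmoothDomain Ω) {U : Set (Space N)}
    {ρ : Space N → ℝ} (hρ : IsLocalDefiningFunction Ω U ρ) {x : Space N} (hxU : x ∈ U)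
    (hx : x ∈ frontier Ω) : outerNormal Ω x = ‖gradient ρ x‖⁻¹ • gradient ρ x :=
  isOuterUnitNormal_unique hΩ.isOpen hx (hΩ.isOuterUnitNormal hx) ⟨U, ρ, hxU, hρ, rfl⟩

theorem IsBoundedSmoothDomain.continuousOn_outerNormal (hΩ : IsBoundedSmoothDomain Ω) :
    ContinuousOn (outerNormal Ω) (frontier Ω) := by
  intro x hx
  obtain ⟨U, ρ, hxU, hρ⟩ := hΩ.smooth_boundary x hx
  have hc : ContinuousAt (fun y => ‖gradient ρ y‖⁻¹ • gradient ρ y) x := by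
    have := hρ.continuousOn_gradient.continuousAt (hρ.isOpen.mem_nhds hxU)
    exact (this.norm.inv₀ (norm_ne_zero_iff.2 (hρ.gradient_ne_zero x hxU))).smul this
  refine hc.continuousWithinAt.congr_of_eventuallyEq ?_ (hΩ.outerNormal_eq hρ hxU hx)
  filter_upwards [self_mem_nhdsWithin, mem_nhdsWithin_of_mem_nhds (hρ.isOpen.mem_nhds hxU)]
    with y hy hyU
  exact hΩ.outerNormal_eq hρ hyU hy

/-- A chart of `∂Ω` at `p`: in the ball `B(p, R)`, the domain is `{ρ < 0}`, and `∇ρ` is `ε`-close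
to the unit vector `e`. -/
structure IsChart (Ω : Set (Space N)) (p e : Space N) (ε R : ℝ) (ρ : Space N → ℝ) : Prop where
  norm_eq_one : ‖e‖ = 1
  pos : 0 < R
  defining : IsLocalDefiningFunction Ω (Metric.ball p R) ρ
  close : ∀ x ∈ Metric.ball p R, ‖gradient ρ x - e‖ ≤ ε

/-- Dividing ρ by ‖∇ρ(p)‖ makes the gradient at p a unit vector; continuity gives a ball where it
stays ε-close to it. -/
theorem IsBoundedSmoothDomain.exists_chart (hΩ : IsBoundedSmoothDomain Ω) {p : Space N}
    (hp : p ∈ frontier Ω) {ε : ℝ} (hε : 0 < ε) : ∃ e R ρ, IsChart Ω p e ε R ρ := by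
  obtain ⟨U, ρ, hpU, hρ⟩ := hΩ.smooth_boundary p hp
  have g0 : 0 < ‖gradient ρ p‖ := norm_pos_iff.2 (hρ.gradient_ne_zero p hpU)
  set c := ‖gradient ρ p‖⁻¹ with hc
  have hc0 : 0 < c := inv_pos.2 g0
  have hcont : ContinuousAt (fun x => c • gradient ρ x) p :=
    (hρ.continuousOn_gradient.continuousAt (hρ.isOpen.mem_nhds hpU)).const_smul c
  have hev : ∀ᶠ x in 𝓝 p, ‖c • gradient ρ x - c • gradient ρ p‖ ≤ ε ∧ x ∈ U := by
    refine ((Metric.tendsto_nhds.1 hcont ε hε).mono fun x hx => ?_).and (hρ.isOpen.mem_nhds hpU)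
    rw [← dist_eq_norm]; exact hx.le
  obtain ⟨R, hR, hball⟩ := Metric.eventually_nhds_iff_ball.1 hev
  refine ⟨c • gradient ρ p, R, fun x => c * ρ x, ?_, hR, ?_, ?_⟩
  · rw [norm_smul, Real.norm_of_nonneg hc0.le, hc, inv_mul_cancel₀ g0.ne']
  · refine ⟨Metric.isOpen_ball, contDiffOn_const.mul
      (hρ.smooth.mono fun x hx => (hball x hx).2), fun x hx => ?_, fun x hx => ?_⟩
    · rw [gradient_const_smul]
      exact smul_ne_zero hc0.ne' (hρ.gradient_ne_zero x (hball x hx).2)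
    · rw [hρ.mem_iff x (hball x hx).2]
      exact ⟨fun h => mul_neg_of_pos_of_neg hc0 h, fun h => (pos_iff_neg_of_mul_neg h).1 hc0⟩
  · intro x hx
    rw [gradient_const_smul]
    exact (hball x hx).1

namespace IsChart

variable {p e : Space N} {ε R : ℝ} {ρ : Space N → ℝ}

/-- Mean value inequality for ρ - ⟨e, ·⟩ on the convex ball. The geometry of the chart follows from
this estimate: cones, graph, Lipschitz constants. -/
theorem abs_sub_le (h : IsChart Ω p e ε R ρ) {x y : Space N} (hx : x ∈ Metric.ball p R)
    (hy : y ∈ Metric.ball p R) : |ρ y - ρ x - ⟪e, y - x⟫_ℝ| ≤ ε * ‖y - x‖ := by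
  have := (convex_ball p R).norm_image_sub_le_of_norm_fderiv_le' (𝕜 := ℝ) (φ := innerSL ℝ e)
    (fun z hz => h.defining.differentiableAt hz)
    (fun z hz => by rw [norm_fderiv_sub_innerSL]; exact h.close z hz) hx hy
  simpa using this

theorem mem_ball (h : IsChart Ω p e ε R ρ) : p ∈ Metric.ball p R := Metric.mem_ball_self h.pos

theorem eps_nonneg (h : IsChart Ω p e ε R ρ) : 0 ≤ ε :=
  (norm_nonneg _).trans (h.close p h.mem_ball)

/-- The inward cone property. -/
theorem add_mem (h : IsChart Ω p e ε R ρ) (hΩ : IsOpen Ω) {x z : Space N} (hx : x ∈ closure Ω)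
    (hxB : x ∈ Metric.ball p R) (hzB : x + z ∈ Metric.ball p R) (hz : ⟪e, z⟫_ℝ < -(ε * ‖z‖)) :
    x + z ∈ Ω := by
  have h1 := abs_le.1 (h.abs_sub_le hxB hzB)
  rw [add_sub_cancel_left] at h1
  have h2 : ρ x ≤ 0 := by
    by_cases hxΩ : x ∈ Ω
    · exact ((h.defining.mem_iff x hxB).1 hxΩ).le
    · exact (h.defining.eq_zero hΩ hxB (by rw [hΩ.frontier_eq]; exact ⟨hx, hxΩ⟩)).le
  rw [h.defining.mem_iff _ hzB]
  linarith [h1.2]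

/-- From a zero of ρ, moving along -e decreases ρ at rate at least 1 - ε > 0, so points of Ω are
arbitrarily close. -/
theorem mem_frontier_iff (h : IsChart Ω p e ε R ρ) (hΩ : IsOpen Ω) (hε : ε < 1) {x : Space N}
    (hxB : x ∈ Metric.ball p R) : x ∈ frontier Ω ↔ ρ x = 0 := by
  refine ⟨fun hx => h.defining.eq_zero hΩ hxB hx, fun hx => ?_⟩
  rw [hΩ.frontier_eq]
  refine ⟨?_, fun hxΩ => by have := (h.defining.mem_iff x hxB).1 hxΩ; linarith⟩
  rw [mem_closure_iff_frequently]
  intro hev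
  have hc : Continuous fun t : ℝ => x + t • (-e) := by fun_prop
  have ht : Tendsto (fun t : ℝ => x + t • (-e)) (𝓝[>] 0) (𝓝 x) := by
    have h := (hc.tendsto 0).mono_left (nhdsWithin_le_nhds (s := Ioi 0))
    simpa using h
  obtain ⟨t, h1, h2, h3⟩ := ((ht.eventually hev).and
    ((ht.eventually (Metric.isOpen_ball.mem_nhds hxB)).and self_mem_nhdsWithin)).exists
  have h3 : (0 : ℝ) < t := h3
  refine h1 ((h.defining.mem_iff _ h2).2 ?_)
  have := abs_le.1 (h.abs_sub_le hxB h2)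
  rw [add_sub_cancel_left, inner_smul_right, inner_neg_right, real_inner_self_eq_norm_sq,
    norm_smul, norm_neg, h.norm_eq_one, Real.norm_of_nonneg h3.le] at this
  have : ρ (x + t • -e) ≤ -t + ε * t := by linarith [this.2]
  have : ε * t < 1 * t := by gcongr
  linarith

/-- One ε is the distance from ∇ρ to e, the other the cost of normalising ∇ρ, since its length
differs from 1 by at most ε. -/
theorem norm_outerNormal_sub_le (h : IsChart Ω p e ε R ρ) (hΩ : IsBoundedSmoothDomain Ω)
    {x : Space N} (hxB : x ∈ Metric.ball p R) (hx : x ∈ frontier Ω) :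
    ‖outerNormal Ω x - e‖ ≤ 2 * ε := by
  rw [hΩ.outerNormal_eq h.defining hxB hx]
  have h1 := h.close x hxB
  have g0 : 0 < ‖gradient ρ x‖ := norm_pos_iff.2 (h.defining.gradient_ne_zero x hxB)
  have h2 : ‖‖gradient ρ x‖⁻¹ • gradient ρ x - gradient ρ x‖ ≤ ε := by
    have e1 : ‖gradient ρ x‖⁻¹ • gradient ρ x - gradient ρ x
        = (‖gradient ρ x‖⁻¹ - 1) • gradient ρ x := by rw [sub_smul, one_smul]
    have e2 : ‖(‖gradient ρ x‖⁻¹ - 1) • gradient ρ x‖ = |‖e‖ - ‖gradient ρ x‖| := by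
      rw [norm_smul, Real.norm_eq_abs, h.norm_eq_one]
      nth_rewrite 2 [← abs_of_pos g0]
      rw [← abs_mul, sub_mul, inv_mul_cancel₀ g0.ne', one_mul]
    rw [e1, e2]
    refine (abs_norm_sub_norm_le _ _).trans ?_
    rw [norm_sub_rev]; exact h1
  calc _ = ‖(‖gradient ρ x‖⁻¹ • gradient ρ x - gradient ρ x) + (gradient ρ x - e)‖ := by
        rw [sub_add_sub_cancel]
    _ ≤ ε + ε := (norm_add_le _ _).trans (add_le_add h2 h1)
    _ = _ := by ring

end IsChart

/-- At a boundary point the closure contains an open convex cone with that vertex, and a convex set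
with nonempty interior has unique derivatives at the points of its closure. This makes derivatives
up to the boundary well behaved, so that `grad` of a C² function is C¹ there. -/
theorem IsBoundedSmoothDomain.uniqueDiffOn_closure (hΩ : IsBoundedSmoothDomain Ω) :
    UniqueDiffOn ℝ (closure Ω) := by
  intro p hp
  by_cases hpΩ : p ∈ Ω
  · exact (hΩ.isOpen.uniqueDiffWithinAt hpΩ).mono subset_closure
  have hpf : p ∈ frontier Ω := by rw [hΩ.isOpen.frontier_eq]; exact ⟨hp, hpΩ⟩
  obtain ⟨e, R, ρ, h⟩ := hΩ.exists_chart hpf (ε := 1 / 4) (by norm_num)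
  -- The constant 1/2 exceeds the ε = 1/4 of the chart, so the cone is inward, and is below 1, so
  -- the cone contains the direction -e.
  set C : Set (Space N) := Metric.ball p R ∩ {x | ⟪e, x - p⟫_ℝ + (1 / 2) * ‖x - p‖ < 0} with hC
  have hCo : IsOpen C := Metric.isOpen_ball.inter
    (isOpen_lt (by fun_prop) continuous_const)
  have hCc : Convex ℝ C := by
    refine (convex_ball p R).inter ?_
    have h1 : ConvexOn ℝ univ fun x : Space N => ⟪e, x - p⟫_ℝ + (1 / 2) * ‖x - p‖ := by
      refine ⟨convex_univ, fun x _ y _ a b ha hb hab => ?_⟩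
      have e1 : a • x + b • y - p = a • (x - p) + b • (y - p) := by
        rw [smul_sub, smul_sub, sub_add_sub_comm, ← add_smul, hab, one_smul]
      have e2 : ‖a • (x - p) + b • (y - p)‖ ≤ a * ‖x - p‖ + b * ‖y - p‖ := by
        refine (norm_add_le _ _).trans (le_of_eq ?_)
        rw [norm_smul, norm_smul, Real.norm_of_nonneg ha, Real.norm_of_nonneg hb]
      simp only [smul_eq_mul]
      rw [e1, inner_add_right, inner_smul_right, inner_smul_right]
      nlinarith
    have := h1.convex_lt 0
    simpa using this
  have hpt : ∀ t : ℝ, 0 < t → t < R → p + t • (-e) ∈ C := by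
    intro t ht htR
    have hn : ‖t • (-e)‖ = t := by
      rw [norm_smul, norm_neg, h.norm_eq_one, Real.norm_of_nonneg ht.le, mul_one]
    refine ⟨by rw [Metric.mem_ball, dist_eq_norm, add_sub_cancel_left, hn]; exact htR, ?_⟩
    change ⟪e, p + t • (-e) - p⟫_ℝ + (1 / 2) * ‖p + t • (-e) - p‖ < 0
    rw [add_sub_cancel_left, hn, inner_smul_right, inner_neg_right, real_inner_self_eq_norm_sq,
      h.norm_eq_one]
    linarith
  have hpC : p ∈ closure C := by
    have hc : Continuous fun t : ℝ => p + t • (-e) := by fun_prop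
    have ht : Tendsto (fun t : ℝ => p + t • (-e)) (𝓝[>] 0) (𝓝 p) := by
      have h := (hc.tendsto 0).mono_left (nhdsWithin_le_nhds (s := Ioi 0))
      simpa using h
    refine mem_closure_of_tendsto ht ?_
    filter_upwards [self_mem_nhdsWithin, mem_nhdsWithin_of_mem_nhds (gt_mem_nhds h.pos)]
      with t h1 h2
    exact hpt t h1 h2
  have hCΩ : C ⊆ closure Ω := by
    intro x hx
    have hx2 : ⟪e, x - p⟫_ℝ + (1 / 2) * ‖x - p‖ < 0 := hx.2
    have := h.add_mem hΩ.isOpen (z := x - p) hp h.mem_ball (by simpa using hx.1)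
      (by nlinarith [norm_nonneg (x - p)])
    rw [add_sub_cancel] at this
    exact subset_closure this
  have hne : (interior C).Nonempty := by
    rw [hCo.interior_eq]
    exact ⟨_, hpt (R / 2) (half_pos h.pos) (half_lt_self h.pos)⟩
  exact (uniqueDiffWithinAt_convex hCc hne hpC).mono hCΩ

section

open scoped NNReal ENNReal

/-! ### The surface measure in a chart -/

/-- Fubini along the orthogonal splitting into the line of e and its complement; the normalisation
of the Hausdorff measure makes the splitting measure preserving. -/
theorem integral_eq_integral_line {e : Space N} (he : ‖e‖ = 1) (p : Space N) {F : Space N → ℝ}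
    (hF : Integrable F) :
    ∫ x, F x = ∫ y : ((ℝ ∙ e)ᗮ : Submodule ℝ (Space N)), ∫ t : ℝ, F (p + y + t • e) := by
  let s := ℝ ∙ e
  have mp : MeasurePreserving (s.measurableEquivProd p) volume volume := by
    have := s.measurePreserving_measurableEquivProd p
    rwa [InnerProductSpace.euclideanHausdorffMeasure_eq_volume] at this
  have h1 := mp.symm.integral_comp' (g := F)
  have hint : Integrable (fun q => F ((s.measurableEquivProd p).symm q))
      (volume.prod volume) := (mp.symm.integrable_comp_emb
        (s.measurableEquivProd p).symm.measurableEmbedding).2 hF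
  rw [← h1, Measure.volume_eq_prod, integral_prod_symm _ hint]
  congr 1
  ext y
  have h2 := (LinearIsometryEquiv.toSpanUnitSingleton e he).measurePreserving.integral_comp
    (LinearIsometryEquiv.toSpanUnitSingleton e he).toHomeomorph.measurableEmbedding
    (fun a : s => F ((s.measurableEquivProd p).symm (a, y)))
  rw [← h2]
  congr 1
  ext t
  rw [Submodule.measurableEquivProd_symm_apply]
  congr 1
  simp only [LinearIsometryEquiv.toSpanUnitSingleton_apply, vadd_eq_add]
  abel

theorem euclideanHausdorffMeasure_image_le {X Y : Type*} [EMetricSpace X] [EMetricSpace Y]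
    [MeasurableSpace X] [BorelSpace X] [MeasurableSpace Y] [BorelSpace Y] {K : ℝ≥0} {f : X → Y}
    {s : Set X} (h : LipschitzOnWith K f s) (n : ℕ) :
    Measure.euclideanHausdorffMeasure n (f '' s)
      ≤ (K : ℝ≥0∞) ^ n * Measure.euclideanHausdorffMeasure n s := by
  simp only [Measure.euclideanHausdorffMeasure_def, Measure.smul_apply]
  have := h.hausdorffMeasure_image_le (d := n) (by positivity)
  rw [ENNReal.rpow_natCast] at this
  rw [ENNReal.smul_def, ENNReal.smul_def, smul_eq_mul, smul_eq_mul, mul_left_comm]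
  gcongr

namespace IsChart

variable {p e : Space N} {ε R : ℝ} {ρ : Space N → ℝ}

theorem norm_smul_e (h : IsChart Ω p e ε R ρ) (t : ℝ) : ‖t • e‖ = |t| := by
  rw [norm_smul, h.norm_eq_one, mul_one, Real.norm_eq_abs]

theorem cyl_mem_ball (h : IsChart Ω p e ε R ρ) {y : Space N} (hy : ‖y‖ < R / 4) {t : ℝ}
    (ht : |t| ≤ R / 2) : p + y + t • e ∈ Metric.ball p R := by
  rw [Metric.mem_ball, dist_eq_norm, add_assoc, add_sub_cancel_left]
  have := norm_add_le y (t • e)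
  rw [h.norm_smul_e] at this
  linarith [h.pos]

theorem strictMono_line (h : IsChart Ω p e ε R ρ) (hε : ε ≤ 1 / 4) {y : Space N}
    (hy : ‖y‖ < R / 4) {t t' : ℝ} (ht : |t| ≤ R / 2) (ht' : |t'| ≤ R / 2) (htt : t < t') :
    ρ (p + y + t • e) < ρ (p + y + t' • e) := by
  have := abs_le.1 (h.abs_sub_le (h.cyl_mem_ball hy ht) (h.cyl_mem_ball hy ht'))
  rw [add_sub_add_left_eq_sub, ← sub_smul, h.norm_smul_e, inner_smul_right,
    real_inner_self_eq_norm_sq, h.norm_eq_one, abs_of_pos (sub_pos.2 htt)] at this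
  nlinarith [this.1]

/-- On the line through p + y the function ρ differs from t by at most ε(R/4 + |t|). At t = ±R/2
this is at most 3R/16 < R/2, so ρ changes sign; strict monotonicity then makes Ω the part below the
zero. -/
theorem exists_height (h : IsChart Ω p e ε R ρ) (hΩ : IsOpen Ω) (hp : p ∈ frontier Ω)
    (hε : ε ≤ 1 / 4) {y : Space N} (hye : ⟪e, y⟫_ℝ = 0) (hy : ‖y‖ < R / 4) :
    ∃ f, |f| < R / 2 ∧ ρ (p + y + f • e) = 0 ∧
      ∀ t, |t| ≤ R / 2 → (p + y + t • e ∈ Ω ↔ t < f) := by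
  have hR := h.pos
  have hp0 : ρ p = 0 := h.defining.eq_zero hΩ h.mem_ball hp
  have hest : ∀ t, |t| ≤ R / 2 → |ρ (p + y + t • e) - t| ≤ ε * (R / 4 + |t|) := by
    intro t ht
    have := h.abs_sub_le h.mem_ball (h.cyl_mem_ball hy ht)
    rw [hp0, sub_zero, add_assoc, add_sub_cancel_left, inner_add_right, hye, zero_add,
      inner_smul_right, real_inner_self_eq_norm_sq, h.norm_eq_one] at this
    rw [add_assoc]
    simp only [one_pow, mul_one] at this
    refine this.trans (mul_le_mul_of_nonneg_left ?_ h.eps_nonneg)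
    have := norm_add_le y (t • e)
    rw [h.norm_smul_e] at this
    linarith
  have habs : |R / 2| = R / 2 := abs_of_pos (by linarith)
  have hpos : 0 < ρ (p + y + (R / 2) • e) := by
    have := (abs_le.1 (hest (R / 2) habs.le)).1
    rw [habs] at this
    nlinarith
  have hneg : ρ (p + y + (-(R / 2)) • e) < 0 := by
    have := (abs_le.1 (hest (-(R / 2)) (by rw [abs_neg, habs]))).2
    rw [abs_neg, habs] at this
    nlinarith
  have hcont : ContinuousOn (fun t : ℝ => ρ (p + y + t • e)) (Icc (-(R / 2)) (R / 2)) := by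
    refine h.defining.smooth.continuousOn.comp (by fun_prop) fun t ht => ?_
    exact h.cyl_mem_ball hy (abs_le.2 ht)
  obtain ⟨f, hf, hf0⟩ := intermediate_value_Ioo (by linarith) hcont ⟨hneg, hpos⟩
  have hfa : |f| < R / 2 := abs_lt.2 hf
  refine ⟨f, hfa, hf0, fun t ht => ?_⟩
  rw [h.defining.mem_iff _ (h.cyl_mem_ball hy ht)]
  simp only at hf0
  constructor
  · intro hlt
    by_contra! hc
    rcases hc.eq_or_lt with rfl | hc
    · linarith
    · have := h.strictMono_line hε hy hfa.le ht hc
      linarith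
  · intro hlt
    have := h.strictMono_line hε hy ht hfa.le hlt
    linarith

/-- Fundamental theorem of calculus on the slice below the graph. As y is orthogonal to e, |t| ≤ ‖y
+ t e‖, so ψ vanishes for |t| ≥ R/4 and the lower end contributes nothing. -/
theorem integral_slice (h : IsChart Ω p e ε R ρ) {y : Space N} (hye : ⟪e, y⟫_ℝ = 0) {f : ℝ}
    (hf : |f| < R / 2) (hfΩ : ∀ t, |t| ≤ R / 2 → (p + y + t • e ∈ Ω ↔ t < f)) {ψ : Space N → ℝ}
    (hψ : IsTestFunction (Metric.ball p (R / 4)) ψ) :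
    ∫ t : ℝ, Ω.indicator (fun x => fderiv ℝ ψ x e) (p + y + t • e) = ψ (p + y + f • e) := by
  have hR := h.pos
  have hψ1 : ContDiff ℝ 1 ψ := hψ.smooth.of_le (by exact_mod_cast le_top)
  have hout : ∀ t : ℝ, R / 4 ≤ |t| → p + y + t • e ∉ tsupport ψ := by
    intro t ht hmem
    have := hψ.tsupport_subset hmem
    rw [Metric.mem_ball, dist_eq_norm, add_assoc, add_sub_cancel_left] at this
    have h2 : |t| ≤ ‖y + t • e‖ := by
      have := abs_real_inner_le_norm e (y + t • e)
      rwa [inner_add_right, hye, zero_add, inner_smul_right, real_inner_self_eq_norm_sq,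
        h.norm_eq_one, one_pow, mul_one, one_mul] at this
    linarith
  have hd0 : ∀ t : ℝ, R / 4 ≤ |t| → fderiv ℝ ψ (p + y + t • e) e = 0 := fun t ht =>
    image_eq_zero_of_notMem_tsupport (f := fun x => fderiv ℝ ψ x e) fun hm =>
      hout t ht (tsupport_fderiv_apply_subset ℝ e hm)
  have heq : (fun t : ℝ => Ω.indicator (fun x => fderiv ℝ ψ x e) (p + y + t • e))
      = (Ioo (-(R / 2)) f).indicator fun t => fderiv ℝ ψ (p + y + t • e) e := by
    ext t
    rw [abs_lt] at hf
    by_cases ht : |t| ≤ R / 2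
    · by_cases hm : p + y + t • e ∈ Ω
      · rw [indicator_of_mem hm]
        have h1 := (hfΩ t ht).1 hm
        rcases (abs_le.1 ht).1.eq_or_lt with h2 | h2
        · rw [indicator_of_notMem (fun hh => hh.1.ne h2)]
          exact hd0 t (by rw [← h2, abs_neg, abs_of_pos] <;> linarith)
        · rw [indicator_of_mem (show t ∈ Ioo (-(R / 2)) f from ⟨h2, h1⟩)]
      · rw [indicator_of_notMem hm, indicator_of_notMem]
        exact fun hh => hm ((hfΩ t ht).2 hh.2)
    · have h0 := hd0 t (by linarith [not_le.1 ht])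
      classical
      rw [indicator_apply, indicator_apply]
      simp [h0]
  have hline : ∀ t : ℝ, HasDerivAt (fun t : ℝ => ψ (p + y + t • e))
      (fderiv ℝ ψ (p + y + t • e) e) t := by
    intro t
    have h1 : HasDerivAt (fun t : ℝ => p + y + t • e) e t := by
      simpa using ((hasDerivAt_id t).smul_const e).const_add (p + y)
    exact (hψ1.differentiable one_ne_zero _).hasFDerivAt.comp_hasDerivAt t h1
  have hcont : Continuous fun t : ℝ => fderiv ℝ ψ (p + y + t • e) e :=
    (hψ.fderiv_apply e).smooth.continuous.comp (by fun_prop)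
  rw [heq, integral_indicator measurableSet_Ioo, ← integral_Ioc_eq_integral_Ioo,
    ← intervalIntegral.integral_of_le (abs_lt.1 hf).1.le,
    intervalIntegral.integral_eq_sub_of_hasDerivAt (fun t _ => hline t)
      (hcont.intervalIntegrable _ _)]
  have : ψ (p + y + (-(R / 2)) • e) = 0 := image_eq_zero_of_notMem_tsupport
    (hout _ (by rw [abs_neg, abs_of_pos] <;> linarith))
  rw [this, sub_zero]

/-- In a chart, the derivative of the indicator of `Ω` in the direction `e` is a measure
comparable to the surface measure, up to a factor close to `1`. -/
theorem exists_measure (h : IsChart Ω p e ε R ρ) (hΩ : IsOpen Ω) (hp : p ∈ frontier Ω)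
    (hε : ε ≤ 1 / 4) :
    ∃ μ : Measure (Space N), μ univ < ⊤ ∧ μ ≤ surfaceMeasure Ω ∧
      (surfaceMeasure Ω).restrict (Metric.ball p (R / 4))
        ≤ ((1 + 2 * ε.toNNReal) ^ (N - 1) : ℝ≥0) • μ ∧
      ∀ ψ, IsTestFunction (Metric.ball p (R / 4)) ψ →
        ∫ x in Ω, fderiv ℝ ψ x e = ∫ x, ψ x ∂μ := by
  classical
  have hR := h.pos
  let T : Submodule ℝ (Space N) := (ℝ ∙ e)ᗮ
  have hTe : ∀ y : T, ⟪e, (y : Space N)⟫_ℝ = 0 := fun y =>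
    Submodule.mem_orthogonal_singleton_iff_inner_right.1 y.2
  have hfin : Module.finrank ℝ T = N - 1 := by
    have h1 := (ℝ ∙ e).finrank_add_finrank_orthogonal
    rw [finrank_span_singleton (norm_ne_zero_iff.1 (by rw [h.norm_eq_one]; exact one_ne_zero)),
      finrank_euclideanSpace, Fintype.card_fin] at h1
    change 1 + Module.finrank ℝ T = N at h1
    omega
  have hvol : (Measure.euclideanHausdorffMeasure (N - 1) : Measure T) = volume := by
    rw [← hfin]; exact InnerProductSpace.euclideanHausdorffMeasure_eq_volume
  choose f hf1 hf2 hf3 using fun (y : T) (hy : ‖(y : Space N)‖ < R / 4) =>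
    h.exists_height hΩ hp hε (hTe y) hy
  -- Graph parametrisation of the boundary over the disc `B`; the value outside the disc plays no
  -- part.
  let Φ : T → Space N := fun y =>
    if hy : ‖(y : Space N)‖ < R / 4 then p + y + f y hy • e else p
  have hΦ : ∀ (y : T) (hy : ‖(y : Space N)‖ < R / 4), Φ y = p + y + f y hy • e := fun y hy => by
    simp only [Φ]; exact dif_pos hy
  let B : Set T := Metric.ball 0 (R / 4)
  have hB : ∀ y : T, y ∈ B ↔ ‖(y : Space N)‖ < R / 4 := fun y => by
    simp [B]
  have hΦB : ∀ y ∈ B, Φ y ∈ Metric.ball p R ∧ ρ (Φ y) = 0 := by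
    intro y hy
    rw [hB] at hy
    rw [hΦ y hy]
    exact ⟨h.cyl_mem_ball hy (hf1 y hy).le, hf2 y hy⟩
  have hlip : LipschitzOnWith (1 + 2 * ε.toNNReal) Φ B := by
    refine LipschitzOnWith.of_dist_le_mul fun y hy z hz => ?_
    have hest := h.abs_sub_le (hΦB z hz).1 (hΦB y hy).1
    rw [(hΦB z hz).2, (hΦB y hy).2] at hest
    rw [hB] at hy hz
    rw [hΦ y hy, hΦ z hz] at hest ⊢
    set a := f y hy
    set b := f z hz
    have e1 : p + (y : Space N) + a • e - (p + z + b • e)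
        = ((y : Space N) - z) + (a - b) • e := by rw [sub_smul]; abel
    rw [dist_eq_norm, e1]
    rw [e1, inner_add_right, inner_sub_right, hTe, hTe, inner_smul_right,
      real_inner_self_eq_norm_sq, h.norm_eq_one] at hest
    simp only [sub_zero, zero_sub, zero_add, one_pow, mul_one, abs_neg] at hest
    have hd : dist y z = ‖(y : Space N) - z‖ := by rw [dist_eq_norm]; rfl
    have hn := norm_add_le ((y : Space N) - z) ((a - b) • e)
    rw [h.norm_smul_e] at hn
    have h0 := h.eps_nonneg
    have hcast : ((1 + 2 * ε.toNNReal : ℝ≥0) : ℝ) = 1 + 2 * ε := by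
      push_cast; rw [Real.coe_toNNReal _ h0]
    rw [hcast, hd]
    -- ρ vanishes at both points of the graph, so the difference of heights is at most ε times the
    -- distance. With ε ≤ 1/4 the term ε|a - b| is absorbed, leaving the slope 2ε.
    have h3 : |a - b| ≤ ε * (‖(y : Space N) - z‖ + |a - b|) :=
      hest.trans (mul_le_mul_of_nonneg_left hn h0)
    have h4 : 0 ≤ |a - b| := abs_nonneg _
    have h5 : |a - b| ≤ 2 * ε * ‖(y : Space N) - z‖ := by nlinarith [norm_nonneg ((y : Space N) - z)]
    linarith
  have hΦm : AEMeasurable Φ (volume.restrict B) :=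
    hlip.continuousOn.aemeasurable Metric.isOpen_ball.measurableSet
  -- The projection is 1-Lipschitz and inverts `Φ` on `B`, which bounds the pushforward measure by
  -- σ; the Lipschitz constant of `Φ` gives the converse bound.
  let P : Space N → T := fun x => T.orthogonalProjectionOnto (x - p)
  have hP : LipschitzWith 1 P := by
    refine LipschitzWith.of_dist_le_mul fun x z => ?_
    rw [dist_eq_norm, ← map_sub, sub_sub_sub_cancel_right, dist_eq_norm, NNReal.coe_one, one_mul]
    exact T.norm_orthogonalProjectionOnto_apply_le _
  have heT : T.orthogonalProjectionOnto e = 0 :=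
    Submodule.orthogonalProjectionOnto_orthogonalComplement_singleton_eq_zero e
  have hPΦ : ∀ y ∈ B, P (Φ y) = y := by
    intro y hy
    rw [hB] at hy
    simp only [P]
    rw [hΦ y hy, add_assoc, add_sub_cancel_left, map_add, map_smul, heT, smul_zero, add_zero]
    exact Submodule.orthogonalProjectionOnto_mem_subspace_eq_self y
  refine ⟨Measure.map Φ (volume.restrict B), ?_, ?_, ?_, ?_⟩
  · rw [Measure.map_apply_of_aemeasurable hΦm MeasurableSet.univ, preimage_univ,
      Measure.restrict_apply_univ]
    exact measure_ball_lt_top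
  · refine Measure.le_iff.2 fun S hS => ?_
    rw [Measure.map_apply_of_aemeasurable hΦm hS, surfaceMeasure, Measure.restrict_apply hS,
      Measure.restrict_apply' Metric.isOpen_ball.measurableSet, ← hvol]
    have hsub : Φ ⁻¹' S ∩ B ⊆ P '' (S ∩ frontier Ω) := by
      rintro y ⟨hyS, hyB⟩
      exact ⟨Φ y, ⟨hyS, (h.mem_frontier_iff hΩ (by linarith) (hΦB y hyB).1).2 (hΦB y hyB).2⟩,
        hPΦ y hyB⟩
    refine (measure_mono hsub).trans ?_
    have := euclideanHausdorffMeasure_image_le (hP.lipschitzOnWith (s := S ∩ frontier Ω)) (N - 1)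
    simpa using this
  · refine Measure.le_iff.2 fun S hS => ?_
    rw [Measure.restrict_apply hS, surfaceMeasure, Measure.restrict_apply (hS.inter
      Metric.isOpen_ball.measurableSet), Measure.smul_apply,
      Measure.map_apply_of_aemeasurable hΦm hS,
      Measure.restrict_apply' Metric.isOpen_ball.measurableSet, ← hvol, ENNReal.smul_def,
      smul_eq_mul, ENNReal.coe_pow]
    have hsub : S ∩ Metric.ball p (R / 4) ∩ frontier Ω ⊆ Φ '' (Φ ⁻¹' S ∩ B) := by
      rintro x ⟨⟨hxS, hxB⟩, hxf⟩
      have hn : ‖x - p‖ < R / 4 := by rwa [← dist_eq_norm]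
      have hyn : ‖((P x : T) : Space N)‖ < R / 4 :=
        (T.norm_orthogonalProjectionOnto_apply_le (x - p)).trans_lt hn
      have hdec : x = p + (P x : Space N) + ⟪e, x - p⟫_ℝ • e := by
        have h1 := Submodule.starProjection_add_starProjection_orthogonal (K := ℝ ∙ e) (x - p)
        rw [Submodule.starProjection_unit_singleton ℝ h.norm_eq_one] at h1
        have h2 : (P x : Space N) = (ℝ ∙ e)ᗮ.starProjection (x - p) := rfl
        rw [h2, add_assoc, add_comm (Submodule.starProjection _ _), h1]
        abel
      have ht : |⟪e, x - p⟫_ℝ| < R / 4 := by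
        have := abs_real_inner_le_norm e (x - p)
        rw [h.norm_eq_one, one_mul] at this
        linarith
      have hx0 : ρ x = 0 := h.defining.eq_zero hΩ
        (Metric.ball_subset_ball (by linarith) hxB) hxf
      -- A boundary point near p lies on the graph: ρ vanishes at both heights and is strictly
      -- increasing along the line.
      have hfx : f (P x) hyn = ⟪e, x - p⟫_ℝ := by
        have h2 := hf2 (P x) hyn
        rw [hdec] at hx0
        rcases lt_trichotomy (f (P x) hyn) ⟪e, x - p⟫_ℝ with hlt | heq | hlt
        · have := h.strictMono_line hε hyn (hf1 (P x) hyn).le (by linarith) hlt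
          linarith
        · exact heq
        · have := h.strictMono_line hε hyn (by linarith) (hf1 (P x) hyn).le hlt
          linarith
      have hΦx : Φ (P x) = x := by rw [hΦ _ hyn, hfx, ← hdec]
      exact ⟨P x, ⟨by rwa [mem_preimage, hΦx], (hB _).2 hyn⟩, hΦx⟩
    exact (measure_mono hsub).trans (euclideanHausdorffMeasure_image_le
      (hlip.mono inter_subset_right) (N - 1))
  · intro ψ hψ
    have hψe := hψ.fderiv_apply e
    have hint : Integrable (Ω.indicator fun x => fderiv ℝ ψ x e) :=
      (hψe.smooth.continuous.integrable_of_hasCompactSupport hψe.hasCompactSupport).indicator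
        hΩ.measurableSet
    rw [← integral_indicator hΩ.measurableSet, integral_eq_integral_line h.norm_eq_one p hint,
      integral_map hΦm hψ.smooth.continuous.aestronglyMeasurable,
      ← integral_indicator Metric.isOpen_ball.measurableSet]
    congr 1
    ext y
    by_cases hy : y ∈ B
    · rw [indicator_of_mem hy]
      have hy' := (hB y).1 hy
      rw [hΦ y hy']
      exact h.integral_slice (hTe y) (hf1 y hy') (hf3 y hy') hψ
    · rw [indicator_of_notMem hy]
      refine integral_eq_zero_of_ae (Eventually.of_forall fun t => ?_)
      have : fderiv ℝ ψ (p + y + t • e) e = 0 := by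
        refine image_eq_zero_of_notMem_tsupport (f := fun x => fderiv ℝ ψ x e) fun hm => ?_
        have h1 := hψe.tsupport_subset hm
        rw [Metric.mem_ball, dist_eq_norm, add_assoc, add_sub_cancel_left] at h1
        rw [hB, not_lt] at hy
        have h2 : ‖(y : Space N)‖ * ‖(y : Space N)‖ ≤ ‖(y : Space N)‖ * ‖(y : Space N) + t • e‖ := by
          have := real_inner_le_norm (y : Space N) ((y : Space N) + t • e)
          rwa [inner_add_right, inner_smul_right, real_inner_comm e, hTe, mul_zero, add_zero,
            real_inner_self_eq_norm_mul_norm] at this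
        have h3 : 0 < ‖(y : Space N)‖ := by linarith
        have := le_of_mul_le_mul_left h2 h3
        linarith
      simp only [indicator_apply, this, ite_self, Pi.zero_apply]

end IsChart

end

/-! ### The Gauss-Green formula for smooth functions -/

theorem IsTestFunction.mono {U V : Set (Space N)} {ψ : Space N → ℝ} (h : IsTestFunction U ψ)
    (hUV : U ⊆ V) : IsTestFunction V ψ :=
  ⟨h.smooth, h.hasCompactSupport, h.tsupport_subset.trans hUV⟩

theorem IsTestFunction.integrable_fderiv {ψ : Space N → ℝ} {U : Set (Space N)}
    (h : IsTestFunction U ψ) (v : Space N) : Integrable fun x => fderiv ℝ ψ x v :=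
  (h.fderiv_apply v).smooth.continuous.integrable_of_hasCompactSupport
    (h.fderiv_apply v).hasCompactSupport

theorem IsTestFunction.integrable {ψ : Space N → ℝ} {U : Set (Space N)}
    (h : IsTestFunction U ψ) {μ : Measure (Space N)} [IsFiniteMeasure μ] : Integrable ψ μ := by
  obtain ⟨C, hC⟩ := h.smooth.continuous.bounded_above_of_compact_support h.hasCompactSupport
  exact Integrable.of_bound h.smooth.continuous.aestronglyMeasurable C (Eventually.of_forall hC)

theorem surfaceMeasure_ae_mem : ∀ᵐ x ∂(surfaceMeasure Ω), x ∈ frontier Ω :=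
  ae_restrict_mem isClosed_frontier.measurableSet

theorem aestronglyMeasurable_surfaceMeasure {F : Type*} [NormedAddCommGroup F]
    {f : Space N → F} (hf : ContinuousOn f (frontier Ω)) :
    AEStronglyMeasurable f (surfaceMeasure Ω) :=
  hf.aestronglyMeasurable isClosed_frontier.measurableSet

namespace IsChart

variable {p e : Space N} {ε R : ℝ} {ρ : Space N → ℝ}

/-- Distributionally the gradient of the indicator of Ω is a nonpositive multiple of ∇ρ, and ∇ρ is
ε-close to e. Hence its v component is nearly ⟨e, v⟩ times its e component, the error being relative
to the latter because ψ ≥ 0. -/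
theorem abs_integral_fderiv_sub_le (h : IsChart Ω p e ε R ρ) (hΩ : IsOpen Ω) (hε : ε ≤ 1 / 4)
    {ψ : Space N → ℝ} (hψ : IsTestFunction (Metric.ball p R) ψ) (h0 : ∀ x, 0 ≤ ψ x)
    (v : Space N) :
    |(∫ x in Ω, fderiv ℝ ψ x v) - ⟪e, v⟫_ℝ * ∫ x in Ω, fderiv ℝ ψ x e|
      ≤ 4 * ε * ‖v‖ * ∫ x in Ω, fderiv ℝ ψ x e := by
  -- Smooth approximations of the indicator of Ω: zero where ρ ≥ 0, and eventually 1 at each point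
  -- where ρ < 0.
  let H : ℕ → Space N → ℝ := fun k x => Real.smoothTransition (-(k : ℝ) * ρ x)
  have hρ1 : ContDiffOn ℝ 1 ρ (Metric.ball p R) := h.defining.smooth.of_le (by exact_mod_cast le_top)
  have hH : ∀ k, ContDiffOn ℝ 1 (H k) (Metric.ball p R) := fun k =>
    (Real.smoothTransition.contDiff (n := 1)).comp_contDiffOn (contDiffOn_const.mul hρ1)
  have hparts := fun k (w : Space N) =>
    hψ.integral_mul_fderiv Metric.isOpen_ball (hH k) w
  have hint := fun k (w : Space N) =>
    hψ.integrable_mul Metric.isOpen_ball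
      (((hH k).continuousOn_fderiv_of_isOpen Metric.isOpen_ball le_rfl).clm_apply
        (continuousOn_const (c := w))) hψ.smooth.continuous subset_rfl
  have hlim : ∀ w, Tendsto (fun k => ∫ x, H k x * fderiv ℝ ψ x w) atTop
      (𝓝 (∫ x in Ω, fderiv ℝ ψ x w)) := by
    intro w
    rw [← integral_indicator hΩ.measurableSet]
    refine tendsto_integral_of_dominated_convergence (fun x => ‖fderiv ℝ ψ x w‖) ?_
      (hψ.integrable_fderiv w).norm ?_ ?_
    · intro k
      exact (hψ.integrable_mul Metric.isOpen_ball (hH k).continuousOn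
        (hψ.fderiv_apply w).smooth.continuous
        (tsupport_fderiv_apply_subset ℝ w)).aestronglyMeasurable
    · intro k
      refine Eventually.of_forall fun x => ?_
      rw [norm_mul]
      refine mul_le_of_le_one_left (norm_nonneg _) ?_
      rw [Real.norm_of_nonneg (Real.smoothTransition.nonneg _)]
      exact Real.smoothTransition.le_one _
    · refine Eventually.of_forall fun x => ?_
      by_cases hxB : x ∈ Metric.ball p R
      · by_cases hx : x ∈ Ω
        · rw [indicator_of_mem hx]
          have hρx := (h.defining.mem_iff x hxB).1 hx
          obtain ⟨n, hn⟩ := exists_nat_gt (1 / (-ρ x))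
          rw [div_lt_iff₀ (by linarith)] at hn
          refine tendsto_const_nhds.congr' ?_
          filter_upwards [eventually_ge_atTop n] with k hk
          have : (1 : ℝ) ≤ -(k : ℝ) * ρ x := by
            have : (n : ℝ) ≤ k := by exact_mod_cast hk
            nlinarith
          simp only [H]
          rw [Real.smoothTransition.one_of_one_le this, one_mul]
        · rw [indicator_of_notMem hx]
          have hρx : 0 ≤ ρ x := not_lt.1 fun hh => hx ((h.defining.mem_iff x hxB).2 hh)
          refine tendsto_const_nhds.congr fun k => ?_
          have : -(k : ℝ) * ρ x ≤ 0 := by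
            have : (0 : ℝ) ≤ k := Nat.cast_nonneg k
            nlinarith
          simp only [H]
          rw [Real.smoothTransition.zero_of_nonpos this, zero_mul]
      · have h0 : fderiv ℝ ψ x w = 0 := image_eq_zero_of_notMem_tsupport
          (f := fun x => fderiv ℝ ψ x w) fun hm =>
            hxB ((hψ.fderiv_apply w).tsupport_subset hm)
        rw [show Ω.indicator (fun x => fderiv ℝ ψ x w) x = 0 by
          classical rw [indicator_apply]; simp [h0]]
        simp [h0]
  have hcomp : ∀ k, |(∫ x, H k x * fderiv ℝ ψ x v) - ⟪e, v⟫_ℝ * ∫ x, H k x * fderiv ℝ ψ x e|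
      ≤ 4 * ε * ‖v‖ * ∫ x, H k x * fderiv ℝ ψ x e := by
    intro k
    rw [hparts k v, hparts k e]
    have i1 : Integrable fun x => ψ x * fderiv ℝ (H k) x v := by
      simpa only [mul_comm] using hint k v
    have i2 : Integrable fun x => ψ x * fderiv ℝ (H k) x e := by
      simpa only [mul_comm] using hint k e
    rw [mul_neg, sub_neg_eq_add, neg_add_eq_sub, ← integral_const_mul,
      ← integral_sub (i2.const_mul _) i1, mul_neg, ← mul_neg, ← integral_neg,
      ← integral_const_mul]
    refine (abs_integral_le_integral_abs).trans (integral_mono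
      ((i2.const_mul _).sub i1).abs (i2.neg.const_mul _) fun x => ?_)
    by_cases hxB : x ∈ Metric.ball p R
    · have hd : ∀ w, fderiv ℝ (H k) x w
          = -(k * deriv Real.smoothTransition (-(k : ℝ) * ρ x) * ⟪gradient ρ x, w⟫_ℝ) := by
        intro w
        have d1 : HasDerivAt Real.smoothTransition
            (deriv Real.smoothTransition (-(k : ℝ) * ρ x)) (-(k : ℝ) * ρ x) :=
          ((Real.smoothTransition.contDiff (n := 1)).differentiable one_ne_zero _).hasDerivAt
        have d2 := (h.defining.differentiableAt hxB).hasFDerivAt.const_mul (-(k : ℝ))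
        have := (d1.comp_hasFDerivAt x d2).fderiv
        have e1 : H k = Real.smoothTransition ∘ fun x => -(k : ℝ) * ρ x := rfl
        rw [e1, this, inner_gradient_left]
        simp only [smul_apply, smul_eq_mul]
        ring
      set q := k * deriv Real.smoothTransition (-(k : ℝ) * ρ x)
      have hq : 0 ≤ q := mul_nonneg (Nat.cast_nonneg k) Real.smoothTransition.monotone.deriv_nonneg
      simp only [hd]
      have hc := h.close x hxB
      have hE : ∀ w, ⟪gradient ρ x, w⟫_ℝ = ⟪e, w⟫_ℝ + ⟪gradient ρ x - e, w⟫_ℝ := by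
        intro w; rw [inner_sub_left]; ring
      have hee : ⟪e, e⟫_ℝ = 1 := by rw [real_inner_self_eq_norm_sq, h.norm_eq_one, one_pow]
      have b1 : |⟪gradient ρ x - e, v⟫_ℝ| ≤ ε * ‖v‖ :=
        (abs_real_inner_le_norm _ _).trans (by gcongr)
      have b2 : |⟪gradient ρ x - e, e⟫_ℝ| ≤ ε := by
        refine (abs_real_inner_le_norm _ _).trans ?_
        rw [h.norm_eq_one, mul_one]; exact hc
      have b3 : |⟪e, v⟫_ℝ| ≤ ‖v‖ := by
        refine (abs_real_inner_le_norm _ _).trans ?_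
        rw [h.norm_eq_one, one_mul]
      set a := ⟪gradient ρ x - e, v⟫_ℝ
      set b := ⟪gradient ρ x - e, e⟫_ℝ
      set c := ⟪e, v⟫_ℝ
      rw [hE v, hE e, hee]
      -- The left side is at most 2ε‖v‖, while 1 + b ≥ 3/4 makes the right side at least 3ε‖v‖.
      have key : |a - c * b| ≤ 4 * ε * ‖v‖ * (1 + b) := by
        have h1 : |a - c * b| ≤ ε * ‖v‖ + ‖v‖ * ε := by
          refine (abs_sub _ _).trans (add_le_add b1 ?_)
          rw [abs_mul]
          exact mul_le_mul b3 b2 (abs_nonneg _) (norm_nonneg _)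
        have h2 : 3 / 4 ≤ 1 + b := by linarith [(abs_le.1 b2).1]
        have h3 : 0 ≤ ε * ‖v‖ := mul_nonneg h.eps_nonneg (norm_nonneg _)
        nlinarith
      have e1 : c * (ψ x * -(q * (1 + b))) - ψ x * -(q * (c + a)) = (ψ x * q) * (a - c * b) := by
        ring
      have e2 : 4 * ε * ‖v‖ * -(ψ x * -(q * (1 + b))) = (ψ x * q) * (4 * ε * ‖v‖ * (1 + b)) := by
        ring
      rw [e1, e2, abs_mul, abs_of_nonneg (mul_nonneg (h0 x) hq)]
      exact mul_le_mul_of_nonneg_left key (mul_nonneg (h0 x) hq)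
    · have : ψ x = 0 := image_eq_zero_of_notMem_tsupport fun hm => hxB (hψ.tsupport_subset hm)
      simp [this]
  exact le_of_tendsto_of_tendsto
    (((hlim v).sub ((hlim e).const_mul _)).abs) ((hlim e).const_mul _)
    (Eventually.of_forall hcomp)

end IsChart

theorem IsBoundedSmoothDomain.isCompact_frontier (hΩ : IsBoundedSmoothDomain Ω) :
    IsCompact (frontier Ω) :=
  hΩ.isBounded.isCompact_closure.of_isClosed_subset isClosed_frontier frontier_subset_closure

/-- In a chart σ is at most a constant times a finite measure, and ∂Ω is compact. -/
theorem IsBoundedSmoothDomain.surfaceMeasure_univ_lt_top (hΩ : IsBoundedSmoothDomain Ω) :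
    surfaceMeasure Ω univ < ⊤ := by
  have hloc : ∀ p ∈ frontier Ω, ∃ t ∈ 𝓝[frontier Ω] p, surfaceMeasure Ω t < ⊤ := by
    intro p hp
    obtain ⟨e, R, ρ, h⟩ := hΩ.exists_chart hp (ε := 1 / 4) (by norm_num)
    obtain ⟨μ, hμ, -, h2, -⟩ := h.exists_measure hΩ.isOpen hp le_rfl
    refine ⟨Metric.ball p (R / 4), mem_nhdsWithin_of_mem_nhds
      (Metric.ball_mem_nhds p (by linarith [h.pos])), ?_⟩
    have := h2 univ
    rw [Measure.restrict_apply_univ, Measure.smul_apply] at this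
    refine this.trans_lt ?_
    rw [ENNReal.smul_def, smul_eq_mul]
    exact ENNReal.mul_lt_top ENNReal.coe_lt_top hμ
  have h1 : surfaceMeasure Ω (frontier Ω) < ⊤ :=
    hΩ.isCompact_frontier.measure_lt_top_of_nhdsWithin hloc
  rw [surfaceMeasure, Measure.restrict_apply_self] at h1
  rwa [surfaceMeasure, Measure.restrict_apply_univ]

theorem IsBoundedSmoothDomain.isFiniteMeasure (hΩ : IsBoundedSmoothDomain Ω) :
    IsFiniteMeasure (surfaceMeasure Ω) := ⟨hΩ.surfaceMeasure_univ_lt_top⟩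

theorem IsBoundedSmoothDomain.aestronglyMeasurable_outerNormal (hΩ : IsBoundedSmoothDomain Ω) :
    AEStronglyMeasurable (outerNormal Ω) (surfaceMeasure Ω) :=
  aestronglyMeasurable_surfaceMeasure hΩ.continuousOn_outerNormal

theorem IsBoundedSmoothDomain.integrable_mul_normal (hΩ : IsBoundedSmoothDomain Ω)
    {ψ : Space N → ℝ} (hψ : Integrable ψ (surfaceMeasure Ω)) (v : Space N) :
    Integrable (fun x => ψ x * ⟪outerNormal Ω x, v⟫_ℝ) (surfaceMeasure Ω) := by
  refine hψ.mul_bdd (c := ‖v‖) (hΩ.aestronglyMeasurable_outerNormal.inner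
    aestronglyMeasurable_const) ?_
  filter_upwards [surfaceMeasure_ae_mem] with x hx
  refine (norm_inner_le_norm _ _).trans ?_
  rw [hΩ.norm_outerNormal hx, one_mul]

/-- The errors of `local_gaussGreen_frontier`: 4ε from comparing directions, 2ε from the normal, and
the power from comparing σ with Lebesgue measure on the hyperplane. -/
theorem exists_small_eps (n : ℕ) {δ : ℝ} (hδ : 0 < δ) :
    ∃ ε : ℝ, 0 < ε ∧ ε ≤ 1 / 4 ∧ 6 * ε + ((1 + 2 * ε) ^ n - 1) ≤ δ := by
  have hc : Continuous fun ε : ℝ => 6 * ε + ((1 + 2 * ε) ^ n - 1) := by fun_prop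
  have ht : Tendsto (fun ε : ℝ => 6 * ε + ((1 + 2 * ε) ^ n - 1)) (𝓝[>] 0) (𝓝 0) := by
    have h := (hc.tendsto 0).mono_left (nhdsWithin_le_nhds (s := Ioi 0))
    simpa using h
  have h2 : ∀ᶠ ε : ℝ in 𝓝[>] 0, ε ≤ 1 / 4 :=
    mem_nhdsWithin_of_mem_nhds (ge_mem_nhds (by norm_num))
  have h3 : ∀ᶠ ε : ℝ in 𝓝[>] 0, 0 < ε := self_mem_nhdsWithin
  obtain ⟨ε, h1, h2, h3⟩ := ((ht.eventually (ge_mem_nhds hδ)).and (h2.and h3)).exists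
  exact ⟨ε, h3, h2, h1⟩

/-- Both terms are compared with ⟨e, v⟩ ∫ψ dσ: the volume integral through the derivative in the
direction e and the measure of `IsChart.exists_measure`, the surface integral through the closeness
of ν to e. -/
theorem IsBoundedSmoothDomain.local_gaussGreen_frontier (hΩ : IsBoundedSmoothDomain Ω)
    {p : Space N} (hp : p ∈ frontier Ω) {δ : ℝ} (hδ : 0 < δ) :
    ∃ U ∈ 𝓝 p, ∀ ψ, IsTestFunction U ψ → (∀ x, 0 ≤ ψ x) → ∀ v,
      |(∫ x in Ω, fderiv ℝ ψ x v) - ∫ x, ψ x * ⟪outerNormal Ω x, v⟫_ℝ ∂(surfaceMeasure Ω)|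
        ≤ δ * ‖v‖ * ∫ x, ψ x ∂(surfaceMeasure Ω) := by
  have := hΩ.isFiniteMeasure
  obtain ⟨ε, hε0, hε, hεδ⟩ := exists_small_eps (N - 1) hδ
  obtain ⟨e, R, ρ, h⟩ := hΩ.exists_chart hp hε0
  obtain ⟨μ, hμ, hμ1, hμ2, hμ3⟩ := h.exists_measure hΩ.isOpen hp hε
  have : IsFiniteMeasure μ := ⟨hμ⟩
  have hR := h.pos
  refine ⟨Metric.ball p (R / 4), Metric.ball_mem_nhds p (by linarith), fun ψ hψ h0 v => ?_⟩
  have hsub : Metric.ball p (R / 4) ⊆ Metric.ball p R := Metric.ball_subset_ball (by linarith)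
  have hz : ∀ x, x ∉ Metric.ball p (R / 4) → ψ x = 0 := fun x hx =>
    image_eq_zero_of_notMem_tsupport fun hm => hx (hψ.tsupport_subset hm)
  set σ := surfaceMeasure Ω
  set S := ∫ x, ψ x ∂σ with hS
  set I := ∫ x in Ω, fderiv ℝ ψ x e with hI
  have hS0 : 0 ≤ S := integral_nonneg h0
  have hIμ : I = ∫ x, ψ x ∂μ := hμ3 ψ hψ
  have hIS : I ≤ S := by
    rw [hIμ]
    exact integral_mono_measure hμ1 (Eventually.of_forall h0) hψ.integrable
  have hSI : S ≤ (1 + 2 * ε) ^ (N - 1) * I := by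
    have e1 : S = ∫ x in Metric.ball p (R / 4), ψ x ∂σ :=
      (setIntegral_eq_integral_of_forall_compl_eq_zero hz).symm
    rw [e1, hIμ]
    refine (integral_mono_measure hμ2 (Eventually.of_forall h0)
      (hψ.integrable.smul_measure_nnreal)).trans (le_of_eq ?_)
    rw [integral_smul_nnreal_measure, NNReal.smul_def, smul_eq_mul]
    push_cast
    rw [Real.coe_toNNReal _ hε0.le]
  have hI0 : 0 ≤ I := by rw [hIμ]; exact integral_nonneg h0
  have h1 := h.abs_integral_fderiv_sub_le hΩ.isOpen hε (hψ.mono hsub) h0 v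
  have h2 : |(∫ x, ψ x * ⟪outerNormal Ω x, v⟫_ℝ ∂σ) - ⟪e, v⟫_ℝ * S| ≤ 2 * ε * ‖v‖ * S := by
    have hi : Integrable ψ σ := hψ.integrable
    rw [hS, ← integral_const_mul, ← integral_const_mul,
      ← integral_sub (hΩ.integrable_mul_normal hi v) (hi.const_mul _)]
    refine (abs_integral_le_integral_abs).trans (integral_mono_ae
      ((hΩ.integrable_mul_normal hi v).sub (hi.const_mul _)).abs (hi.const_mul _) ?_)
    filter_upwards [surfaceMeasure_ae_mem] with x hx
    by_cases hxB : x ∈ Metric.ball p (R / 4)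
    · have hn := h.norm_outerNormal_sub_le hΩ (hsub hxB) hx
      have e1 : ψ x * ⟪outerNormal Ω x, v⟫_ℝ - ⟪e, v⟫_ℝ * ψ x
          = ⟪outerNormal Ω x - e, v⟫_ℝ * ψ x := by rw [inner_sub_left]; ring
      rw [e1, abs_mul, abs_of_nonneg (h0 x)]
      refine mul_le_mul_of_nonneg_right ?_ (h0 x)
      exact (abs_real_inner_le_norm _ _).trans (by gcongr)
    · simp [hz x hxB]
  have h3 : |⟪e, v⟫_ℝ| ≤ ‖v‖ := by
    refine (abs_real_inner_le_norm _ _).trans ?_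
    rw [h.norm_eq_one, one_mul]
  have h4 : |⟪e, v⟫_ℝ * (I - S)| ≤ ‖v‖ * (((1 + 2 * ε) ^ (N - 1) - 1) * S) := by
    rw [abs_mul]
    refine mul_le_mul h3 ?_ (abs_nonneg _) (norm_nonneg _)
    have hK : 1 ≤ (1 + 2 * ε) ^ (N - 1) := one_le_pow₀ (by linarith)
    rw [abs_le]
    constructor <;> nlinarith
  have h5 : 4 * ε * ‖v‖ * I ≤ 4 * ε * ‖v‖ * S := by gcongr
  have hsplit : (∫ x in Ω, fderiv ℝ ψ x v) - ∫ x, ψ x * ⟪outerNormal Ω x, v⟫_ℝ ∂σ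
      = ((∫ x in Ω, fderiv ℝ ψ x v) - ⟪e, v⟫_ℝ * I) + ⟪e, v⟫_ℝ * (I - S)
        - ((∫ x, ψ x * ⟪outerNormal Ω x, v⟫_ℝ ∂σ) - ⟪e, v⟫_ℝ * S) := by ring
  rw [hsplit]
  refine (abs_sub _ _).trans ((add_le_add ((abs_add_le _ _).trans (add_le_add (h1.trans h5) h4))
    h2).trans ?_)
  have h6 : 0 ≤ ‖v‖ * S := mul_nonneg (norm_nonneg _) hS0
  nlinarith [mul_le_mul_of_nonneg_right hεδ h6]

theorem IsBoundedSmoothDomain.local_gaussGreen (hΩ : IsBoundedSmoothDomain Ω)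
    (p : Space N) {δ : ℝ} (hδ : 0 < δ) :
    ∃ U ∈ 𝓝 p, ∀ ψ, IsTestFunction U ψ → (∀ x, 0 ≤ ψ x) → ∀ v,
      |(∫ x in Ω, fderiv ℝ ψ x v) - ∫ x, ψ x * ⟪outerNormal Ω x, v⟫_ℝ ∂(surfaceMeasure Ω)|
        ≤ δ * ‖v‖ * ∫ x, ψ x ∂(surfaceMeasure Ω) := by
  by_cases hp : p ∈ frontier Ω
  · exact hΩ.local_gaussGreen_frontier hp hδ
  -- Off the frontier the indicator of Ω is locally constant, so both integrals vanish.
  refine ⟨(frontier Ω)ᶜ, isClosed_frontier.isOpen_compl.mem_nhds hp, fun ψ hψ h0 v => ?_⟩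
  have hz : ∀ x ∈ frontier Ω, ψ x = 0 := fun x hx =>
    image_eq_zero_of_notMem_tsupport fun hm => hψ.tsupport_subset hm hx
  have e1 : ∫ x, ψ x * ⟪outerNormal Ω x, v⟫_ℝ ∂(surfaceMeasure Ω) = 0 := by
    refine integral_eq_zero_of_ae ?_
    filter_upwards [surfaceMeasure_ae_mem] with x hx
    simp [hz x hx]
  have e2 : ∫ x in Ω, fderiv ℝ ψ x v = 0 := by
    have hloc : ∀ x ∈ (frontier Ω)ᶜ, ∃ c : ℝ, Ω.indicator (fun _ => (1 : ℝ)) =ᶠ[𝓝 x] fun _ => c := by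
      intro x hx
      by_cases hxΩ : x ∈ Ω
      · refine ⟨1, ?_⟩
        filter_upwards [hΩ.isOpen.mem_nhds hxΩ] with y hy
        exact indicator_of_mem hy _
      · have hc : x ∉ closure Ω := fun hc => hx (by
          rw [hΩ.isOpen.frontier_eq]; exact ⟨hc, hxΩ⟩)
        refine ⟨0, ?_⟩
        filter_upwards [isClosed_closure.isOpen_compl.mem_nhds hc] with y hy
        exact indicator_of_notMem (fun h => hy (subset_closure h)) _
    have hC : ContDiffOn ℝ 1 (Ω.indicator (fun _ => (1 : ℝ))) (frontier Ω)ᶜ := fun x hx => by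
      obtain ⟨c, hc⟩ := hloc x hx
      exact (contDiffAt_const.congr_of_eventuallyEq hc).contDiffWithinAt
    have h := hψ.integral_mul_fderiv isClosed_frontier.isOpen_compl hC v
    have hr : ∫ x, ψ x * fderiv ℝ (Ω.indicator fun _ => (1 : ℝ)) x v = 0 := by
      refine integral_eq_zero_of_ae (Eventually.of_forall fun x => ?_)
      by_cases hx : x ∈ frontier Ω
      · simp [hz x hx]
      · obtain ⟨c, hc⟩ := hloc x hx
        simp [hc.fderiv_eq]
    rw [hr, neg_zero] at h
    rw [← integral_indicator hΩ.isOpen.measurableSet, ← h]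
    congr 1; ext x
    classical rw [indicator_apply, indicator_apply]; split_ifs <;> simp
  rw [e1, e2]
  simp only [sub_zero, abs_zero]
  have : 0 ≤ ∫ x, ψ x ∂(surfaceMeasure Ω) := integral_nonneg h0
  positivity

/-- Gauss-Green formula for nonnegative smooth functions. -/
theorem IsBoundedSmoothDomain.gaussGreen (hΩ : IsBoundedSmoothDomain Ω)
    {ψ : Space N → ℝ} (hψ : IsTestFunction univ ψ) (h0 : ∀ x, 0 ≤ ψ x) (v : Space N) :
    ∫ x in Ω, fderiv ℝ ψ x v = ∫ x, ψ x * ⟪outerNormal Ω x, v⟫_ℝ ∂(surfaceMeasure Ω) := by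
  have := hΩ.isFiniteMeasure
  set S := ∫ x, ψ x ∂(surfaceMeasure Ω) with hS
  -- The local errors are multiples of ∫ χ_i ψ dσ, which add up to ∫ψ dσ; the total does not depend
  -- on the number of pieces, however fine the partition.
  have hbound : ∀ δ : ℝ, 0 < δ →
      |(∫ x in Ω, fderiv ℝ ψ x v) - ∫ x, ψ x * ⟪outerNormal Ω x, v⟫_ℝ ∂(surfaceMeasure Ω)|
        ≤ δ * ‖v‖ * S := by
    intro δ hδ
    choose U hU hloc using fun p => hΩ.local_gaussGreen p hδ
    obtain ⟨t, χ, -, hχ, hsum⟩ := exists_finite_partition hψ.hasCompactSupport.isCompact U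
      fun x _ => hU x
    have htest : ∀ i ∈ t, IsTestFunction (U i) (fun x => χ i x * ψ x) := fun i hi =>
      ⟨(hχ i hi).1.mul hψ.smooth, hψ.hasCompactSupport.mul_left,
        tsupport_mul_subset_left.trans (hχ i hi).2.2.1⟩
    have hdec : ψ = fun x => ∑ i ∈ t, χ i x * ψ x := by
      ext x
      rw [← Finset.sum_mul]
      by_cases hx : x ∈ tsupport ψ
      · rw [hsum x hx, one_mul]
      · rw [image_eq_zero_of_notMem_tsupport hx, mul_zero]
    have d1 : ∫ x in Ω, fderiv ℝ ψ x v
        = ∑ i ∈ t, ∫ x in Ω, fderiv ℝ (fun x => χ i x * ψ x) x v := by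
      rw [← integral_finsetSum _ fun i hi => ((htest i hi).integrable_fderiv v).integrableOn]
      congr 1; ext x
      conv_lhs => rw [hdec]
      rw [fderiv_fun_sum fun i hi => (htest i hi).smooth.differentiable (by simp) x,
        _root_.sum_apply]
    have d2 : ∫ x, ψ x * ⟪outerNormal Ω x, v⟫_ℝ ∂(surfaceMeasure Ω)
        = ∑ i ∈ t, ∫ x, χ i x * ψ x * ⟪outerNormal Ω x, v⟫_ℝ ∂(surfaceMeasure Ω) := by
      rw [← integral_finsetSum _ fun i hi => hΩ.integrable_mul_normal (htest i hi).integrable v]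
      congr 1; ext x
      conv_lhs => rw [hdec]
      rw [Finset.sum_mul]
    have d3 : S = ∑ i ∈ t, ∫ x, χ i x * ψ x ∂(surfaceMeasure Ω) := by
      rw [← integral_finsetSum _ fun i hi => (htest i hi).integrable, hS]
      conv_lhs => rw [hdec]
    rw [d1, d2, d3, ← Finset.sum_sub_distrib, Finset.mul_sum]
    refine (Finset.abs_sum_le_sum_abs _ _).trans (Finset.sum_le_sum fun i hi => ?_)
    exact hloc i _ (htest i hi) (fun x => mul_nonneg ((hχ i hi).2.2.2 x) (h0 x)) v
  rw [← sub_eq_zero, ← abs_eq_zero]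
  refine le_antisymm ?_ (abs_nonneg _)
  refine le_of_forall_pos_le_add fun η hη => ?_
  have hS0 : 0 ≤ S := integral_nonneg h0
  refine (hbound (η / (‖v‖ * S + 1)) (by positivity)).trans ?_
  rw [zero_add, div_mul_eq_mul_div, div_mul_eq_mul_div, div_le_iff₀ (by positivity)]
  nlinarith

/-! ### Traces -/

open scoped ENNReal in
/-- The density of the averages over `Ω ∩ B_r(x)`. -/
def traceKernel (Ω : Set (Space N)) (r : ℝ) (z : Space N × Space N) : ℝ≥0∞ :=
  {z : Space N × Space N | dist z.2 z.1 < r}.indicator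
    (fun z => (volume (Ω ∩ Metric.ball z.1 r))⁻¹) z

/-- The measure on `∂Ω × Ω` whose integrals are the integrals over `x ∈ ∂Ω` of the averages over
`Ω ∩ B_r(x)`. -/
def traceMeasure (Ω : Set (Space N)) (r : ℝ) : Measure (Space N × Space N) :=
  ((surfaceMeasure Ω).prod (volume.restrict Ω)).withDensity (traceKernel Ω r)

theorem measurable_traceKernel (hΩ : IsOpen Ω) (r : ℝ) : Measurable (traceKernel Ω r) := by
  have hs : MeasurableSet {z : Space N × Space N | dist z.2 z.1 < r} :=
    (isOpen_lt (by fun_prop) continuous_const).measurableSet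
  refine Measurable.indicator ?_ hs
  have h : MeasurableSet ({z : Space N × Space N | dist z.2 z.1 < r} ∩ Prod.snd ⁻¹' Ω) :=
    hs.inter (measurable_snd hΩ.measurableSet)
  have h1 := measurable_measure_prodMk_left (ν := (volume : Measure (Space N))) h
  have h2 : (fun x : Space N => volume (Ω ∩ Metric.ball x r)) = fun x => volume (Prod.mk x ⁻¹'
      ({z : Space N × Space N | dist z.2 z.1 < r} ∩ Prod.snd ⁻¹' Ω)) := by
    ext x; congr 1; ext y; simp [and_comm]
  rw [← h2] at h1
  exact (h1.comp measurable_fst).inv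

theorem traceMeasure_absolutelyContinuous (Ω : Set (Space N)) (r : ℝ) :
    traceMeasure Ω r ≪ (surfaceMeasure Ω).prod (volume.restrict Ω) :=
  withDensity_absolutelyContinuous _ _

theorem volume_inter_ball_ne_zero (hΩ : IsOpen Ω) {x : Space N} (hx : x ∈ frontier Ω) {r : ℝ}
    (hr : 0 < r) : volume (Ω ∩ Metric.ball x r) ≠ 0 := by
  refine (hΩ.inter Metric.isOpen_ball).measure_ne_zero _ ?_
  obtain ⟨y, hy, hyx⟩ := Metric.mem_closure_iff.1 (frontier_subset_closure hx) r hr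
  exact ⟨y, hy, by rwa [Metric.mem_ball, dist_comm]⟩

/-- The averages become integrals against one measure on the product, to which monotonicity and
additivity apply directly. The division is legitimate since Ω meets every ball centred on ∂Ω. -/
theorem lintegral_traceMeasure (hΩ : IsOpen Ω) {r : ℝ} (hr : 0 < r)
    {φ : Space N × Space N → ENNReal}
    (hφ : AEMeasurable φ ((surfaceMeasure Ω).prod (volume.restrict Ω))) :
    ∫⁻ z, φ z ∂(traceMeasure Ω r)
      = ∫⁻ x, laverage (volume.restrict (Ω ∩ Metric.ball x r)) (fun y => φ (x, y))
        ∂(surfaceMeasure Ω) := by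
  rw [traceMeasure, lintegral_withDensity_eq_lintegral_mul₀
    (measurable_traceKernel hΩ r).aemeasurable hφ,
    lintegral_prod _ ((measurable_traceKernel hΩ r).aemeasurable.mul hφ)]
  refine lintegral_congr_ae ?_
  filter_upwards [surfaceMeasure_ae_mem] with x hx
  have h0 := volume_inter_ball_ne_zero hΩ hx hr
  rw [setLAverage_eq, ENNReal.div_eq_inv_mul, ← lintegral_const_mul' _ _ (ENNReal.inv_ne_top.2 h0),
    inter_comm, ← Measure.restrict_restrict Metric.isOpen_ball.measurableSet,
    ← lintegral_indicator Metric.isOpen_ball.measurableSet]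
  congr 1; ext y
  rw [Pi.mul_apply, traceKernel]
  by_cases hy : y ∈ Metric.ball x r
  · rw [indicator_of_mem hy, indicator_of_mem (show (x, y) ∈ _ from hy), inter_comm]
  · rw [indicator_of_notMem hy, indicator_of_notMem (show (x, y) ∉ _ from hy), zero_mul]

theorem lintegral_fst_traceMeasure_le (hΩ : IsOpen Ω) {r : ℝ} (hr : 0 < r)
    {φ : Space N → ENNReal} (hφ : AEMeasurable φ (surfaceMeasure Ω)) :
    ∫⁻ z, φ z.1 ∂(traceMeasure Ω r) ≤ ∫⁻ x, φ x ∂(surfaceMeasure Ω) := by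
  rw [lintegral_traceMeasure hΩ hr (φ := fun z => φ z.1) hφ.comp_fst]
  refine lintegral_mono fun x => ?_
  simp only [setLAverage_eq, lintegral_const, Measure.restrict_apply_univ]
  exact ENNReal.div_le_of_le_mul le_rfl

theorem traceMeasure_ae (hΩ : IsOpen Ω) (r : ℝ) :
    ∀ᵐ z ∂(traceMeasure Ω r), z.1 ∈ frontier Ω ∧ z.2 ∈ Ω ∧ dist z.2 z.1 < r := by
  have h1 : ∀ᵐ z ∂((surfaceMeasure Ω).prod (volume.restrict Ω)), z.1 ∈ frontier Ω :=
    Measure.quasiMeasurePreserving_fst.ae surfaceMeasure_ae_mem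
  have h2 : ∀ᵐ z ∂((surfaceMeasure Ω).prod (volume.restrict Ω)), z.2 ∈ Ω :=
    Measure.quasiMeasurePreserving_snd.ae (ae_restrict_mem hΩ.measurableSet)
  have h3 : ∀ᵐ z ∂(traceMeasure Ω r), traceKernel Ω r z ≠ 0 := by
    rw [traceMeasure, ae_withDensity_iff (measurable_traceKernel hΩ r)]
    exact Eventually.of_forall fun _ h => h
  filter_upwards [traceMeasure_absolutelyContinuous Ω r h1,
    traceMeasure_absolutelyContinuous Ω r h2, h3] with z a b c
  refine ⟨a, b, ?_⟩
  by_contra h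
  exact c (indicator_of_notMem (show z ∉ _ from h) _)

section Trace

variable {F F' : Type*} [NormedAddCommGroup F] [NormedAddCommGroup F']
  {f fb : Space N → F} {f' fb' : Space N → F'}

theorem IsBoundedSmoothDomain.aemeasurable_enorm_sub (hΩ : IsBoundedSmoothDomain Ω)
    (hf : AEStronglyMeasurable f (volume.restrict Ω))
    (hfb : AEStronglyMeasurable fb (surfaceMeasure Ω)) :
    AEMeasurable (fun z : Space N × Space N => ‖f z.2 - fb z.1‖ₑ)
      ((surfaceMeasure Ω).prod (volume.restrict Ω)) :=
  have := hΩ.isFiniteMeasure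
  (hf.comp_snd.sub hfb.comp_fst).enorm

theorem IsBoundedSmoothDomain.hasTrace_iff (hΩ : IsBoundedSmoothDomain Ω)
    (hf : AEStronglyMeasurable f (volume.restrict Ω)) :
    HasTrace Ω f fb ↔ Integrable fb (surfaceMeasure Ω) ∧
      Tendsto (fun r : ℝ => ∫⁻ z, ‖f z.2 - fb z.1‖ₑ ∂(traceMeasure Ω r)) (𝓝[>] 0) (𝓝 0) := by
  refine and_congr_right fun hfb => tendsto_congr' ?_
  filter_upwards [self_mem_nhdsWithin] with r hr
  rw [lintegral_traceMeasure hΩ.isOpen hr (hΩ.aemeasurable_enorm_sub hf hfb.aestronglyMeasurable)]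

/-- Criterion for transferring a trace: for fixed κ the first term tends to zero whatever C is, and
the second contributes at most κ ∫(1 + |fb|) dσ, which is as small as desired. -/
theorem HasTrace.of_norm_sub_le (h : HasTrace Ω f fb) (hΩ : IsBoundedSmoothDomain Ω)
    (hf : AEStronglyMeasurable f (volume.restrict Ω))
    (hf' : AEStronglyMeasurable f' (volume.restrict Ω))
    (hfb' : Integrable fb' (surfaceMeasure Ω))
    (hle : ∀ κ : ℝ, 0 < κ → ∃ C r₀ : ℝ, 0 < r₀ ∧ ∀ x ∈ frontier Ω, ∀ y ∈ Ω, dist y x < r₀ →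
      ‖f' y - fb' x‖ ≤ C * ‖f y - fb x‖ + κ * (1 + ‖fb x‖)) : HasTrace Ω f' fb' := by
  have := hΩ.isFiniteMeasure
  rw [hΩ.hasTrace_iff hf']
  obtain ⟨hfb, ht⟩ := (hΩ.hasTrace_iff hf).1 h
  refine ⟨hfb', ENNReal.tendsto_nhds_zero.2 fun ε hε => ?_⟩
  wlog hε' : ε ≠ ⊤ generalizing ε
  · exact Eventually.of_forall fun r => by rw [not_not.1 hε']; exact le_top
  set S := ∫ x, (1 + ‖fb x‖) ∂(surfaceMeasure Ω)
  have hS : 0 ≤ S := integral_nonneg fun x => by positivity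
  have hi : Integrable (fun x => 1 + ‖fb x‖) (surfaceMeasure Ω) := (integrable_const _).add hfb.norm
  have hη : 0 < ε.toReal := ENNReal.toReal_pos hε.ne' hε'
  -- This gives κ S ≤ ε/2, including when S = 0.
  set κ := ε.toReal / 2 / (S + 1)
  have hκ : 0 < κ := by positivity
  obtain ⟨C, r₀, hr₀, hC⟩ := hle κ hκ
  have h1 : ∀ᶠ r in 𝓝[>] (0 : ℝ),
      ENNReal.ofReal C * ∫⁻ z, ‖f z.2 - fb z.1‖ₑ ∂(traceMeasure Ω r) ≤ ε / 2 := by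
    have := ENNReal.Tendsto.const_mul ht (Or.inr ENNReal.ofReal_ne_top) (a := ENNReal.ofReal C)
    rw [mul_zero] at this
    exact ENNReal.tendsto_nhds_zero.1 this _ (ENNReal.half_pos hε.ne')
  have h2 : ∀ᶠ r in 𝓝[>] (0 : ℝ), r < r₀ := nhdsWithin_le_nhds (gt_mem_nhds hr₀)
  filter_upwards [h1, h2, self_mem_nhdsWithin] with r hr1 hr2 hr
  have hm1 := hΩ.aemeasurable_enorm_sub hf hfb.aestronglyMeasurable
  calc ∫⁻ z, ‖f' z.2 - fb' z.1‖ₑ ∂(traceMeasure Ω r)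
      ≤ ∫⁻ z, (ENNReal.ofReal C * ‖f z.2 - fb z.1‖ₑ + ENNReal.ofReal (κ * (1 + ‖fb z.1‖)))
          ∂(traceMeasure Ω r) := by
        refine lintegral_mono_ae ?_
        filter_upwards [traceMeasure_ae hΩ.isOpen r] with z hz
        have := hC z.1 hz.1 z.2 hz.2.1 (hz.2.2.trans hr2)
        rw [← ofReal_norm, ← ofReal_norm, ← ENNReal.ofReal_mul' (norm_nonneg _)]
        exact (ENNReal.ofReal_le_ofReal this).trans ENNReal.ofReal_add_le
    _ = ENNReal.ofReal C * (∫⁻ z, ‖f z.2 - fb z.1‖ₑ ∂(traceMeasure Ω r))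
        + ∫⁻ z, ENNReal.ofReal (κ * (1 + ‖fb z.1‖)) ∂(traceMeasure Ω r) := by
        have hm2 := hm1.mono_ac (traceMeasure_absolutelyContinuous Ω r)
        rw [lintegral_add_left' (hm2.const_mul _), lintegral_const_mul'' _ hm2]
    _ ≤ ε / 2 + ε / 2 := by
        refine add_le_add hr1 ((lintegral_fst_traceMeasure_le hΩ.isOpen hr
          (φ := fun x => ENNReal.ofReal (κ * (1 + ‖fb x‖)))
          (hi.const_mul κ).aestronglyMeasurable.aemeasurable.ennreal_ofReal).trans ?_)
        rw [← ofReal_integral_eq_lintegral_ofReal (hi.const_mul κ)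
          (Eventually.of_forall fun x => by positivity), integral_const_mul]
        rw [← ENNReal.ofReal_toReal (ENNReal.div_ne_top hε' two_ne_zero)]
        refine ENNReal.ofReal_le_ofReal ?_
        rw [ENNReal.toReal_div, ENNReal.toReal_ofNat]
        change ε.toReal / 2 / (S + 1) * S ≤ _
        rw [div_mul_eq_mul_div, div_le_iff₀ (by positivity)]
        nlinarith
    _ = ε := ENNReal.add_halves ε

theorem HasTrace.prodMk (h : HasTrace Ω f fb) (h' : HasTrace Ω f' fb')
    (hΩ : IsBoundedSmoothDomain Ω) (hf : AEStronglyMeasurable f (volume.restrict Ω))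
    (hf' : AEStronglyMeasurable f' (volume.restrict Ω)) :
    HasTrace Ω (fun x => (f x, f' x)) (fun x => (fb x, fb' x)) := by
  have := hΩ.isFiniteMeasure
  rw [hΩ.hasTrace_iff (hf.prodMk hf')]
  obtain ⟨hfb, ht⟩ := (hΩ.hasTrace_iff hf).1 h
  obtain ⟨hfb', ht'⟩ := (hΩ.hasTrace_iff hf').1 h'
  refine ⟨hfb.prodMk hfb', ?_⟩
  have hadd := ht.add ht'
  rw [add_zero] at hadd
  refine tendsto_of_tendsto_of_tendsto_of_le_of_le tendsto_const_nhds hadd (fun _ => zero_le)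
    fun r => ?_
  have hm2 := (hΩ.aemeasurable_enorm_sub hf hfb.aestronglyMeasurable).mono_ac
    (traceMeasure_absolutelyContinuous Ω r)
  simp only
  rw [← lintegral_add_left' hm2]
  refine lintegral_mono fun z => ?_
  rw [Prod.mk_sub_mk, ← ofReal_norm, ← ofReal_norm, ← ofReal_norm, Prod.norm_def,
    ENNReal.ofReal_max]
  exact max_le le_self_add le_add_self

variable [NormedSpace ℝ F] [NormedSpace ℝ F']

/-- B(y) f(y) - B(x) fb(x) is split as B(y)(f(y) - fb(x)) + (B(y) - B(x)) fb(x); boundedness and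
uniform continuity of B on the compact closure control the two parts. -/
theorem HasTrace.clm_apply (h : HasTrace Ω f fb) (hΩ : IsBoundedSmoothDomain Ω)
    (hf : AEStronglyMeasurable f (volume.restrict Ω)) {B : Space N → F →L[ℝ] F'}
    (hB : ContinuousOn B (closure Ω)) :
    HasTrace Ω (fun x => B x (f x)) (fun x => B x (fb x)) := by
  have hK := hΩ.isBounded.isCompact_closure
  obtain ⟨M, hM⟩ := hK.exists_bound_of_continuousOn hB
  have hBm : AEStronglyMeasurable B (volume.restrict Ω) :=
    (hB.mono subset_closure).aestronglyMeasurable hΩ.isOpen.measurableSet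
  have hBs : AEStronglyMeasurable B (surfaceMeasure Ω) :=
    aestronglyMeasurable_surfaceMeasure (hB.mono frontier_subset_closure)
  refine h.of_norm_sub_le hΩ hf (isBoundedBilinearMap_apply.continuous.comp_aestronglyMeasurable (hBm.prodMk hf)) ?_ fun κ hκ => ?_
  · refine Integrable.mono' (h.1.norm.const_mul M) (isBoundedBilinearMap_apply.continuous.comp_aestronglyMeasurable
      (hBs.prodMk h.1.aestronglyMeasurable)) ?_
    filter_upwards [surfaceMeasure_ae_mem] with x hx
    exact ((B x).le_opNorm _).trans (mul_le_mul_of_nonneg_right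
      (hM x (frontier_subset_closure hx)) (norm_nonneg _))
  · have hu := hK.uniformContinuousOn_of_continuous hB
    obtain ⟨r₀, hr₀, hr⟩ := Metric.uniformContinuousOn_iff.1 hu κ hκ
    refine ⟨M, r₀, hr₀, fun x hx y hy hxy => ?_⟩
    have h1 := hr y (subset_closure hy) x (frontier_subset_closure hx) hxy
    rw [dist_eq_norm] at h1
    have e : B y (f y) - B x (fb x) = B y (f y - fb x) + (B y - B x) (fb x) := by
      rw [map_sub, sub_apply]; abel
    rw [e]
    refine (norm_add_le _ _).trans (add_le_add (((B y).le_opNorm _).trans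
      (mul_le_mul_of_nonneg_right (hM y (subset_closure hy)) (norm_nonneg _))) ?_)
    refine ((B y - B x).le_opNorm _).trans (mul_le_mul h1.le ?_ (norm_nonneg _) hκ.le)
    linarith

end Trace

theorem IsBoundedSmoothDomain.aestronglyMeasurable_comp {μ : Measure (Space N)}
    {h : Space N → ℝ → ℝ}
    (hh : ContinuousOn (Function.uncurry h) (closure Ω ×ˢ univ)) {m : Space N → ℝ}
    (hm : AEStronglyMeasurable m μ) (hμ : ∀ᵐ x ∂μ, x ∈ closure Ω) :
    AEStronglyMeasurable (fun x => h x (m x)) μ := by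
  have hc : MeasurableSet (closure Ω ×ˢ (univ : Set ℝ)) :=
    isClosed_closure.measurableSet.prod MeasurableSet.univ
  have h1 : Measurable ((closure Ω ×ˢ (univ : Set ℝ)).indicator (Function.uncurry h)) := by
    classical
    rw [← piecewise_eq_indicator]
    exact hh.measurable_piecewise continuousOn_const hc
  have h2 := (h1.comp_aemeasurable (aemeasurable_id.prodMk hm.aemeasurable)).aestronglyMeasurable
  refine h2.congr ?_
  filter_upwards [hμ] with x hx
  simp only [Function.comp, id]
  rw [indicator_of_mem (show (x, m x) ∈ closure Ω ×ˢ (univ : Set ℝ) from ⟨hx, mem_univ _⟩)]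
  rfl

/-- Uniform continuity of h is available only for s in a compact interval. If m(y) and mb(x) are at
distance at least d, or if |mb(x)| ≥ R, the crude bound 2|M| is absorbed by the first or the second
term of `HasTrace.of_norm_sub_le`; otherwise both values lie in [-R - 1, R + 1]. -/
theorem HasTrace.comp_bounded {m mb : Space N → ℝ} (hm : HasTrace Ω m mb)
    (hΩ : IsBoundedSmoothDomain Ω) (hmm : AEStronglyMeasurable m (volume.restrict Ω))
    {h : Space N → ℝ → ℝ} (hh : ContinuousOn (Function.uncurry h) (closure Ω ×ˢ univ))
    {M : ℝ} (hM : ∀ x ∈ closure Ω, ∀ s, |h x s| ≤ M) :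
    HasTrace Ω (fun x => h x (m x)) (fun x => h x (mb x)) := by
  have := hΩ.isFiniteMeasure
  have hK := hΩ.isBounded.isCompact_closure
  have hσ : ∀ᵐ x ∂(surfaceMeasure Ω), x ∈ closure Ω := by
    filter_upwards [surfaceMeasure_ae_mem] with x hx using frontier_subset_closure hx
  have hv : ∀ᵐ x ∂(volume.restrict Ω), x ∈ closure Ω := by
    filter_upwards [ae_restrict_mem hΩ.isOpen.measurableSet] with x hx using subset_closure hx
  refine hm.of_norm_sub_le hΩ hmm (IsBoundedSmoothDomain.aestronglyMeasurable_comp hh hmm hv)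
    (Integrable.of_bound (IsBoundedSmoothDomain.aestronglyMeasurable_comp hh
      hm.1.aestronglyMeasurable hσ) M (hσ.mono fun x hx => hM x hx _)) fun κ hκ => ?_
  set R := 2 * |M| / κ
  have hR0 : 0 ≤ R := by positivity
  have hK2 : IsCompact (closure Ω ×ˢ Icc (-R - 1) (R + 1)) := hK.prod isCompact_Icc
  have hu := hK2.uniformContinuousOn_of_continuous
    (hh.mono (prod_mono subset_rfl (subset_univ _)))
  obtain ⟨δ, hδ, hr⟩ := Metric.uniformContinuousOn_iff.1 hu κ hκ
  set d := min δ 1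
  have hd : 0 < d := lt_min hδ one_pos
  refine ⟨2 * |M| / d, d, hd, fun x hx y hy hxy => ?_⟩
  have hxc := frontier_subset_closure hx
  have hyc := subset_closure hy
  simp only [Real.norm_eq_abs]
  have b1 : |h y (m y) - h x (mb x)| ≤ 2 * |M| :=
    (abs_sub _ _).trans (by
      linarith [hM x hxc (mb x), hM y hyc (m y), le_abs_self M])
  by_cases c1 : d ≤ |m y - mb x|
  · have : 2 * |M| ≤ 2 * |M| / d * |m y - mb x| := by
      rw [div_mul_eq_mul_div, le_div_iff₀ hd]
      exact mul_le_mul_of_nonneg_left c1 (by positivity)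
    have : 0 ≤ κ * (1 + |mb x|) := by positivity
    linarith
  by_cases c2 : R ≤ |mb x|
  · have h3 : 2 * |M| ≤ κ * |mb x| := by
      rw [div_le_iff₀ hκ] at c2
      linarith
    have : 0 ≤ 2 * |M| / d * |m y - mb x| := by positivity
    nlinarith
  · push Not at c1 c2
    have c1' := abs_lt.1 (c1.trans_le (min_le_right _ _))
    have c2' := abs_lt.1 c2
    have := hr (y, m y) ⟨hyc, mem_Icc.2 (by constructor <;> linarith)⟩ (x, mb x)
      ⟨hxc, mem_Icc.2 (by constructor <;> linarith)⟩ (by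
        rw [Prod.dist_eq]
        exact max_lt (hxy.trans_le (min_le_left _ _)) (c1.trans_le (min_le_left _ _)))
    rw [Real.dist_eq] at this
    simp only [Function.uncurry] at this
    have h4 : 0 ≤ 2 * |M| / d * |m y - mb x| := by positivity
    have h5 : 0 ≤ κ * |mb x| := by positivity
    linarith

/-! ### The divergence theorem for fields with a trace -/

/-- A bump function centred at `-2re`, of radius `r`. -/
def shiftBump (e : Space N) (r : ℝ) (hr : 0 < r) : ContDiffBump (-(2 * r) • e) :=
  ⟨r / 2, r, by positivity, by linarith⟩

/-- A nonnegative smooth function of integral one, supported in the ball of radius `r` centred at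
`-2re`. -/
def shiftKernel (e : Space N) (r : ℝ) (z : Space N) : ℝ :=
  if hr : 0 < r then (shiftBump e r hr).normed volume z else 0

section ShiftKernel

variable {e : Space N} {r : ℝ}

theorem shiftKernel_eq (e : Space N) (hr : 0 < r) :
    shiftKernel e r = (shiftBump e r hr).normed volume := by
  ext z; exact dif_pos hr

theorem shiftKernel_nonneg (z : Space N) : 0 ≤ shiftKernel e r z := by
  rw [shiftKernel]
  split_ifs with hr
  exacts [ContDiffBump.nonneg_normed _ _, le_rfl]

theorem contDiff_shiftKernel (hr : 0 < r) : ContDiff ℝ ∞ (shiftKernel e r) := by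
  rw [shiftKernel_eq e hr]; exact ContDiffBump.contDiff_normed _

theorem hasCompactSupport_shiftKernel (hr : 0 < r) : HasCompactSupport (shiftKernel e r) := by
  rw [shiftKernel_eq e hr]; exact ContDiffBump.hasCompactSupport_normed _

theorem tsupport_shiftKernel (hr : 0 < r) :
    tsupport (shiftKernel e r) = Metric.closedBall (-(2 * r) • e) r := by
  rw [shiftKernel_eq e hr]; exact ContDiffBump.tsupport_normed_eq _

theorem integral_shiftKernel (hr : 0 < r) : ∫ z, shiftKernel e r z = 1 := by
  rw [shiftKernel_eq e hr]; exact ContDiffBump.integral_normed _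

theorem norm_le_of_mem_tsupport (he : ‖e‖ = 1) (hr : 0 < r) {z : Space N}
    (hz : z ∈ tsupport (shiftKernel e r)) : ‖z‖ ≤ 3 * r := by
  rw [tsupport_shiftKernel hr, mem_closedBall_iff_norm] at hz
  have h1 : ‖-(2 * r) • e‖ = 2 * r := by
    rw [norm_smul, he, mul_one, norm_neg, Real.norm_of_nonneg (by positivity)]
  have h2 : z = (z - -(2 * r) • e) + -(2 * r) • e := by abel
  rw [h2]
  exact (norm_add_le _ _).trans (by linarith)

/-- On the support ⟨e, z⟩ ≤ -r while ‖z‖ ≤ 3r. This is the inward cone condition of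
`IsChart.add_mem` for ε = 1/4. -/
theorem inner_lt_of_mem_tsupport (he : ‖e‖ = 1) (hr : 0 < r) {z : Space N}
    (hz : z ∈ tsupport (shiftKernel e r)) : ⟪e, z⟫_ℝ < -(1 / 4 * ‖z‖) := by
  have h0 := norm_le_of_mem_tsupport he hr hz
  rw [tsupport_shiftKernel hr, mem_closedBall_iff_norm] at hz
  have h2 : ⟪e, z⟫_ℝ = ⟪e, z - -(2 * r) • e⟫_ℝ - 2 * r := by
    rw [inner_sub_right, inner_smul_right, real_inner_self_eq_norm_sq, he]; ring
  have h3 : ⟪e, z - -(2 * r) • e⟫_ℝ ≤ r := by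
    refine (real_inner_le_norm _ _).trans ?_
    rw [he, one_mul]; exact hz
  linarith

theorem shiftKernel_eq_zero (he : ‖e‖ = 1) (hr : 0 < r) {z : Space N} (hz : 3 * r < ‖z‖) :
    shiftKernel e r z = 0 :=
  image_eq_zero_of_notMem_tsupport fun h => absurd (norm_le_of_mem_tsupport he hr h) (not_le.2 hz)

/-- The normalised bump, with radii r/2 and r, is at most 2^N / |B_r| = 8^N / |B_{4r}|, and |Ω ∩
B_{4r}| ≤ |B_{4r}|. The radius 4r exceeds the range 3r of the kernel. -/
theorem ofReal_shiftKernel_le (Ω : Set (Space N)) (he : ‖e‖ = 1) (hr : 0 < r)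
    (z : Space N × Space N) : ENNReal.ofReal (shiftKernel e r (z.2 - z.1))
      ≤ ENNReal.ofReal (8 ^ N) * traceKernel Ω (4 * r) z := by
  by_cases hz : dist z.2 z.1 < 4 * r
  · rw [traceKernel, indicator_of_mem (show z ∈ _ from hz)]
    have hV : 0 < volume.real (Metric.ball (0 : Space N) 1) :=
      ENNReal.toReal_pos (Metric.measure_ball_pos _ _ one_pos).ne' measure_ball_lt_top.ne
    set V := volume.real (Metric.ball (0 : Space N) 1) with hVdef
    have h1 : shiftKernel e r (z.2 - z.1) ≤ 8 ^ N * ((4 * r) ^ N * V)⁻¹ := by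
      rw [shiftKernel_eq e hr]
      refine ((shiftBump e r hr).normed_le_div_measure_closedBall_rOut volume 2
        (show r ≤ 2 * (r / 2) by linarith) _).trans (le_of_eq ?_)
      rw [show (shiftBump e r hr).rOut = r from rfl,
        Measure.addHaar_real_closedBall _ _ hr.le, finrank_euclideanSpace_fin, ← hVdef,
        show (8 : ℝ) = 4 * 2 by norm_num, mul_pow, mul_pow]
      field_simp
    refine (ENNReal.ofReal_le_ofReal h1).trans ?_
    rw [ENNReal.ofReal_mul (by positivity)]
    gcongr
    rw [ENNReal.ofReal_inv_of_pos (by positivity)]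
    refine ENNReal.inv_le_inv.2 ((measure_mono inter_subset_right).trans
      ((measure_mono Metric.ball_subset_closedBall).trans (le_of_eq ?_)))
    have h2 := Measure.addHaar_real_closedBall (volume : Measure (Space N)) z.1
      (show 0 ≤ 4 * r by positivity)
    rw [finrank_euclideanSpace_fin] at h2
    rw [← h2, Measure.real, ENNReal.ofReal_toReal measure_closedBall_lt_top.ne]
  · rw [shiftKernel_eq_zero he hr, ENNReal.ofReal_zero]
    · exact zero_le
    · rw [← dist_eq_norm]; linarith

end ShiftKernel

/-- The only place where the averaged form of the trace meets the kernel: replacing Y(y) by its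
boundary value costs a constant times the quantity that tends to zero. -/
theorem enorm_integral_shiftKernel_sub_le (hΩ : IsBoundedSmoothDomain Ω) {e : Space N}
    (he : ‖e‖ = 1) {r : ℝ} (hr : 0 < r) {Y Yb : Space N → Space N}
    (hY : IntegrableOn Y Ω) (hYb : Integrable Yb (surfaceMeasure Ω)) :
    ‖∫ z, shiftKernel e r (z.2 - z.1) * ⟪outerNormal Ω z.1, Y z.2 - Yb z.1⟫_ℝ
        ∂((surfaceMeasure Ω).prod (volume.restrict Ω))‖ₑ
      ≤ ENNReal.ofReal (8 ^ N) * ∫⁻ z, ‖Y z.2 - Yb z.1‖ₑ ∂(traceMeasure Ω (4 * r)) := by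
  have hm := hΩ.aemeasurable_enorm_sub hY.aestronglyMeasurable hYb.aestronglyMeasurable
  have hK := measurable_traceKernel hΩ.isOpen (4 * r)
  rw [traceMeasure, lintegral_withDensity_eq_lintegral_mul₀ hK.aemeasurable hm,
    ← lintegral_const_mul'' _ (hK.aemeasurable.mul hm)]
  refine (enorm_integral_le_lintegral_enorm _).trans (lintegral_mono_ae ?_)
  have h1 : ∀ᵐ z ∂((surfaceMeasure Ω).prod (volume.restrict Ω)), z.1 ∈ frontier Ω :=
    Measure.quasiMeasurePreserving_fst.ae surfaceMeasure_ae_mem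
  filter_upwards [h1] with z hz
  rw [Pi.mul_apply, ← mul_assoc, enorm_mul]
  refine mul_le_mul' ?_ ?_
  · rw [← ofReal_norm, Real.norm_of_nonneg (shiftKernel_nonneg _)]
    exact ofReal_shiftKernel_le Ω he hr z
  · rw [← ofReal_norm, ← ofReal_norm]
    refine ENNReal.ofReal_le_ofReal ((norm_inner_le_norm _ _).trans ?_)
    rw [hΩ.norm_outerNormal hz, one_mul]

section Boundary

variable {p e : Space N} {R r : ℝ} {ρ : Space N → ℝ} {Y Yb : Space N → Space N} {f : Space N → ℝ}

theorem fderiv_comp_const_sub' {ζ : Space N → ℝ} (hζ : ContDiff ℝ ∞ ζ) (x y v : Space N) :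
    fderiv ℝ (fun x => ζ (y - x)) x v = -fderiv ℝ ζ (y - x) v := by
  have h1 : HasFDerivAt ζ (fderiv ℝ ζ (y - x)) (y - x) :=
    (hζ.differentiable (by simp) _).hasFDerivAt
  have h2 := (h1.comp x ((hasFDerivAt_id x).const_sub y)).fderiv
  refine (congrArg (fun L : Space N →L[ℝ] ℝ => L v) h2).trans ?_
  simp

theorem isTestFunction_comp_const_sub {ζ : Space N → ℝ} (hζ : ContDiff ℝ ∞ ζ)
    (hc : HasCompactSupport ζ) (y : Space N) : IsTestFunction univ (fun x => ζ (y - x)) :=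
  ⟨hζ.comp (contDiff_const.sub contDiff_id), hc.comp_homeomorph (Homeomorph.subLeft y),
    subset_univ _⟩

theorem isTestFunction_comp_sub_const {ζ : Space N → ℝ} (hζ : ContDiff ℝ ∞ ζ)
    (hc : HasCompactSupport ζ) (x : Space N) {U : Set (Space N)}
    (hU : ∀ z ∈ tsupport ζ, x + z ∈ U) : IsTestFunction U (fun y => ζ (y - x)) := by
  refine ⟨hζ.comp (contDiff_id.sub contDiff_const), hc.comp_homeomorph (Homeomorph.subRight x),
    fun y hy => ?_⟩
  have hcl : IsClosed {y | y - x ∈ tsupport ζ} :=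
    (isClosed_tsupport ζ).preimage (continuous_id.sub continuous_const)
  have : tsupport (fun y => ζ (y - x)) ⊆ {y | y - x ∈ tsupport ζ} :=
    closure_minimal (fun y hy => subset_tsupport _ hy) hcl
  have := hU _ (this hy)
  rwa [add_sub_cancel] at this

/-- The weak divergence tested with `y ↦ ζ_r (y - x)`. -/
theorem IsChart.integral_fderiv_shiftKernel (h : IsChart Ω p e (1 / 4) R ρ) (hΩ : IsOpen Ω)
    (hY : HasWeakDiv Ω Y f) (hY0 : ∀ y ∉ Metric.ball p (R / 4), Y y = 0)
    (hf0 : ∀ y ∉ Metric.ball p (R / 4), f y = 0) (hr : 0 < r) (hrR : 16 * r < R) {x : Space N}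
    (hx : x ∈ Ω) :
    ∫ y in Ω, fderiv ℝ (shiftKernel e r) (y - x) (Y y)
      = -∫ y in Ω, shiftKernel e r (y - x) * f y := by
  have hζ := contDiff_shiftKernel (e := e) hr
  have hc := hasCompactSupport_shiftKernel (e := e) hr
  by_cases hxB : x ∈ Metric.ball p (R / 2)
  · have ht : IsTestFunction Ω (fun y => shiftKernel e r (y - x)) := by
      refine isTestFunction_comp_sub_const hζ hc x fun z hz => ?_
      refine h.add_mem hΩ (subset_closure hx) (Metric.ball_subset_ball (by linarith [h.pos]) hxB)
        ?_ (inner_lt_of_mem_tsupport h.norm_eq_one hr hz)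
      have h3 := norm_le_of_mem_tsupport h.norm_eq_one hr hz
      rw [mem_ball_iff_norm] at hxB ⊢
      rw [show x + z - p = (x - p) + z by abel]
      exact (norm_add_le _ _).trans_lt (by linarith)
    have := hY.integral_eq _ ht
    simpa only [fderiv_comp_sub] using this
  -- When x is at distance at least R/2 from p, the kernel, of range 3r < 3R/16, does not reach the
  -- ball carrying Y and f.
  · have hz : ∀ y, y ∈ Metric.ball p (R / 4) → y - x ∉ tsupport (shiftKernel e r) := by
      intro y hy hm
      have h3 := norm_le_of_mem_tsupport h.norm_eq_one hr hm
      rw [mem_ball_iff_norm] at hxB hy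
      refine hxB ?_
      rw [show x - p = (y - p) - (y - x) by abel]
      exact (norm_sub_le _ _).trans_lt (by linarith)
    have e1 : ∀ y, fderiv ℝ (shiftKernel e r) (y - x) (Y y) = 0 := by
      intro y
      by_cases hy : y ∈ Metric.ball p (R / 4)
      · rw [image_eq_zero_of_notMem_tsupport fun hm => hz y hy (tsupport_fderiv_subset ℝ hm)]
        rfl
      · rw [hY0 y hy, map_zero]
    have e2 : ∀ y, shiftKernel e r (y - x) * f y = 0 := by
      intro y
      by_cases hy : y ∈ Metric.ball p (R / 4)
      · rw [image_eq_zero_of_notMem_tsupport (hz y hy), zero_mul]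
      · rw [hf0 y hy, mul_zero]
    simp only [e1, e2, integral_zero, neg_zero]

theorem IsBoundedSmoothDomain.isFiniteMeasure_restrict (hΩ : IsBoundedSmoothDomain Ω) :
    IsFiniteMeasure ((volume : Measure (Space N)).restrict Ω) :=
  ⟨by rw [Measure.restrict_apply_univ]; exact hΩ.isBounded.measure_lt_top⟩

theorem integrable_kernel_mul {μ ν : Measure (Space N)} [IsFiniteMeasure μ] [SFinite ν]
    {ζ : Space N → ℝ} (hζ : Continuous ζ) (hc : HasCompactSupport ζ) (hf : Integrable f ν) :
    Integrable (fun z : Space N × Space N => ζ (z.2 - z.1) * f z.2) (μ.prod ν) := by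
  obtain ⟨C, hC⟩ := hζ.bounded_above_of_compact_support hc
  exact (hf.comp_snd μ).bdd_mul (c := C)
    (hζ.comp (continuous_snd.sub continuous_fst)).aestronglyMeasurable
    (Eventually.of_forall fun z => hC _)

/-- The weak divergence against the boundary kernel. -/
theorem IsChart.integral_normal_shiftKernel (h : IsChart Ω p e (1 / 4) R ρ)
    (hΩ : IsBoundedSmoothDomain Ω)
    (hY : HasWeakDiv Ω Y f) (hY0 : ∀ y ∉ Metric.ball p (R / 4), Y y = 0)
    (hf0 : ∀ y ∉ Metric.ball p (R / 4), f y = 0) (hr : 0 < r) (hrR : 16 * r < R) :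
    ∫ y in Ω, ∫ x, shiftKernel e r (y - x) * ⟪outerNormal Ω x, Y y⟫_ℝ ∂(surfaceMeasure Ω)
      = ∫ y in Ω, (∫ x in Ω, shiftKernel e r (y - x) * f y) := by
  have hζ := contDiff_shiftKernel (e := e) hr
  have hc := hasCompactSupport_shiftKernel (e := e) hr
  have := hΩ.isFiniteMeasure_restrict
  obtain ⟨C, hC⟩ := norm_fderiv_bounded (hζ.of_le (by exact_mod_cast le_top)) hc
  have hi1 : Integrable (Function.uncurry fun x y => fderiv ℝ (shiftKernel e r) (y - x) (Y y))
      ((volume.restrict Ω).prod (volume.restrict Ω)) := by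
    have hYs : Integrable (fun z : Space N × Space N => Y z.2)
        ((volume.restrict Ω).prod (volume.restrict Ω)) := hY.integrableOn.comp_snd _
    have hcd : Continuous fun z : Space N × Space N => fderiv ℝ (shiftKernel e r) (z.2 - z.1) :=
      (hζ.continuous_fderiv (by simp)).comp (continuous_snd.sub continuous_fst)
    refine Integrable.mono' (hYs.norm.const_mul C)
      (isBoundedBilinearMap_apply.continuous.comp_aestronglyMeasurable
        (hcd.aestronglyMeasurable.prodMk hYs.aestronglyMeasurable))
      (Eventually.of_forall fun z => ?_)
    exact (ContinuousLinearMap.le_opNorm _ _).trans (by gcongr; exact hC _)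
  have hi2 : Integrable (Function.uncurry fun x y => shiftKernel e r (y - x) * f y)
      ((volume.restrict Ω).prod (volume.restrict Ω)) :=
    integrable_kernel_mul hζ.continuous hc hY.integrableOn_div
  have e1 : ∫ x in Ω, ∫ y in Ω, fderiv ℝ (shiftKernel e r) (y - x) (Y y)
      = -∫ x in Ω, ∫ y in Ω, shiftKernel e r (y - x) * f y := by
    rw [← integral_neg]
    exact setIntegral_congr_fun hΩ.isOpen.measurableSet fun x hx =>
      h.integral_fderiv_shiftKernel hΩ.isOpen hY hY0 hf0 hr hrR hx
  -- With y fixed, the x integral is that of a derivative in the constant direction Y(y) of a smooth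
  -- nonnegative function, so Gauss-Green applies to it.
  rw [integral_integral_swap hi1, integral_integral_swap hi2] at e1
  rw [← neg_inj, ← e1, ← integral_neg]
  congr 1; ext y
  have := hΩ.gaussGreen (isTestFunction_comp_const_sub hζ hc y)
    (fun x => shiftKernel_nonneg (y - x)) (Y y)
  rw [← this, ← integral_neg]
  congr 1; ext x
  rw [fderiv_comp_const_sub' hζ, neg_neg]

theorem setIntegral_shiftKernel_eq_one (he : ‖e‖ = 1) (hr : 0 < r) {y : Space N}
    (hy : Metric.ball y (4 * r) ⊆ Ω) : ∫ x in Ω, shiftKernel e r (y - x) = 1 := by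
  rw [setIntegral_eq_integral_of_forall_compl_eq_zero, integral_sub_left_eq_self,
    integral_shiftKernel hr]
  intro x hx
  refine shiftKernel_eq_zero he hr ?_
  by_contra hcon
  refine hx (hy ?_)
  rw [mem_ball_iff_norm, norm_sub_rev]
  linarith

/-- For fixed y ∈ Ω the kernel integrates to exactly 1 over x ∈ Ω as soon as B(y, 4r) lies in Ω; the
integrand is dominated by |f|. -/
theorem tendsto_integral_shiftKernel (he : ‖e‖ = 1) (hΩ : IsBoundedSmoothDomain Ω)
    (hf : IntegrableOn f Ω) :
    Tendsto (fun r => ∫ y in Ω, (∫ x in Ω, shiftKernel e r (y - x) * f y)) (𝓝[>] 0)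
      (𝓝 (∫ y in Ω, f y)) := by
  have := hΩ.isFiniteMeasure_restrict
  refine tendsto_integral_filter_of_dominated_convergence (fun y => ‖f y‖) ?_ ?_ hf.norm ?_
  · filter_upwards [self_mem_nhdsWithin] with r hr
    exact (integrable_kernel_mul (contDiff_shiftKernel hr).continuous
      (hasCompactSupport_shiftKernel hr) hf).integral_prod_right.aestronglyMeasurable
  · filter_upwards [self_mem_nhdsWithin] with r hr
    refine Eventually.of_forall fun y => ?_
    rw [integral_mul_const, norm_mul]
    refine mul_le_of_le_one_left (norm_nonneg _) ?_
    rw [Real.norm_of_nonneg (integral_nonneg fun x => shiftKernel_nonneg _)]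
    have ht := isTestFunction_comp_const_sub (contDiff_shiftKernel (e := e) hr)
      (hasCompactSupport_shiftKernel (e := e) hr) y
    refine (setIntegral_le_integral
      (ht.smooth.continuous.integrable_of_hasCompactSupport ht.hasCompactSupport)
      (Eventually.of_forall fun x => shiftKernel_nonneg _)).trans (le_of_eq ?_)
    rw [integral_sub_left_eq_self, integral_shiftKernel hr]
  · filter_upwards [ae_restrict_mem hΩ.isOpen.measurableSet] with y hy
    obtain ⟨δ, hδ, hB⟩ := Metric.isOpen_iff.1 hΩ.isOpen y hy
    refine tendsto_const_nhds.congr' ?_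
    have h2 : ∀ᶠ r in 𝓝[>] (0 : ℝ), r < δ / 4 := nhdsWithin_le_nhds (gt_mem_nhds (by linarith))
    filter_upwards [self_mem_nhdsWithin, h2] with r hr hr2
    rw [integral_mul_const, setIntegral_shiftKernel_eq_one he hr
      ((Metric.ball_subset_ball (by linarith)).trans hB), one_mul]

theorem IsChart.integral_eq_integral_normal (h : IsChart Ω p e (1 / 4) R ρ)
    (hΩ : IsBoundedSmoothDomain Ω) (hY : HasWeakDiv Ω Y f) (ht : HasTrace Ω Y Yb)
    (hY0 : ∀ y ∉ Metric.ball p (R / 4), Y y = 0) (hf0 : ∀ y ∉ Metric.ball p (R / 4), f y = 0)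
    (hYb0 : ∀ y ∉ Metric.ball p (R / 4), Yb y = 0) :
    ∫ y in Ω, f y = ∫ x, ⟪outerNormal Ω x, Yb x⟫_ℝ ∂(surfaceMeasure Ω) := by
  have := hΩ.isFiniteMeasure_restrict
  have := hΩ.isFiniteMeasure
  have hR := h.pos
  obtain ⟨hYb, htr⟩ := (hΩ.hasTrace_iff hY.integrableOn.aestronglyMeasurable).1 ht
  have hsmall : ∀ᶠ r in 𝓝[>] (0 : ℝ), r < R / 16 :=
    nhdsWithin_le_nhds (gt_mem_nhds (by linarith))
  refine tendsto_nhds_unique (tendsto_integral_shiftKernel h.norm_eq_one hΩ hY.integrableOn_div) ?_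
  rw [tendsto_iff_edist_tendsto_0]
  have h4 : Tendsto (fun r : ℝ => 4 * r) (𝓝[>] 0) (𝓝[>] 0) := by
    refine tendsto_nhdsWithin_iff.2 ⟨?_, ?_⟩
    · have : Tendsto (fun r : ℝ => 4 * r) (𝓝 0) (𝓝 (4 * 0)) := tendsto_id.const_mul 4
      rw [mul_zero] at this
      exact this.mono_left nhdsWithin_le_nhds
    · filter_upwards [self_mem_nhdsWithin] with r hr
      exact mul_pos four_pos (mem_Ioi.1 hr)
  have hlim := ENNReal.Tendsto.const_mul (htr.comp h4) (a := ENNReal.ofReal (8 ^ N))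
    (Or.inr ENNReal.ofReal_ne_top)
  rw [mul_zero] at hlim
  refine tendsto_of_tendsto_of_tendsto_of_le_of_le' tendsto_const_nhds hlim
    (Eventually.of_forall fun _ => zero_le) ?_
  filter_upwards [self_mem_nhdsWithin, hsmall] with r hr hrR
  have hζ := contDiff_shiftKernel (e := e) hr
  have hc := hasCompactSupport_shiftKernel (e := e) hr
  obtain ⟨C, hC⟩ := hζ.continuous.bounded_above_of_compact_support hc
  have hcc : Continuous fun z : Space N × Space N => shiftKernel e r (z.2 - z.1) :=
    hζ.continuous.comp (continuous_snd.sub continuous_fst)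
  have hν : ∀ᵐ z ∂((surfaceMeasure Ω).prod (volume.restrict Ω)), ‖outerNormal Ω z.1‖ ≤ 1 := by
    have h1 : ∀ᵐ z ∂((surfaceMeasure Ω).prod (volume.restrict Ω)), z.1 ∈ frontier Ω :=
      Measure.quasiMeasurePreserving_fst.ae surfaceMeasure_ae_mem
    filter_upwards [h1] with z hz using (hΩ.norm_outerNormal hz).le
  have hνm : AEStronglyMeasurable (fun z : Space N × Space N => outerNormal Ω z.1)
      ((surfaceMeasure Ω).prod (volume.restrict Ω)) :=
    hΩ.aestronglyMeasurable_outerNormal.comp_fst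
  have hgen : ∀ W : Space N × Space N → Space N,
      Integrable W ((surfaceMeasure Ω).prod (volume.restrict Ω)) →
      Integrable (fun z => shiftKernel e r (z.2 - z.1) * ⟪outerNormal Ω z.1, W z⟫_ℝ)
        ((surfaceMeasure Ω).prod (volume.restrict Ω)) := by
    intro W hW
    refine Integrable.bdd_mul (c := C) ?_ hcc.aestronglyMeasurable
      (Eventually.of_forall fun z => hC _)
    refine hW.norm.mono' (hνm.inner hW.aestronglyMeasurable) ?_
    filter_upwards [hν] with z hz
    refine (norm_inner_le_norm _ _).trans (mul_le_of_le_one_left (norm_nonneg _) hz)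
  have i1 := hgen (fun z => Y z.2) (hY.integrableOn.comp_snd _)
  have i2 := hgen (fun z => Yb z.1) (hYb.comp_fst _)
  have e1 : ∫ y in Ω, (∫ x in Ω, shiftKernel e r (y - x) * f y)
      = ∫ z, shiftKernel e r (z.2 - z.1) * ⟪outerNormal Ω z.1, Y z.2⟫_ℝ
          ∂((surfaceMeasure Ω).prod (volume.restrict Ω)) := by
    rw [integral_prod_symm _ i1]
    exact (h.integral_normal_shiftKernel hΩ hY hY0 hf0 hr (by linarith)).symm
  have e2 : ∫ x, ⟪outerNormal Ω x, Yb x⟫_ℝ ∂(surfaceMeasure Ω)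
      = ∫ z, shiftKernel e r (z.2 - z.1) * ⟪outerNormal Ω z.1, Yb z.1⟫_ℝ
          ∂((surfaceMeasure Ω).prod (volume.restrict Ω)) := by
    rw [integral_prod _ i2]
    refine integral_congr_ae ?_
    filter_upwards [surfaceMeasure_ae_mem] with x hx
    rw [integral_mul_const]
    by_cases hxB : x ∈ Metric.ball p (R / 4)
    -- For a boundary point near p the kernel lies entirely inside Ω, by the cone property, so the
    -- boundary term is exact for every small r.
    · have : ∫ y in Ω, shiftKernel e r (y - x) = 1 := by
        rw [setIntegral_eq_integral_of_forall_compl_eq_zero, integral_sub_right_eq_self,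
          integral_shiftKernel hr]
        intro y hy
        refine image_eq_zero_of_notMem_tsupport fun hm => hy ?_
        have h3 := norm_le_of_mem_tsupport h.norm_eq_one hr hm
        have := h.add_mem hΩ.isOpen (frontier_subset_closure hx)
          (Metric.ball_subset_ball (by linarith) hxB) (z := y - x) ?_
          (inner_lt_of_mem_tsupport h.norm_eq_one hr hm)
        · rwa [add_sub_cancel] at this
        · rw [mem_ball_iff_norm] at hxB ⊢
          rw [show x + (y - x) - p = (x - p) + (y - x) by abel]
          exact (norm_add_le _ _).trans_lt (by linarith)
      rw [this, one_mul]
    · rw [hYb0 x hxB, inner_zero_right, mul_zero]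
  rw [edist_eq_enorm_sub, e1, e2, ← integral_sub i1 i2]
  refine le_trans (le_of_eq ?_)
    (enorm_integral_shiftKernel_sub_le hΩ h.norm_eq_one hr hY.integrableOn hYb)
  congr 2; ext z
  rw [inner_sub_right, mul_sub]

end Boundary

/-- The divergence theorem for a field with an integrable weak divergence and a trace. -/
theorem HasWeakDiv.integral_eq_integral_normal {X Xb : Space N → Space N} {f : Space N → ℝ}
    (hX : HasWeakDiv Ω X f) (hΩ : IsBoundedSmoothDomain Ω) (ht : HasTrace Ω X Xb) :
    ∫ y in Ω, f y = ∫ x, ⟪outerNormal Ω x, Xb x⟫_ℝ ∂(surfaceMeasure Ω) := by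
  have hloc : ∀ p ∈ closure Ω, ∃ U ∈ 𝓝 p, ∀ χ : Space N → ℝ, IsTestFunction U χ →
      ∫ y in Ω, (χ y * f y + fderiv ℝ χ y (X y))
        = ∫ x, χ x * ⟪outerNormal Ω x, Xb x⟫_ℝ ∂(surfaceMeasure Ω) := by
    intro p hp
    by_cases hpΩ : p ∈ Ω
    · refine ⟨Ω, hΩ.isOpen.mem_nhds hpΩ, fun χ hχ => ?_⟩
      rw [integral_add (integrable_mul_of_hasCompactSupport hχ.smooth.continuous
        hχ.hasCompactSupport hX.integrableOn_div) (integrable_fderiv_apply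
        (hχ.smooth.of_le (by exact_mod_cast le_top)) hχ.hasCompactSupport hX.integrableOn),
        hX.integral_eq χ hχ, add_neg_cancel]
      symm
      refine integral_eq_zero_of_ae ?_
      filter_upwards [surfaceMeasure_ae_mem] with x hx
      rw [hΩ.isOpen.frontier_eq] at hx
      rw [image_eq_zero_of_notMem_tsupport fun hm => hx.2 (hχ.tsupport_subset hm)]
      simp
    · have hpf : p ∈ frontier Ω := by rw [hΩ.isOpen.frontier_eq]; exact ⟨hp, hpΩ⟩
      obtain ⟨e, R, ρ, h⟩ := hΩ.exists_chart hpf (ε := 1 / 4) (by norm_num)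
      refine ⟨Metric.ball p (R / 4), Metric.ball_mem_nhds p (by linarith [h.pos]), fun χ hχ => ?_⟩
      have hz : ∀ y ∉ Metric.ball p (R / 4), χ y = 0 := fun y hy =>
        image_eq_zero_of_notMem_tsupport fun hm => hy (hχ.tsupport_subset hm)
      have hz' : ∀ y ∉ Metric.ball p (R / 4), fderiv ℝ χ y = 0 := fun y hy =>
        image_eq_zero_of_notMem_tsupport fun hm =>
          hy (hχ.tsupport_subset (tsupport_fderiv_subset ℝ hm))
      have hY := hX.smul hΩ.isOpen
        (IsTestFunction.isC1Bounded (Ω := Ω) hχ.smooth hχ.hasCompactSupport)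
      have htY : HasTrace Ω (fun x => χ x • X x) (fun x => χ x • Xb x) := by
        have := ht.clm_apply hΩ hX.integrableOn.aestronglyMeasurable
          (B := fun x => χ x • ContinuousLinearMap.id ℝ (Space N))
          (hχ.smooth.continuous.smul continuous_const).continuousOn
        simpa using this
      rw [h.integral_eq_integral_normal hΩ hY htY (fun y hy => by rw [hz y hy, zero_smul])
        (fun y hy => by rw [hz y hy, hz' y hy]; simp) (fun y hy => by rw [hz y hy, zero_smul])]
      simp only [inner_smul_right]
  choose! U hU hUloc using hloc
  obtain ⟨t, χ, hmem, hχ, hsum⟩ := exists_finite_partition hΩ.isBounded.isCompact_closure U hU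
  have htest : ∀ i ∈ t, IsTestFunction (U i) (χ i) := fun i hi =>
    ⟨(hχ i hi).1, (hχ i hi).2.1, (hχ i hi).2.2.1⟩
  have hXb : Integrable (fun x => ⟪outerNormal Ω x, Xb x⟫_ℝ) (surfaceMeasure Ω) := by
    refine ht.1.norm.mono' (hΩ.aestronglyMeasurable_outerNormal.inner ht.1.aestronglyMeasurable) ?_
    filter_upwards [surfaceMeasure_ae_mem] with x hx
    refine (norm_inner_le_norm _ _).trans ?_
    rw [hΩ.norm_outerNormal hx, one_mul]
  have e1 : ∫ y in Ω, f y = ∑ i ∈ t, ∫ y in Ω, (χ i y * f y + fderiv ℝ (χ i) y (X y)) := by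
    rw [← integral_finsetSum _ fun i hi => (hX.smul hΩ.isOpen
      (IsTestFunction.isC1Bounded (Ω := Ω) (hχ i hi).1 (hχ i hi).2.1)).integrableOn_div]
    refine setIntegral_congr_fun hΩ.isOpen.measurableSet fun y hy => ?_
    -- The partition sums to 1 on the open set Ω, so its derivatives sum to zero and the cutoffs
    -- leave no trace in the total divergence.
    have h1 : ∑ i ∈ t, fderiv ℝ (χ i) y (X y) = 0 := by
      have h2 : (fun y => ∑ i ∈ t, χ i y) =ᶠ[𝓝 y] fun _ => 1 := by
        filter_upwards [hΩ.isOpen.mem_nhds hy] with x hx using hsum x (subset_closure hx)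
      have h3 := h2.fderiv_eq (𝕜 := ℝ)
      rw [fderiv_fun_sum fun i hi => (hχ i hi).1.differentiable (by simp) y] at h3
      have h4 := congrArg (fun L : Space N →L[ℝ] ℝ => L (X y)) h3
      simpa using h4
    rw [Finset.sum_add_distrib, h1, add_zero, ← Finset.sum_mul, hsum y (subset_closure hy),
      one_mul]
  have e2 : ∫ x, ⟪outerNormal Ω x, Xb x⟫_ℝ ∂(surfaceMeasure Ω)
      = ∑ i ∈ t, ∫ x, χ i x * ⟪outerNormal Ω x, Xb x⟫_ℝ ∂(surfaceMeasure Ω) := by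
    rw [← integral_finsetSum _ fun i hi => ?_]
    · refine integral_congr_ae ?_
      filter_upwards [surfaceMeasure_ae_mem] with x hx
      rw [← Finset.sum_mul, hsum x (frontier_subset_closure hx), one_mul]
    · obtain ⟨C, hC⟩ := (hχ i hi).1.continuous.bounded_above_of_compact_support (hχ i hi).2.1
      exact hXb.bdd_mul (c := C) (hχ i hi).1.continuous.aestronglyMeasurable
        (Eventually.of_forall hC)
  rw [e1, e2]
  exact Finset.sum_congr rfl fun i hi => hUloc i (hmem i hi) _ (htest i hi)

/-! ### Truncated compositions with a Sobolev function -/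

theorem MemW11.of_tendsto {f : ℕ → Space N → ℝ} {F : ℕ → Space N → Space N} {m : Space N → ℝ}
    {Dm : Space N → Space N} {b B : Space N → ℝ} (h : ∀ j, MemW11 Ω (f j) (F j))
    (hb : IntegrableOn b Ω) (hB : IntegrableOn B Ω)
    (hfb : ∀ j, ∀ᵐ x ∂(volume.restrict Ω), ‖f j x‖ ≤ b x)
    (hFB : ∀ j, ∀ᵐ x ∂(volume.restrict Ω), ‖F j x‖ ≤ B x)
    (hf : ∀ᵐ x ∂(volume.restrict Ω), Tendsto (fun j => f j x) atTop (𝓝 (m x)))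
    (hF : ∀ᵐ x ∂(volume.restrict Ω), Tendsto (fun j => F j x) atTop (𝓝 (Dm x))) :
    MemW11 Ω m Dm where
  integrableOn := by
    refine hb.mono' (aestronglyMeasurable_of_tendsto_ae _
      (fun j => (h j).integrableOn.aestronglyMeasurable) hf) ?_
    filter_upwards [hf, ae_all_iff.2 hfb] with x h1 h2
    exact le_of_tendsto h1.norm (Eventually.of_forall h2)
  integrableOn_grad := by
    refine hB.mono' (aestronglyMeasurable_of_tendsto_ae _
      (fun j => (h j).integrableOn_grad.aestronglyMeasurable) hF) ?_
    filter_upwards [hF, ae_all_iff.2 hFB] with x h1 h2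
    exact le_of_tendsto h1.norm (Eventually.of_forall h2)
  weak_gradient φ hφ := by
    have hd : ContDiff ℝ 1 φ := hφ.smooth.of_le (by exact_mod_cast le_top)
    obtain ⟨C, hC⟩ := norm_fderiv_bounded hd hφ.hasCompactSupport
    obtain ⟨C', hC'⟩ := hd.continuous.bounded_above_of_compact_support hφ.hasCompactSupport
    have l1 : Tendsto (fun j => ∫ x in Ω, f j x • gradient φ x) atTop
        (𝓝 (∫ x in Ω, m x • gradient φ x)) := by
      refine tendsto_integral_of_dominated_convergence (fun x => b x * C)
        (fun j => (h j).integrableOn.aestronglyMeasurable.smul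
          (continuous_gradient hd).aestronglyMeasurable) (hb.mul_const C) (fun j => ?_) ?_
      · filter_upwards [hfb j] with x hx
        rw [norm_smul, norm_gradient]
        exact mul_le_mul hx (hC x) (norm_nonneg _) ((norm_nonneg _).trans hx)
      · filter_upwards [hf] with x hx using hx.smul_const _
    have l2 : Tendsto (fun j => -∫ x in Ω, φ x • F j x) atTop
        (𝓝 (-∫ x in Ω, φ x • Dm x)) := by
      refine (tendsto_integral_of_dominated_convergence (fun x => C' * B x)
        (fun j => hd.continuous.aestronglyMeasurable.smul
          (h j).integrableOn_grad.aestronglyMeasurable) (hB.const_mul C') (fun j => ?_) ?_).neg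
      · filter_upwards [hFB j] with x hx
        refine (norm_smul_le (φ x) (F j x)).trans ?_
        exact mul_le_mul (hC' x) hx (norm_nonneg _) ((norm_nonneg _).trans (hC' x))
      · filter_upwards [hF] with x hx using hx.const_smul _
    refine tendsto_nhds_unique l1 (l2.congr fun j => ((h j).weak_gradient φ hφ).symm)

/-- A Sobolev function `m` and a `C¹` function `G` such that `G(x, m)`, `∇ₓG(x, m)` are integrable
and `g(x, m)` is bounded, `g` being the derivative of `G` in its second variable. -/
structure IsAdmissible (Ω : Set (Space N)) (G g : Space N → ℝ → ℝ) (m : Space N → ℝ)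
    (Dm : Space N → Space N) : Prop where
  contDiffOn : ContDiffOn ℝ 1 (Function.uncurry G) (closure Ω ×ˢ univ)
  continuousOn : ContinuousOn (Function.uncurry g) (closure Ω ×ˢ univ)
  hasDerivAt : ∀ x ∈ closure Ω, ∀ s : ℝ, HasDerivAt (G x) (g x s) s
  memW11 : MemW11 Ω m Dm
  integrableOn : IntegrableOn (fun x => G x (m x)) Ω
  integrableOn_gradient : IntegrableOn (fun x => gradient (fun y => G y (m x)) x) Ω
  bounded : ∃ C, ∀ᵐ x ∂(volume.restrict Ω), ‖g x (m x)‖ ≤ C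

theorem gradient_comp_mul_const {h : Space N → ℝ} {x : Space N} (hh : DifferentiableAt ℝ h x)
    {Z : ℝ → ℝ} (hZ : DifferentiableAt ℝ Z (h x)) (c : ℝ) :
    gradient (fun y => Z (h y) * c) x = (c * deriv Z (h x)) • gradient h x := by
  have h1 : HasFDerivAt (fun y => Z (h y) * c) (c • deriv Z (h x) • fderiv ℝ h x) x :=
    (hZ.hasDerivAt.comp_hasFDerivAt x hh.hasFDerivAt).mul_const c
  rw [gradient, h1.fderiv, map_smul, map_smul, smul_smul, gradient]

/-- A smooth cutoff function on the real line. -/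
def lineBump : ContDiffBump (0 : ℝ) := ⟨1, 2, one_pos, one_lt_two⟩

namespace IsAdmissible

variable {G g : Space N → ℝ → ℝ} {m mb : Space N → ℝ} {Dm : Space N → Space N}

theorem contDiffOn_interior (h : IsAdmissible Ω G g m Dm) :
    ContDiffOn ℝ 1 (Function.uncurry G) (Ω ×ˢ univ) :=
  h.contDiffOn.mono (prod_mono subset_closure subset_rfl)

theorem differentiableAt_left (h : IsAdmissible Ω G g m Dm) (hΩ : IsOpen Ω) {x : Space N}
    (hx : x ∈ Ω) (s : ℝ) : DifferentiableAt ℝ (fun y => G y s) x := by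
  have h1 : DifferentiableAt ℝ (Function.uncurry G) (x, s) :=
    (h.contDiffOn_interior.contDiffAt ((hΩ.prod isOpen_univ).mem_nhds
      ⟨hx, mem_univ _⟩)).differentiableAt one_ne_zero
  exact DifferentiableAt.comp (f := fun y => (y, s)) x h1
    (hasFDerivAt_prodMk_left x s).differentiableAt

theorem ae_mem_closure (hΩ : IsOpen Ω) : ∀ᵐ x ∂((volume : Measure (Space N)).restrict Ω),
    x ∈ closure Ω := by
  filter_upwards [ae_restrict_mem hΩ.measurableSet] with x hx using subset_closure hx

theorem aestronglyMeasurable_g (h : IsAdmissible Ω G g m Dm) (hΩ : IsOpen Ω) :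
    AEStronglyMeasurable (fun x => g x (m x)) (volume.restrict Ω) :=
  IsBoundedSmoothDomain.aestronglyMeasurable_comp h.continuousOn
    h.memW11.integrableOn.aestronglyMeasurable (ae_mem_closure hΩ)

theorem integrableOn_total (h : IsAdmissible Ω G g m Dm) (hΩ : IsOpen Ω) :
    IntegrableOn (fun x => gradient (fun y => G y (m x)) x + g x (m x) • Dm x) Ω := by
  obtain ⟨C, hC⟩ := h.bounded
  exact h.integrableOn_gradient.add (h.memW11.integrableOn_grad.bdd_smul C
    (h.aestronglyMeasurable_g hΩ) hC)

/-- The chain rule `MemW11.comp` requires a function of (x, s) vanishing for large s, so Z(G(x, s))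
is multiplied by ξ(s/(j+1)). The additional gradient term carries the factor 1/(j+1) and is
dominated by M L |∇m|, so it disappears in the limit. -/
theorem memW11_comp (h : IsAdmissible Ω G g m Dm) (hΩ : IsBoundedSmoothDomain Ω) {Z : ℝ → ℝ}
    (hZ : ContDiff ℝ 1 Z) (hZ1 : ∀ t, ‖deriv Z t‖ ≤ 1) {M : ℝ} (hM : ∀ t, ‖Z t‖ ≤ M) :
    MemW11 Ω (fun x => Z (G x (m x))) (fun x => deriv Z (G x (m x)) •
      (gradient (fun y => G y (m x)) x + g x (m x) • Dm x)) := by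
  have hΩo := hΩ.isOpen
  have := hΩ.isFiniteMeasure_restrict
  have hM0 : 0 ≤ M := (norm_nonneg _).trans (hM 0)
  let ξ : ℝ → ℝ := lineBump
  have hξ : ContDiff ℝ 1 ξ := lineBump.contDiff
  obtain ⟨L, hL⟩ := (hξ.continuous_deriv le_rfl).bounded_above_of_compact_support
    (lineBump.hasCompactSupport.deriv)
  have hL0 : 0 ≤ L := (norm_nonneg _).trans (hL 0)
  have hξ1 : ∀ s, ‖ξ s‖ ≤ 1 := fun s => by
    rw [Real.norm_of_nonneg lineBump.nonneg]; exact lineBump.le_one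
  let c : ℕ → ℝ := fun j => ((j : ℝ) + 1)⁻¹
  have hc0 : ∀ j, 0 < c j := fun j => by positivity
  have hc1 : ∀ j, c j ≤ 1 := fun j => inv_le_one_of_one_le₀ (by
    have : (0 : ℝ) ≤ j := Nat.cast_nonneg j
    linarith)
  have hclim : Tendsto c atTop (𝓝 0) := by
    simpa [c] using tendsto_one_div_add_atTop_nhds_zero_nat (𝕜 := ℝ)
  let H : ℕ → Space N → ℝ → ℝ := fun j x s => Z (G x s) * ξ (c j * s)
  have hHC : ∀ j, ContDiffOn ℝ 1 (Function.uncurry (H j)) (Ω ×ˢ univ) := fun j =>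
    (hZ.comp_contDiffOn h.contDiffOn_interior).mul
      ((hξ.comp (contDiff_const.mul contDiff_snd)).contDiffOn)
  have hgrad : ∀ j, ∀ x ∈ Ω, gradient (fun y => H j y (m x)) x + deriv (H j x) (m x) • Dm x
      = (ξ (c j * m x) * deriv Z (G x (m x))) •
          (gradient (fun y => G y (m x)) x + g x (m x) • Dm x)
        + (Z (G x (m x)) * (deriv ξ (c j * m x) * c j)) • Dm x := by
    intro j x hx
    have hZd : DifferentiableAt ℝ Z (G x (m x)) := hZ.differentiable one_ne_zero _
    rw [gradient_comp_mul_const (h.differentiableAt_left hΩo hx (m x)) hZd]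
    have d1 := hZd.hasDerivAt.comp (m x) (h.hasDerivAt x (subset_closure hx) (m x))
    have d2 : HasDerivAt (fun s => ξ (c j * s)) (deriv ξ (c j * m x) * (c j * 1)) (m x) :=
      ((hξ.differentiable one_ne_zero _).hasDerivAt).comp (m x)
        ((hasDerivAt_id (m x)).const_mul (c j))
    have d3 : deriv (H j x) (m x) = _ := (d1.mul d2).deriv
    rw [d3, smul_add, smul_smul, add_assoc, ← add_smul]
    congr 2
    simp only [Function.comp]
    ring
  obtain ⟨Cg, hCg⟩ := h.bounded
  have hmm := h.memW11.integrableOn.aestronglyMeasurable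
  have iT := h.integrableOn_total hΩo
  have hGm := h.integrableOn.aestronglyMeasurable
  have mξ : ∀ j, AEStronglyMeasurable (fun x => ξ (c j * m x)) (volume.restrict Ω) := fun j =>
    hξ.continuous.comp_aestronglyMeasurable (hmm.const_mul (c j))
  have mξ' : ∀ j, AEStronglyMeasurable (fun x => deriv ξ (c j * m x) * c j)
      (volume.restrict Ω) := fun j =>
    ((hξ.continuous_deriv le_rfl).comp_aestronglyMeasurable (hmm.const_mul (c j))).mul_const _
  have mZ : AEStronglyMeasurable (fun x => Z (G x (m x))) (volume.restrict Ω) :=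
    hZ.continuous.comp_aestronglyMeasurable hGm
  have mZ' : AEStronglyMeasurable (fun x => deriv Z (G x (m x))) (volume.restrict Ω) :=
    (hZ.continuous_deriv le_rfl).comp_aestronglyMeasurable hGm
  have b1 : ∀ j x, ‖Z (G x (m x)) * ξ (c j * m x)‖ ≤ M := fun j x => by
    rw [norm_mul]
    exact (mul_le_mul (hM _) (hξ1 _) (norm_nonneg _) hM0).trans_eq (mul_one _)
  have b2 : ∀ j x, ‖ξ (c j * m x) * deriv Z (G x (m x))‖ ≤ 1 := fun j x => by
    rw [norm_mul]
    exact (mul_le_mul (hξ1 _) (hZ1 _) (norm_nonneg _) zero_le_one).trans_eq (mul_one _)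
  have b3 : ∀ j x, ‖Z (G x (m x)) * (deriv ξ (c j * m x) * c j)‖ ≤ M * L := fun j x => by
    rw [norm_mul, norm_mul, Real.norm_of_nonneg (hc0 j).le]
    refine mul_le_mul (hM _) ?_ (by have := (hc0 j).le; positivity) hM0
    exact (mul_le_mul (hL _) (hc1 j) (hc0 j).le hL0).trans_eq (mul_one _)
  have iH : ∀ j, IntegrableOn (fun x => (ξ (c j * m x) * deriv Z (G x (m x))) •
          (gradient (fun y => G y (m x)) x + g x (m x) • Dm x)
        + (Z (G x (m x)) * (deriv ξ (c j * m x) * c j)) • Dm x) Ω := fun j =>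
    (iT.bdd_smul 1 ((mξ j).mul mZ') (Eventually.of_forall (b2 j))).add
      (h.memW11.integrableOn_grad.bdd_smul (M * L) (mZ.mul (mξ' j)) (Eventually.of_forall (b3 j)))
  refine MemW11.of_tendsto (f := fun j x => H j x (m x))
    (F := fun j x => gradient (fun y => H j y (m x)) x + deriv (H j x) (m x) • Dm x)
    (b := fun _ => M) (B := fun x => ‖gradient (fun y => G y (m x)) x + g x (m x) • Dm x‖
      + M * L * ‖Dm x‖) (fun j => ?_) (integrable_const M)
    (iT.norm.add (h.memW11.integrableOn_grad.norm.const_mul _))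
    (fun j => Eventually.of_forall (b1 j)) (fun j => ?_) (Eventually.of_forall fun x => ?_) ?_
  -- The value 2 is the outer radius of `lineBump`.
  · refine h.memW11.comp hΩo (hHC j) (R := 2 / c j) (fun x _ s hs => ?_)
      (Integrable.of_bound (mZ.mul (mξ j)) M (Eventually.of_forall (b1 j))) ?_
    · have : ξ (c j * s) = 0 := by
        refine lineBump.zero_of_le_dist ?_
        rw [Real.dist_eq, sub_zero, abs_mul, abs_of_pos (hc0 j)]
        rw [div_lt_iff₀ (hc0 j)] at hs
        change (2 : ℝ) ≤ _
        linarith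
      simp only [H, this, mul_zero]
    · refine (iH j).congr ?_
      filter_upwards [ae_restrict_mem hΩo.measurableSet] with x hx using (hgrad j x hx).symm
  · filter_upwards [ae_restrict_mem hΩo.measurableSet] with x hx
    rw [hgrad j x hx]
    refine (norm_add_le _ _).trans (add_le_add ?_ ?_)
    · rw [norm_smul]
      exact mul_le_of_le_one_left (norm_nonneg _) (b2 j x)
    · rw [norm_smul]
      exact mul_le_mul_of_nonneg_right (b3 j x) (norm_nonneg _)
  · have h1 : Tendsto (fun j => c j * m x) atTop (𝓝 0) := by simpa using hclim.mul_const (m x)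
    have h2 : Tendsto (fun j => ξ (c j * m x)) atTop (𝓝 1) := by
      have := (hξ.continuous.tendsto 0).comp h1
      rwa [show ξ 0 = 1 from lineBump.one_of_mem_closedBall
        (Metric.mem_closedBall_self lineBump.rIn_pos.le)] at this
    simpa using h2.const_mul (Z (G x (m x)))
  · filter_upwards [ae_restrict_mem hΩo.measurableSet] with x hx
    simp only [hgrad _ x hx]
    have h1 : Tendsto (fun j => c j * m x) atTop (𝓝 0) := by simpa using hclim.mul_const (m x)
    have h2 : Tendsto (fun j => ξ (c j * m x)) atTop (𝓝 1) := by
      have := (hξ.continuous.tendsto 0).comp h1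
      rwa [show ξ 0 = 1 from lineBump.one_of_mem_closedBall
        (Metric.mem_closedBall_self lineBump.rIn_pos.le)] at this
    have h3 : Tendsto (fun j => deriv ξ (c j * m x) * c j) atTop (𝓝 0) := by
      have := ((hξ.continuous_deriv le_rfl).tendsto 0).comp h1
      simpa using this.mul hclim
    have h4 := ((h2.mul_const (deriv Z (G x (m x)))).smul_const
      (gradient (fun y => G y (m x)) x + g x (m x) • Dm x)).add
      ((h3.const_mul (Z (G x (m x)))).smul_const (Dm x))
    simpa using h4

theorem hasTrace_comp (h : IsAdmissible Ω G g m Dm) (hΩ : IsBoundedSmoothDomain Ω)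
    (hmb : HasTrace Ω m mb) {Z : ℝ → ℝ} (hZ : Continuous Z) {M : ℝ} (hM : ∀ t, ‖Z t‖ ≤ M) :
    HasTrace Ω (fun x => Z (G x (m x))) (fun x => Z (G x (mb x))) :=
  hmb.comp_bounded hΩ h.memW11.integrableOn.aestronglyMeasurable (h := fun x s => Z (G x s))
    (hZ.comp_continuousOn h.contDiffOn.continuousOn) fun _ _ _ => hM _

/-- Divergence theorem for the field `Z(G(x, m)) x`. -/
theorem integral_comp_smul_id (h : IsAdmissible Ω G g m Dm) (hΩ : IsBoundedSmoothDomain Ω)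
    (hmb : HasTrace Ω m mb) {Z : ℝ → ℝ} (hZ : ContDiff ℝ 1 Z) (hZ1 : ∀ t, ‖deriv Z t‖ ≤ 1) {M : ℝ}
    (hM : ∀ t, ‖Z t‖ ≤ M) :
    ∫ x in Ω, (deriv Z (G x (m x)) * ⟪gradient (fun y => G y (m x)) x + g x (m x) • Dm x, x⟫_ℝ
        + N * Z (G x (m x)))
      = ∫ x, Z (G x (mb x)) * ⟪outerNormal Ω x, x⟫_ℝ ∂(surfaceMeasure Ω) := by
  have hW := h.memW11_comp hΩ hZ hZ1 hM
  have ht : HasTrace Ω (fun x => Z (G x (m x)) • x) (fun x => Z (G x (mb x)) • x) := by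
    have := (h.hasTrace_comp hΩ hmb hZ.continuous hM).clm_apply hΩ
      hW.integrableOn.aestronglyMeasurable
      (B := fun x => ContinuousLinearMap.toSpanSingleton ℝ x)
      (ContinuousLinearMap.toSpanSingletonCLE.continuous.continuousOn)
    simpa using this
  have := (hW.hasWeakDiv_smul_id hΩ.isOpen hΩ.isBounded).integral_eq_integral_normal hΩ ht
  simpa only [inner_smul_left, inner_smul_right, conj_trivial] using this

/-- Divergence theorem for the field `χ Z(G(x, m)) e`. -/
theorem integral_comp_smul_const (h : IsAdmissible Ω G g m Dm) (hΩ : IsBoundedSmoothDomain Ω)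
    (hmb : HasTrace Ω m mb) {Z : ℝ → ℝ} (hZ : ContDiff ℝ 1 Z) (hZ1 : ∀ t, ‖deriv Z t‖ ≤ 1) {M : ℝ}
    (hM : ∀ t, ‖Z t‖ ≤ M) {χ : Space N → ℝ} (hχ : ContDiff ℝ ∞ χ) (hχc : HasCompactSupport χ)
    (e : Space N) :
    ∫ x in Ω, (χ x * (deriv Z (G x (m x)) *
          ⟪gradient (fun y => G y (m x)) x + g x (m x) • Dm x, e⟫_ℝ)
        + Z (G x (m x)) * fderiv ℝ χ x e)
      = ∫ x, χ x * (Z (G x (mb x)) * ⟪outerNormal Ω x, e⟫_ℝ) ∂(surfaceMeasure Ω) := by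
  have hW := h.memW11_comp hΩ hZ hZ1 hM
  have ht : HasTrace Ω (fun x => χ x • Z (G x (m x)) • e) (fun x => χ x • Z (G x (mb x)) • e) := by
    have := (h.hasTrace_comp hΩ hmb hZ.continuous hM).clm_apply hΩ
      hW.integrableOn.aestronglyMeasurable
      (B := fun x => χ x • ContinuousLinearMap.toSpanSingleton ℝ e)
      (hχ.continuous.smul continuous_const).continuousOn
    simpa using this
  have := ((hW.hasWeakDiv_smul_const e).smul hΩ.isOpen
    (IsTestFunction.isC1Bounded hχ hχc)).integral_eq_integral_normal hΩ ht
  simpa only [inner_smul_left, inner_smul_right, conj_trivial, map_smul, smul_eq_mul] using this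

end IsAdmissible

/-! ### Integrability of the boundary values of `G(x, m)` -/

/-- A bounded approximation of the identity of the real line. -/
def trunc (c t : ℝ) : ℝ := t / (1 + c * t ^ 2)

section Trunc

variable {c : ℝ}

theorem trunc_den_pos (hc : 0 ≤ c) (t : ℝ) : 0 < 1 + c * t ^ 2 := by positivity

theorem contDiff_trunc (hc : 0 ≤ c) : ContDiff ℝ 1 (trunc c) :=
  contDiff_id.div (contDiff_const.add (contDiff_const.mul (contDiff_id.pow 2)))
    fun t => (trunc_den_pos hc t).ne'

theorem deriv_trunc (hc : 0 ≤ c) (t : ℝ) :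
    deriv (trunc c) t = (1 - c * t ^ 2) / (1 + c * t ^ 2) ^ 2 := by
  have h := (hasDerivAt_id t).div (((hasDerivAt_pow 2 t).const_mul c).const_add 1)
    (trunc_den_pos hc t).ne'
  have : deriv (trunc c) t = _ := h.deriv
  rw [this]
  simp only [id]
  congr 1
  push_cast
  ring

theorem norm_deriv_trunc_le (hc : 0 ≤ c) (t : ℝ) : ‖deriv (trunc c) t‖ ≤ 1 := by
  have h0 := trunc_den_pos hc t
  have h1 : 0 ≤ c * t ^ 2 := by positivity
  rw [deriv_trunc hc, norm_div, norm_pow, Real.norm_of_nonneg h0.le, div_le_one (by positivity),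
    Real.norm_eq_abs, abs_le]
  constructor <;> nlinarith

theorem norm_trunc_le (hc : 0 ≤ c) (t : ℝ) : ‖trunc c t‖ ≤ ‖t‖ := by
  have h0 := trunc_den_pos hc t
  rw [trunc, norm_div, Real.norm_of_nonneg h0.le]
  refine div_le_self (norm_nonneg _) ?_
  have : 0 ≤ c * t ^ 2 := by positivity
  linarith

/-- Not uniform as c → 0: it only provides the boundedness required for each fixed c. The limit
relies on the uniform bounds `norm_trunc_le` and `norm_deriv_trunc_le`. -/
theorem norm_trunc_le_const (hc : 0 < c) (t : ℝ) : ‖trunc c t‖ ≤ 1 + 1 / c := by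
  have h0 := trunc_den_pos hc.le t
  rw [trunc, norm_div, Real.norm_of_nonneg h0.le, div_le_iff₀ h0, Real.norm_eq_abs]
  have h1 : (1 + 1 / c) * (1 + c * t ^ 2) = 1 + c * t ^ 2 + 1 / c + t ^ 2 := by
    field_simp
    ring
  rw [h1]
  have h2 : 0 ≤ c * t ^ 2 := by positivity
  have h3 : 0 ≤ 1 / c := by positivity
  have h4 : |t| ≤ 1 + t ^ 2 := by rw [← sq_abs]; nlinarith [sq_nonneg (|t| - 1), abs_nonneg t]
  linarith

theorem tendsto_trunc {ι : Type*} {l : Filter ι} {c : ι → ℝ} (hc : Tendsto c l (𝓝 0)) (t : ℝ) :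
    Tendsto (fun i => trunc (c i) t) l (𝓝 t) := by
  have h : Tendsto (fun i => t / (1 + c i * t ^ 2)) l (𝓝 (t / (1 + 0 * t ^ 2))) :=
    tendsto_const_nhds.div ((hc.mul_const _).const_add 1) (by simp)
  simpa [trunc] using h

theorem tendsto_deriv_trunc {ι : Type*} {l : Filter ι} {c : ι → ℝ} (hc0 : ∀ i, 0 ≤ c i)
    (hc : Tendsto c l (𝓝 0)) (t : ℝ) : Tendsto (fun i => deriv (trunc (c i)) t) l (𝓝 1) := by
  have h : Tendsto (fun i => (1 - c i * t ^ 2) / (1 + c i * t ^ 2) ^ 2) l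
      (𝓝 ((1 - 0 * t ^ 2) / (1 + 0 * t ^ 2) ^ 2)) :=
    ((hc.mul_const _).const_sub 1).div (((hc.mul_const _).const_add 1).pow 2) (by simp)
  simpa [deriv_trunc (hc0 _)] using h

/-- A bounded approximation of `t ↦ √(1 + t²)`. -/
def absTrunc (c t : ℝ) : ℝ := √(1 + trunc c t ^ 2)

theorem absTrunc_nonneg (c t : ℝ) : 0 ≤ absTrunc c t := Real.sqrt_nonneg _

theorem contDiff_absTrunc (hc : 0 ≤ c) : ContDiff ℝ 1 (absTrunc c) :=
  (contDiff_const.add ((contDiff_trunc hc).pow 2)).sqrt fun t => by positivity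

theorem absTrunc_le (c t : ℝ) : absTrunc c t ≤ 1 + ‖trunc c t‖ := by
  rw [absTrunc, Real.norm_eq_abs]
  refine Real.sqrt_le_iff.2 ⟨by positivity, ?_⟩
  rw [← sq_abs (trunc c t)]
  nlinarith [abs_nonneg (trunc c t)]

theorem norm_deriv_absTrunc_le (hc : 0 ≤ c) (t : ℝ) : ‖deriv (absTrunc c) t‖ ≤ 1 := by
  have h1 := ((contDiff_trunc hc).differentiable one_ne_zero t).hasDerivAt
  have h0 : 0 < √(1 + trunc c t ^ 2) := Real.sqrt_pos.2 (by positivity)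
  have h2 : HasDerivAt (absTrunc c)
      (2 * trunc c t * deriv (trunc c) t / (2 * √(1 + trunc c t ^ 2))) t := by
    have := ((h1.pow 2).const_add 1).sqrt (show 1 + trunc c t ^ 2 ≠ 0 by positivity)
    exact HasDerivAt.congr_deriv (f := absTrunc c) this (by simp)
  rw [h2.deriv, norm_div, div_le_one (norm_pos_iff.2 (by positivity))]
  have h4 := norm_deriv_trunc_le hc t
  have h5 : ‖trunc c t‖ ≤ √(1 + trunc c t ^ 2) := by
    rw [Real.norm_eq_abs, ← Real.sqrt_sq_eq_abs]
    exact Real.sqrt_le_sqrt (by linarith)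
  rw [Real.norm_of_nonneg (mul_pos two_pos h0).le, norm_mul, norm_mul, RCLike.norm_ofNat]
  nlinarith [norm_nonneg (trunc c t), norm_nonneg (deriv (trunc c) t)]

theorem tendsto_absTrunc {ι : Type*} {l : Filter ι} {c : ι → ℝ} (hc : Tendsto c l (𝓝 0)) (t : ℝ) :
    Tendsto (fun i => absTrunc (c i) t) l (𝓝 √(1 + t ^ 2)) :=
  (((tendsto_trunc hc t).pow 2).const_add 1).sqrt

end Trunc

theorem IsChart.half_le_inner_outerNormal {p e : Space N} {R : ℝ} {ρ : Space N → ℝ}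
    (h : IsChart Ω p e (1 / 4) R ρ) (hΩ : IsBoundedSmoothDomain Ω)
    {x : Space N} (hxB : x ∈ Metric.ball p R) (hx : x ∈ frontier Ω) :
    1 / 2 ≤ ⟪outerNormal Ω x, e⟫_ℝ := by
  have h1 := h.norm_outerNormal_sub_le hΩ hxB hx
  have h2 : ⟪outerNormal Ω x, e⟫_ℝ = ⟪outerNormal Ω x - e, e⟫_ℝ + 1 := by
    rw [inner_sub_left, real_inner_self_eq_norm_sq, h.norm_eq_one]; ring
  have h3 := abs_real_inner_le_norm (outerNormal Ω x - e) e
  rw [h.norm_eq_one, mul_one] at h3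
  linarith [(abs_le.1 (h3.trans h1)).1]

namespace IsAdmissible

variable {G g : Space N → ℝ → ℝ} {m mb : Space N → ℝ} {Dm : Space N → Space N}

theorem aestronglyMeasurable_boundary (h : IsAdmissible Ω G g m Dm) (hmb : HasTrace Ω m mb) :
    AEStronglyMeasurable (fun x => G x (mb x)) (surfaceMeasure Ω) :=
  IsBoundedSmoothDomain.aestronglyMeasurable_comp h.contDiffOn.continuousOn
    hmb.1.aestronglyMeasurable
    (by filter_upwards [surfaceMeasure_ae_mem] with x hx using frontier_subset_closure hx)

/-- Near p one has ⟨ν, e⟩ ≥ 1/2, so the flux of χ Z(G(x,m)) e through ∂Ω controls the surface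
integral of a nonnegative Z(G(x,m)). The divergence theorem bounds this flux by a volume integral,
uniformly over the truncations Z of √(1+t²). -/
theorem integrableAtFilter_boundary (h : IsAdmissible Ω G g m Dm) (hΩ : IsBoundedSmoothDomain Ω)
    (hmb : HasTrace Ω m mb) {p : Space N} (hp : p ∈ frontier Ω) :
    IntegrableAtFilter (fun x => G x (mb x)) (𝓝 p) (surfaceMeasure Ω) := by
  have := hΩ.isFiniteMeasure
  have := hΩ.isFiniteMeasure_restrict
  obtain ⟨e, R, ρ, hC⟩ := hΩ.exists_chart hp (ε := 1 / 4) (by norm_num)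
  obtain ⟨χ, hχ, hχc, hχs, hχ01, hχ1⟩ := exists_cutoff (isCompact_singleton (x := p))
    Metric.isOpen_ball (singleton_subset_iff.2 (Metric.mem_ball_self hC.pos))
  rw [nhdsSet_singleton] at hχ1
  obtain ⟨V, hV, hVo, hpV⟩ := _root_.mem_nhds_iff.1 hχ1
  have hfm := h.aestronglyMeasurable_boundary hmb
  set f := fun x => G x (mb x) with hf
  obtain ⟨L, hL⟩ := norm_fderiv_bounded (hχ.of_le (by exact_mod_cast le_top)) hχc
  have hL0 : 0 ≤ L := (norm_nonneg _).trans (hL 0)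
  let B : Space N → ℝ := fun x => ‖gradient (fun y => G y (m x)) x + g x (m x) • Dm x‖
    + (1 + ‖G x (m x)‖) * L
  have hB : IntegrableOn B Ω := (h.integrableOn_total hΩ.isOpen).norm.add
    (((integrable_const (1 : ℝ)).add h.integrableOn.norm).mul_const L)
  set A := ∫ x in Ω, B x
  let c : ℕ → ℝ := fun j => 1 / ((j : ℝ) + 1)
  have hc0 : ∀ j, 0 < c j := fun j => by positivity
  have hclim : Tendsto c atTop (𝓝 0) := tendsto_one_div_add_atTop_nhds_zero_nat
  have hYle : ∀ j t, absTrunc (c j) t ≤ 1 + ‖t‖ := fun j t =>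
    (absTrunc_le _ _).trans (by linarith [norm_trunc_le (hc0 j).le t])
  have hbd : ∀ j t, ‖absTrunc (c j) t‖ ≤ 1 + (1 + 1 / c j) := fun j t => by
    rw [Real.norm_of_nonneg (absTrunc_nonneg _ _)]
    exact (absTrunc_le _ _).trans (by linarith [norm_trunc_le_const (hc0 j) t])
  -- The bound does not depend on j: `absTrunc` has slope at most 1 and is at most 1 + |t|, so the
  -- divergence is dominated by `B`.
  have hA : ∀ j, ∫ x, χ x * (absTrunc (c j) (f x) * ⟪outerNormal Ω x, e⟫_ℝ)
      ∂(surfaceMeasure Ω) ≤ A := by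
    intro j
    rw [← h.integral_comp_smul_const hΩ hmb (contDiff_absTrunc (hc0 j).le)
      (norm_deriv_absTrunc_le (hc0 j).le) (hbd j) hχ hχc e]
    refine (Real.le_norm_self _).trans (norm_integral_le_of_norm_le hB
      (Eventually.of_forall fun x => ?_))
    refine (norm_add_le _ _).trans (add_le_add ?_ ?_)
    · rw [norm_mul, norm_mul]
      have b1 : ‖χ x‖ ≤ 1 := by rw [Real.norm_of_nonneg (hχ01 x).1]; exact (hχ01 x).2
      have b2 := norm_inner_le_norm (𝕜 := ℝ)
        (gradient (fun y => G y (m x)) x + g x (m x) • Dm x) e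
      rw [hC.norm_eq_one, mul_one] at b2
      refine (mul_le_of_le_one_left (by positivity) b1).trans
        ((mul_le_of_le_one_left (norm_nonneg _) (norm_deriv_absTrunc_le (hc0 j).le _)).trans b2)
    · rw [norm_mul, Real.norm_of_nonneg (absTrunc_nonneg _ _)]
      refine mul_le_mul (hYle j _) ?_ (norm_nonneg _) (by positivity)
      refine ((fderiv ℝ χ x).le_opNorm e).trans ?_
      rw [hC.norm_eq_one, mul_one]
      exact hL x
  have hmY : ∀ j, AEStronglyMeasurable (fun x => absTrunc (c j) (f x)) (surfaceMeasure Ω) :=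
    fun j => (contDiff_absTrunc (hc0 j).le).continuous.comp_aestronglyMeasurable hfm
  have hint : ∀ j, Integrable (fun x => χ x * (absTrunc (c j) (f x) * ⟪outerNormal Ω x, e⟫_ℝ))
      (surfaceMeasure Ω) := fun j => by
    obtain ⟨C, hCb⟩ := hχ.continuous.bounded_above_of_compact_support hχc
    exact (hΩ.integrable_mul_normal (Integrable.of_bound (hmY j) _
      (Eventually.of_forall fun x => hbd j _)) e).bdd_mul (c := C)
      hχ.continuous.aestronglyMeasurable (Eventually.of_forall hCb)
  have hpos : ∀ j, ∀ᵐ x ∂(surfaceMeasure Ω),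
      χ x * absTrunc (c j) (f x) ≤ 2 * (χ x * (absTrunc (c j) (f x) * ⟪outerNormal Ω x, e⟫_ℝ)) := by
    intro j
    filter_upwards [surfaceMeasure_ae_mem] with x hx
    by_cases hxB : x ∈ Metric.ball p R
    · have := hC.half_le_inner_outerNormal hΩ hxB hx
      have h0 := mul_nonneg (hχ01 x).1 (absTrunc_nonneg (c j) (f x))
      nlinarith
    · rw [image_eq_zero_of_notMem_tsupport fun hm => hxB (hχs hm)]
      simp
  have hlin : ∀ j, ∫⁻ x in V, ENNReal.ofReal (absTrunc (c j) (f x)) ∂(surfaceMeasure Ω)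
      ≤ ENNReal.ofReal (2 * A) := by
    intro j
    calc ∫⁻ x in V, ENNReal.ofReal (absTrunc (c j) (f x)) ∂(surfaceMeasure Ω)
        ≤ ∫⁻ x in V, ENNReal.ofReal
            (2 * (χ x * (absTrunc (c j) (f x) * ⟪outerNormal Ω x, e⟫_ℝ))) ∂(surfaceMeasure Ω) := by
          refine lintegral_mono_ae ?_
          filter_upwards [ae_restrict_mem hVo.measurableSet, ae_restrict_of_ae (hpos j)] with x hx h1
          have : χ x = 1 := hV hx
          rw [this, one_mul] at h1
          rw [this]
          exact ENNReal.ofReal_le_ofReal h1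
      _ ≤ ∫⁻ x, ENNReal.ofReal
            (2 * (χ x * (absTrunc (c j) (f x) * ⟪outerNormal Ω x, e⟫_ℝ))) ∂(surfaceMeasure Ω) :=
          setLIntegral_le_lintegral _ _
      _ = ENNReal.ofReal (∫ x, 2 * (χ x * (absTrunc (c j) (f x) * ⟪outerNormal Ω x, e⟫_ℝ))
            ∂(surfaceMeasure Ω)) := by
          refine (ofReal_integral_eq_lintegral_ofReal ((hint j).const_mul 2) ?_).symm
          filter_upwards [hpos j] with x hx
          exact (mul_nonneg (hχ01 x).1 (absTrunc_nonneg (c j) (f x))).trans hx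
      _ ≤ ENNReal.ofReal (2 * A) := by
          rw [integral_const_mul]
          exact ENNReal.ofReal_le_ofReal (by linarith [hA j])
  refine ⟨V, hVo.mem_nhds hpV, hfm.restrict, ?_⟩
  refine (hasFiniteIntegral_iff_enorm.2 ?_)
  -- Fatou's lemma, with |t| ≤ √(1+t²).
  calc ∫⁻ x in V, ‖f x‖ₑ ∂(surfaceMeasure Ω)
      ≤ ∫⁻ x in V, liminf (fun j => ENNReal.ofReal (absTrunc (c j) (f x))) atTop
          ∂(surfaceMeasure Ω) := by
        refine lintegral_mono fun x => ?_
        rw [(ENNReal.tendsto_ofReal (tendsto_absTrunc hclim (f x))).liminf_eq, ← ofReal_norm]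
        refine ENNReal.ofReal_le_ofReal ?_
        rw [Real.norm_eq_abs, ← Real.sqrt_sq_eq_abs]
        exact Real.sqrt_le_sqrt (by linarith)
    _ ≤ liminf (fun j => ∫⁻ x in V, ENNReal.ofReal (absTrunc (c j) (f x)) ∂(surfaceMeasure Ω))
          atTop := lintegral_liminf_le' fun j => (hmY j).restrict.aemeasurable.ennreal_ofReal
    _ ≤ ENNReal.ofReal (2 * A) := liminf_le_of_le (by isBoundedDefault) fun b hb => by
        obtain ⟨j, hj⟩ := hb.exists
        exact hj.trans (hlin j)
    _ < ⊤ := ENNReal.ofReal_lt_top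

theorem integrable_boundary (h : IsAdmissible Ω G g m Dm) (hΩ : IsBoundedSmoothDomain Ω)
    (hmb : HasTrace Ω m mb) : Integrable (fun x => G x (mb x)) (surfaceMeasure Ω) := by
  have h1 : LocallyIntegrableOn (fun x => G x (mb x)) (frontier Ω) (surfaceMeasure Ω) :=
    fun p hp => (h.integrableAtFilter_boundary hΩ hmb hp).filter_mono nhdsWithin_le_nhds
  have h2 := h1.integrableOn_isCompact hΩ.isCompact_frontier
  rwa [IntegrableOn, surfaceMeasure, Measure.restrict_restrict isClosed_frontier.measurableSet,
    inter_self] at h2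

/-- Divergence theorem for the field `G(x, m) x`. -/
theorem integral_eq_integral_boundary (h : IsAdmissible Ω G g m Dm)
    (hΩ : IsBoundedSmoothDomain Ω) (hmb : HasTrace Ω m mb) :
    ∫ x in Ω, (⟪gradient (fun y => G y (m x)) x + g x (m x) • Dm x, x⟫_ℝ + N * G x (m x))
      = ∫ x, G x (mb x) * ⟪outerNormal Ω x, x⟫_ℝ ∂(surfaceMeasure Ω) := by
  obtain ⟨D, hD⟩ := hΩ.isBounded.exists_norm_le
  obtain ⟨D', hD'⟩ := hΩ.isCompact_frontier.isBounded.exists_norm_le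
  let c : ℕ → ℝ := fun j => 1 / ((j : ℝ) + 1)
  have hc0 : ∀ j, 0 < c j := fun j => by positivity
  have hclim : Tendsto c atTop (𝓝 0) := tendsto_one_div_add_atTop_nhds_zero_nat
  have iT := h.integrableOn_total hΩ.isOpen
  have iG := h.integrable_boundary hΩ hmb
  have hGm := h.integrableOn.aestronglyMeasurable
  have hid : AEStronglyMeasurable (fun x : Space N => x) (volume.restrict Ω) :=
    continuous_id.aestronglyMeasurable
  -- The formula holds for each bounded truncation; both sides pass to the limit by dominated
  -- convergence, the boundary side thanks to `integrable_boundary`.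
  have key := fun j => h.integral_comp_smul_id hΩ hmb (contDiff_trunc (hc0 j).le)
    (norm_deriv_trunc_le (hc0 j).le) (norm_trunc_le_const (hc0 j))
  have l1 : Tendsto (fun j => ∫ x in Ω, (deriv (trunc (c j)) (G x (m x))
        * ⟪gradient (fun y => G y (m x)) x + g x (m x) • Dm x, x⟫_ℝ
        + N * trunc (c j) (G x (m x)))) atTop
      (𝓝 (∫ x in Ω, (⟪gradient (fun y => G y (m x)) x + g x (m x) • Dm x, x⟫_ℝ
        + N * G x (m x)))) := by
    refine tendsto_integral_of_dominated_convergence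
      (fun x => ‖gradient (fun y => G y (m x)) x + g x (m x) • Dm x‖ * D + N * ‖G x (m x)‖)
      (fun j => ?_) ((iT.norm.mul_const D).add (h.integrableOn.norm.const_mul _)) (fun j => ?_) ?_
    · exact ((((contDiff_trunc (hc0 j).le).continuous_deriv le_rfl).comp_aestronglyMeasurable
        hGm).mul (iT.aestronglyMeasurable.inner hid)).add
        (((contDiff_trunc (hc0 j).le).continuous.comp_aestronglyMeasurable hGm).const_mul _)
    · filter_upwards [ae_restrict_mem hΩ.isOpen.measurableSet] with x hx
      refine (norm_add_le _ _).trans (add_le_add ?_ ?_)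
      · rw [norm_mul]
        refine (mul_le_of_le_one_left (norm_nonneg _) (norm_deriv_trunc_le (hc0 j).le _)).trans
          ((norm_inner_le_norm _ _).trans ?_)
        gcongr
        exact hD x hx
      · rw [norm_mul, Real.norm_of_nonneg (Nat.cast_nonneg N)]
        gcongr
        exact norm_trunc_le (hc0 j).le _
    · refine Eventually.of_forall fun x => ?_
      have := ((tendsto_deriv_trunc (fun j => (hc0 j).le) hclim (G x (m x))).mul_const
        ⟪gradient (fun y => G y (m x)) x + g x (m x) • Dm x, x⟫_ℝ).add
        ((tendsto_trunc hclim (G x (m x))).const_mul (N : ℝ))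
      simpa using this
  have l2 : Tendsto (fun j => ∫ x, trunc (c j) (G x (mb x)) * ⟪outerNormal Ω x, x⟫_ℝ
      ∂(surfaceMeasure Ω)) atTop
      (𝓝 (∫ x, G x (mb x) * ⟪outerNormal Ω x, x⟫_ℝ ∂(surfaceMeasure Ω))) := by
    refine tendsto_integral_of_dominated_convergence (fun x => ‖G x (mb x)‖ * D')
      (fun j => ?_) (iG.norm.mul_const D') (fun j => ?_) ?_
    · exact ((contDiff_trunc (hc0 j).le).continuous.comp_aestronglyMeasurable
        iG.aestronglyMeasurable).mul (hΩ.aestronglyMeasurable_outerNormal.inner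
          continuous_id.aestronglyMeasurable)
    · filter_upwards [surfaceMeasure_ae_mem] with x hx
      rw [norm_mul]
      refine mul_le_mul (norm_trunc_le (hc0 j).le _) ?_ (norm_nonneg _) (norm_nonneg _)
      refine (norm_inner_le_norm _ _).trans ?_
      rw [hΩ.norm_outerNormal hx, one_mul]
      exact hD' x hx
    · exact Eventually.of_forall fun x => (tendsto_trunc hclim _).mul_const _
  refine tendsto_nhds_unique l1 (l2.congr fun j => (key j).symm)

end IsAdmissible

/-! ### The gradient of the value function -/

theorem IsBoundedSmoothDomain.inner_grad (hΩ : IsBoundedSmoothDomain Ω) (u : Space N → ℝ)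
    {x : Space N} (hx : x ∈ Ω) (a : Space N) : ⟪a, grad Ω u x⟫_ℝ = fderiv ℝ u x a := by
  rw [grad, gradientWithin, fderivWithin_of_mem_nhds
    (mem_of_superset (hΩ.isOpen.mem_nhds hx) subset_closure), real_inner_comm]
  exact inner_gradient_left

section Value

variable {u : Space N → ℝ}

theorem IsBoundedSmoothDomain.contDiffOn_grad (hΩ : IsBoundedSmoothDomain Ω)
    (hu : ContDiffOn ℝ 2 u (closure Ω)) : ContDiffOn ℝ 1 (grad Ω u) (closure Ω) := by
  have h := hu.fderivWithin hΩ.uniqueDiffOn_closure (m := 1) (by norm_num)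
  rw [contDiffOn_euclidean]
  intro i
  have h2 := h.clm_apply (contDiffOn_const (c := EuclideanSpace.basisFun (Fin N) ℝ i))
  refine h2.congr fun x hx => ?_
  rw [← inner_gradientWithin_left, EuclideanSpace.basisFun_apply,
    EuclideanSpace.inner_single_right]
  simp [grad]

theorem IsBoundedSmoothDomain.isC1Bounded (hΩ : IsBoundedSmoothDomain Ω) {F : Type*}
    [NormedAddCommGroup F] [NormedSpace ℝ F] {h : Space N → F}
    (hh : ContDiffOn ℝ 1 h (closure Ω)) : IsC1Bounded Ω h where
  contDiffOn := hh.mono subset_closure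
  bounded := by
    obtain ⟨C, hC⟩ := hΩ.isBounded.isCompact_closure.exists_bound_of_continuousOn hh.continuousOn
    exact ⟨C, fun x hx => hC x (subset_closure hx)⟩
  bounded_fderiv := by
    obtain ⟨C, hC⟩ := hΩ.isBounded.isCompact_closure.exists_bound_of_continuousOn
      (hh.continuousOn_fderivWithin hΩ.uniqueDiffOn_closure le_rfl)
    refine ⟨C, fun x hx => ?_⟩
    rw [← fderivWithin_of_mem_nhds (mem_of_superset (hΩ.isOpen.mem_nhds hx) subset_closure)]
    exact hC x (subset_closure hx)

theorem IsBoundedSmoothDomain.inner_fderiv_grad (hΩ : IsBoundedSmoothDomain Ω)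
    (hu : ContDiffOn ℝ 2 u (closure Ω)) {x : Space N} (hx : x ∈ Ω) (a v : Space N) :
    ⟪a, fderiv ℝ (grad Ω u) x v⟫_ℝ = fderiv ℝ (fderiv ℝ u) x v a := by
  rw [← (hΩ.isC1Bounded (hΩ.contDiffOn_grad hu)).fderiv_inner_left hΩ.isOpen a hx v]
  have h1 : (fun y => ⟪a, grad Ω u y⟫_ℝ) =ᶠ[𝓝 x] fun y => fderiv ℝ u y a := by
    filter_upwards [hΩ.isOpen.mem_nhds hx] with y hy using hΩ.inner_grad u hy a
  have h2 : DifferentiableAt ℝ (fderiv ℝ u) x :=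
    (((hu.mono subset_closure).contDiffAt (hΩ.isOpen.mem_nhds hx)).fderiv_right
      (m := 1) (by norm_num)).differentiableAt one_ne_zero
  rw [h1.fderiv_eq, fderiv_clm_apply h2 (differentiableAt_const a)]
  simp

theorem IsBoundedSmoothDomain.inner_fderiv_grad_comm (hΩ : IsBoundedSmoothDomain Ω)
    (hu : ContDiffOn ℝ 2 u (closure Ω)) {x : Space N} (hx : x ∈ Ω) (a v : Space N) :
    ⟪a, fderiv ℝ (grad Ω u) x v⟫_ℝ = ⟪v, fderiv ℝ (grad Ω u) x a⟫_ℝ := by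
  rw [hΩ.inner_fderiv_grad hu hx, hΩ.inner_fderiv_grad hu hx]
  exact ((hu.mono subset_closure).contDiffAt (hΩ.isOpen.mem_nhds hx)).isSymmSndFDerivAt
    (by simp) v a

theorem IsBoundedSmoothDomain.tr_fderiv_grad (hΩ : IsBoundedSmoothDomain Ω)
    (hu : ContDiffOn ℝ 2 u (closure Ω)) {x : Space N} (hx : x ∈ Ω) :
    tr (fderiv ℝ (grad Ω u) x) = Laplacian.laplacian u x := by
  rw [InnerProductSpace.laplacian_eq_iteratedFDeriv_orthonormalBasis u
    (EuclideanSpace.basisFun (Fin N) ℝ), tr]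
  refine Finset.sum_congr rfl fun i _ => ?_
  rw [hΩ.inner_fderiv_grad hu hx, iteratedFDeriv_two_apply]
  rfl

theorem abs_tr_le (A : Space N →L[ℝ] Space N) : |tr A| ≤ N * ‖A‖ := by
  have h := Finset.abs_sum_le_sum_abs (fun i => ⟪EuclideanSpace.basisFun (Fin N) ℝ i,
    A (EuclideanSpace.basisFun (Fin N) ℝ i)⟫_ℝ) Finset.univ
  refine h.trans ((Finset.sum_le_card_nsmul _ _ ‖A‖ fun i _ => ?_).trans (by simp))
  refine (abs_real_inner_le_norm _ _).trans ?_
  have h1 := (EuclideanSpace.basisFun (Fin N) ℝ).norm_eq_one i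
  have h2 := A.le_opNorm (EuclideanSpace.basisFun (Fin N) ℝ i)
  rw [h1, mul_one] at h2
  rw [h1, one_mul]
  exact h2

/-! ### The drift -/

/-- The field `|v|^{γ-2} v`. -/
def powerField (γ : ℝ) (v : Space N) : Space N := ‖v‖ ^ (γ - 2) • v

variable {γ : ℝ}

/-- For γ > 1 the field is the gradient of the C¹ function |v|^γ/γ; this settles the origin, where
the exponent γ - 2 may be negative. -/
theorem continuous_powerField (hγ : 1 < γ) : Continuous (powerField (N := N) γ) := by
  have h := (continuous_gradient (contDiff_norm_rpow (E := Space N) hγ)).const_smul γ⁻¹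
  refine h.congr fun v => ?_
  have : gradient (fun x : Space N => ‖x‖ ^ γ) v = (γ * ‖v‖ ^ (γ - 2)) • v := by
    refine ext_inner_right ℝ fun y => ?_
    rw [inner_gradient_left, fderiv_norm_rpow v hγ, inner_smul_left]
    simp
  rw [Pi.smul_apply, this, powerField, smul_smul, inv_mul_cancel_left₀ (by linarith)]

theorem inner_powerField_self (hγ : 1 < γ) (v : Space N) : ⟪v, powerField γ v⟫_ℝ = ‖v‖ ^ γ := by
  rw [powerField, inner_smul_right, real_inner_self_eq_norm_sq]
  by_cases hv : v = 0
  · rw [hv, norm_zero, Real.zero_rpow (show γ ≠ 0 by linarith)]; simp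
  · rw [← Real.rpow_natCast, ← Real.rpow_add (norm_pos_iff.2 hv)]
    congr 1; push_cast; ring

theorem fderiv_norm_rpow_comp (hγ : 1 < γ) {w : Space N → Space N} {x : Space N}
    (hw : DifferentiableAt ℝ w x) (v : Space N) :
    fderiv ℝ (fun x => ‖w x‖ ^ γ) x v = γ * ⟪powerField γ (w x), fderiv ℝ w x v⟫_ℝ := by
  have h := ((hasFDerivAt_norm_rpow (w x) hγ).comp x hw.hasFDerivAt).fderiv
  refine (congrArg (fun L : Space N →L[ℝ] ℝ => L v) h).trans ?_
  simp [powerField, inner_smul_left, mul_assoc]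

theorem IsBoundedSmoothDomain.isC1Bounded_norm_rpow (hΩ : IsBoundedSmoothDomain Ω) (hγ : 1 < γ)
    {w : Space N → Space N} (hw : ContDiffOn ℝ 1 w (closure Ω)) :
    IsC1Bounded Ω (fun x => ‖w x‖ ^ γ) :=
  hΩ.isC1Bounded ((contDiff_norm_rpow hγ).comp_contDiffOn hw)

variable {m : Space N → ℝ} {Dm : Space N → Space N}

theorem integrableOn_clm_apply (hΩ : IsBoundedSmoothDomain Ω) {F F' : Type*}
    [NormedAddCommGroup F] [NormedSpace ℝ F] [NormedAddCommGroup F'] [NormedSpace ℝ F']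
    {f : Space N → F} (hf : IntegrableOn f Ω) {B : Space N → F →L[ℝ] F'}
    (hB : ContinuousOn B (closure Ω)) : IntegrableOn (fun x => B x (f x)) Ω := by
  obtain ⟨M, hM⟩ := hΩ.isBounded.isCompact_closure.exists_bound_of_continuousOn hB
  have hBm : AEStronglyMeasurable B (volume.restrict Ω) :=
    (hB.mono subset_closure).aestronglyMeasurable hΩ.isOpen.measurableSet
  refine Integrable.mono' (hf.norm.const_mul M)
    (isBoundedBilinearMap_apply.continuous.comp_aestronglyMeasurable
      (hBm.prodMk hf.aestronglyMeasurable)) ?_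
  filter_upwards [ae_restrict_mem hΩ.isOpen.measurableSet] with x hx
  exact ((B x).le_opNorm _).trans (mul_le_mul_of_nonneg_right (hM x (subset_closure hx))
    (norm_nonneg _))

theorem integrableOn_smul_continuousOn (hΩ : IsBoundedSmoothDomain Ω) (hm : IntegrableOn m Ω)
    {F : Type*} [NormedAddCommGroup F] [NormedSpace ℝ F] {a : Space N → F}
    (ha : ContinuousOn a (closure Ω)) : IntegrableOn (fun x => m x • a x) Ω := by
  have := integrableOn_clm_apply hΩ hm
    (B := fun x => ContinuousLinearMap.toSpanSingleton ℝ (a x))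
    (ContinuousLinearMap.toSpanSingletonCLE.continuous.comp_continuousOn ha)
  simpa using this

theorem integrableOn_inner_continuousOn (hΩ : IsBoundedSmoothDomain Ω) {v : Space N → Space N}
    (hv : IntegrableOn v Ω) {a : Space N → Space N} (ha : ContinuousOn a (closure Ω)) :
    IntegrableOn (fun x => ⟪a x, v x⟫_ℝ) Ω := by
  have := integrableOn_clm_apply hΩ hv (B := fun x => innerSL ℝ (a x))
    ((innerSL ℝ).continuous.comp_continuousOn ha)
  simpa using this

theorem IsWeakKolmogorovSolution.hasWeakDiv (hK : IsWeakKolmogorovSolution Ω γ u m Dm)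
    (hΩ : IsBoundedSmoothDomain Ω) (hγ : 1 < γ) (hm : MemW11 Ω m Dm)
    (hw : ContinuousOn (grad Ω u) (closure Ω)) :
    HasWeakDiv Ω (fun x => Dm x + m x • powerField γ (grad Ω u x)) (fun _ => 0) where
  integrableOn := hm.integrableOn_grad.add (integrableOn_smul_continuousOn hΩ hm.integrableOn
    ((continuous_powerField hγ).comp_continuousOn hw))
  integrableOn_div := integrableOn_zero
  integral_eq φ hφ := by
    simp only [mul_zero, integral_zero, neg_zero]
    rw [← hK φ hφ]
    congr 1; ext x
    rw [← inner_gradient_left, inner_add_right, inner_smul_right, powerField, inner_smul_right,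
      real_inner_comm (Dm x), real_inner_comm (grad Ω u x)]
    ring

/-! ### The stress field -/

/-- The part of the stress field that is normal to the level sets. -/
def stressNormal (γ : ℝ) (w x : Space N) (s : ℝ) (v : Space N) : Space N :=
  s • ⟪w, x⟫_ℝ • powerField γ w + (⟪x, v⟫_ℝ • w + ⟪w, x⟫_ℝ • v)

/-- The radial part of the stress field. -/
def stressRadial (γ : ℝ) (w x : Space N) (s : ℝ) (v : Space N) : Space N :=
  s • (-(1 / γ * ‖w‖ ^ γ)) • x + (-⟪w, v⟫_ℝ) • x

/-- The stress is a sum of three fields with known weak divergence: `d1` is -(1/γ)|w|^γ m x, `d2`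
the antisymmetric field of x and w, and `d3` the product of w·x and the divergence-free flux. The
choice makes all terms in D²u cancel, except for its trace Δu. -/
theorem hasWeakDiv_stress (hΩ : IsBoundedSmoothDomain Ω) (hγ : 1 < γ)
    (hu : ContDiffOn ℝ 2 u (closure Ω)) (hm : MemW11 Ω m Dm)
    (hK : IsWeakKolmogorovSolution Ω γ u m Dm) :
    HasWeakDiv Ω (fun x => stressNormal γ (grad Ω u x) x (m x) (Dm x)
        + stressRadial γ (grad Ω u x) x (m x) (Dm x))
      (fun x => (Laplacian.laplacian u x - 1 / γ * ‖grad Ω u x‖ ^ γ) * ⟪Dm x, x⟫_ℝ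
        + ((1 - N / γ) * (‖grad Ω u x‖ ^ γ * m x) + (2 - N) * ⟪grad Ω u x, Dm x⟫_ℝ)) := by
  have hw := hΩ.contDiffOn_grad hu
  have hwb := hΩ.isC1Bounded hw
  have hid : IsC1Bounded Ω (fun x : Space N => x) := IsC1Bounded.id hΩ.isBounded
  have hγ0 : γ ≠ 0 := by linarith
  have d1 := (((hm.hasWeakDiv_smul_id hΩ.isOpen hΩ.isBounded).smul hΩ.isOpen
    (hΩ.isC1Bounded_norm_rpow hγ hw)).const_smul (-(1 / γ)))
  have d2 := hm.hasWeakDiv_antisymm hΩ.isOpen hid hwb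
  have d3 := (hK.hasWeakDiv hΩ hγ hm hw.continuousOn).smul hΩ.isOpen (hwb.inner hΩ.isOpen hid)
  refine ((d1.add d2).add d3).congr (Eventually.of_forall fun x => ?_) ?_
  · simp only [stressNormal, stressRadial, smul_add, smul_smul, real_inner_comm (Dm x)]
    module
  · filter_upwards [ae_restrict_mem hΩ.isOpen.measurableSet] with x hx
    have htr : tr (fderiv ℝ (fun x : Space N => x) x) = N := by
      rw [fderiv_fun_id, tr]
      simp
    rw [IsC1Bounded.fderiv_inner hΩ.isOpen hwb hid hx,
      fderiv_norm_rpow_comp hγ (hwb.differentiableAt hΩ.isOpen hx), htr,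
      hΩ.tr_fderiv_grad hu hx, fderiv_fun_id]
    simp only [ContinuousLinearMap.id_apply, map_add, map_smul, inner_add_left, inner_add_right,
      inner_smul_left, inner_smul_right, conj_trivial, inner_powerField_self hγ,
      mul_zero, zero_add]
    -- By symmetry of the Hessian, the terms of `d3` become those of `d2` and `d1` with the opposite
    -- sign.
    have s1 : ⟪fderiv ℝ (grad Ω u) x (Dm x), x⟫_ℝ = ⟪Dm x, fderiv ℝ (grad Ω u) x x⟫_ℝ := by
      rw [real_inner_comm, hΩ.inner_fderiv_grad_comm hu hx]
    have s2 : ⟪fderiv ℝ (grad Ω u) x (powerField γ (grad Ω u x)), x⟫_ℝ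
        = ⟪powerField γ (grad Ω u x), fderiv ℝ (grad Ω u) x x⟫_ℝ := by
      rw [real_inner_comm, hΩ.inner_fderiv_grad_comm hu hx]
    rw [s1, s2, real_inner_comm (grad Ω u x) (Dm x)]
    field_simp
    ring

variable {mb : Space N → ℝ} {Db : Space N → Space N}

/-- Both parts of the stress are linear in (m, ∇m) with coefficients continuous up to the boundary,
so one application of `HasTrace.clm_apply` to the pair suffices. -/
theorem HasTrace.smul_add_clm_apply {F : Type*} [NormedAddCommGroup F] [NormedSpace ℝ F]
    (hmb : HasTrace Ω m mb) (hDb : HasTrace Ω Dm Db) (hΩ : IsBoundedSmoothDomain Ω)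
    (hm : MemW11 Ω m Dm) {a : Space N → F} (ha : ContinuousOn a (closure Ω))
    {L : Space N → Space N →L[ℝ] F} (hL : ContinuousOn L (closure Ω)) :
    AEStronglyMeasurable (fun x => m x • a x + L x (Dm x)) (volume.restrict Ω) ∧
      HasTrace Ω (fun x => m x • a x + L x (Dm x)) (fun x => mb x • a x + L x (Db x)) := by
  have h1 := hm.integrableOn.aestronglyMeasurable
  have h2 := hm.integrableOn_grad.aestronglyMeasurable
  refine ⟨((integrableOn_smul_continuousOn hΩ hm.integrableOn ha).add
    (integrableOn_clm_apply hΩ hm.integrableOn_grad hL)).aestronglyMeasurable, ?_⟩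
  have := (hmb.prodMk hDb hΩ h1 h2).clm_apply hΩ (h1.prodMk h2)
    (B := fun x => (ContinuousLinearMap.toSpanSingleton ℝ (a x)).comp
        (ContinuousLinearMap.fst ℝ ℝ (Space N))
      + (L x).comp (ContinuousLinearMap.snd ℝ ℝ (Space N)))
    (((ContinuousLinearMap.toSpanSingletonCLE.continuous.comp_continuousOn ha).clm_comp
      continuousOn_const).add (hL.clm_comp continuousOn_const))
  simpa using this

theorem hasTrace_stressNormal (hmb : HasTrace Ω m mb) (hDb : HasTrace Ω Dm Db)
    (hΩ : IsBoundedSmoothDomain Ω) (hm : MemW11 Ω m Dm) (hγ : 1 < γ)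
    (hw : ContinuousOn (grad Ω u) (closure Ω)) :
    AEStronglyMeasurable (fun x => stressNormal γ (grad Ω u x) x (m x) (Dm x))
        (volume.restrict Ω) ∧
      HasTrace Ω (fun x => stressNormal γ (grad Ω u x) x (m x) (Dm x))
        (fun x => stressNormal γ (grad Ω u x) x (mb x) (Db x)) := by
  have h1 : ContinuousOn (fun x => ⟪grad Ω u x, x⟫_ℝ) (closure Ω) := hw.inner continuousOn_id
  have := hmb.smul_add_clm_apply hDb hΩ hm
    (h1.smul ((continuous_powerField hγ).comp_continuousOn hw))
    (L := fun x => ContinuousLinearMap.smulRightL ℝ (Space N) (Space N) (innerSL ℝ x) (grad Ω u x)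
      + ⟪grad Ω u x, x⟫_ℝ • ContinuousLinearMap.id ℝ (Space N))
    (((((ContinuousLinearMap.smulRightL ℝ (Space N) (Space N)).continuous.comp
      (innerSL ℝ).continuous).continuousOn).clm_apply hw).add (h1.smul continuousOn_const))
  simpa [stressNormal] using this

theorem hasTrace_stressRadial (hmb : HasTrace Ω m mb) (hDb : HasTrace Ω Dm Db)
    (hΩ : IsBoundedSmoothDomain Ω) (hm : MemW11 Ω m Dm) (hγ : 1 < γ)
    (hw : ContinuousOn (grad Ω u) (closure Ω)) :
    AEStronglyMeasurable (fun x => stressRadial γ (grad Ω u x) x (m x) (Dm x))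
        (volume.restrict Ω) ∧
      HasTrace Ω (fun x => stressRadial γ (grad Ω u x) x (m x) (Dm x))
        (fun x => stressRadial γ (grad Ω u x) x (mb x) (Db x)) := by
  have h1 : ContinuousOn (fun x => -(1 / γ * ‖grad Ω u x‖ ^ γ)) (closure Ω) :=
    (continuousOn_const.mul ((contDiff_norm_rpow hγ).continuous.comp_continuousOn hw)).neg
  have := hmb.smul_add_clm_apply hDb hΩ hm (h1.smul continuousOn_id)
    (L := fun x => -ContinuousLinearMap.smulRightL ℝ (Space N) (Space N)
      (innerSL ℝ (grad Ω u x)) x)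
    (((((ContinuousLinearMap.smulRightL ℝ (Space N) (Space N)).continuous.comp
      (innerSL ℝ).continuous).comp_continuousOn hw).clm_apply continuousOn_id).neg)
  simpa [stressRadial] using this

end Value

/-! ### Integrability on the boundary and the final identity -/

theorem IsBoundedSmoothDomain.integrable_inner_normal (hΩ : IsBoundedSmoothDomain Ω)
    {Xb : Space N → Space N} (h : Integrable Xb (surfaceMeasure Ω)) :
    Integrable (fun x => ⟪outerNormal Ω x, Xb x⟫_ℝ) (surfaceMeasure Ω) := by
  refine h.norm.mono' (hΩ.aestronglyMeasurable_outerNormal.inner h.aestronglyMeasurable) ?_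
  filter_upwards [surfaceMeasure_ae_mem] with x hx
  refine (norm_inner_le_norm _ _).trans ?_
  rw [hΩ.norm_outerNormal hx, one_mul]

theorem IsBoundedSmoothDomain.integrable_smul_id (hΩ : IsBoundedSmoothDomain Ω)
    {ψ : Space N → ℝ} (h : Integrable ψ (surfaceMeasure Ω)) :
    Integrable (fun x => ψ x • x) (surfaceMeasure Ω) := by
  obtain ⟨D, hD⟩ := hΩ.isCompact_frontier.isBounded.exists_norm_le
  refine h.smul_bdd D continuous_id.aestronglyMeasurable ?_
  filter_upwards [surfaceMeasure_ae_mem] with x hx using hD x hx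

end

end MFGPohozaev

open MFGPohozaev in
theorem proposition3p1 {N : ℕ} (hN : 1 ≤ N) (Ω : Set (EuclideanSpace ℝ (Fin N)))
    (hΩ : MFGPohozaev.IsBoundedSmoothDomain Ω) (γ : ℝ) (hγ : 1 < γ)
    (g G : EuclideanSpace ℝ (Fin N) → ℝ → ℝ)
    (hg : ContDiffOn ℝ 1 (Function.uncurry g) (closure Ω ×ˢ Set.univ))
    (hG : ContDiffOn ℝ 1 (Function.uncurry G) (closure Ω ×ˢ Set.univ))
    (hGg : ∀ x ∈ closure Ω, ∀ s : ℝ, HasDerivAt (G x) (g x s) s)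
    (u m : EuclideanSpace ℝ (Fin N) → ℝ)
    (Dm : EuclideanSpace ℝ (Fin N) → EuclideanSpace ℝ (Fin N))
    (hu : ContDiffOn ℝ 2 u (closure Ω))
    (hm : MFGPohozaev.MemW11 Ω m Dm)
    -- the first equation, for almost every point of the domain
    (hHJB : ∀ᵐ x ∂(volume.restrict Ω),
      -Laplacian.laplacian u x + 1 / γ * ‖MFGPohozaev.grad Ω u x‖ ^ γ = g x (m x))
    -- the second equation, in the weak sense
    (hK : MFGPohozaev.IsWeakKolmogorovSolution Ω γ u m Dm)
    -- the boundary values of `m` and of its gradient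
    (mb : EuclideanSpace ℝ (Fin N) → ℝ)
    (Db : EuclideanSpace ℝ (Fin N) → EuclideanSpace ℝ (Fin N))
    (hmb : MFGPohozaev.HasTrace Ω m mb) (hDb : MFGPohozaev.HasTrace Ω Dm Db)
    -- the two integrals over the domain that involve `G` are meaningful
    (hGm : IntegrableOn (fun x => G x (m x)) Ω)
    (hGx : IntegrableOn (fun x => gradient (fun y => G y (m x)) x) Ω) :
    Integrable (MFGPohozaev.boundaryIntegrand₁ Ω γ G u mb Db) (MFGPohozaev.surfaceMeasure Ω) ∧
    Integrable (MFGPohozaev.boundaryIntegrand₂ Ω γ u mb Db) (MFGPohozaev.surfaceMeasure Ω) ∧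
    (N : ℝ) * (∫ x in Ω, G x (m x))
      + (∫ x in Ω, ⟪gradient (fun y => G y (m x)) x, x⟫_ℝ)
      + (1 - (N : ℝ) / γ) * (∫ x in Ω, ‖MFGPohozaev.grad Ω u x‖ ^ γ * m x)
      + (2 - (N : ℝ)) * (∫ x in Ω, ⟪MFGPohozaev.grad Ω u x, Dm x⟫_ℝ)
    = (∫ x, MFGPohozaev.boundaryIntegrand₁ Ω γ G u mb Db x ∂(MFGPohozaev.surfaceMeasure Ω))
      + ∫ x, MFGPohozaev.boundaryIntegrand₂ Ω γ u mb Db x ∂(MFGPohozaev.surfaceMeasure Ω) := by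

  have hw := hΩ.contDiffOn_grad hu
  have hwb := hΩ.isC1Bounded hw
  have hwc := hw.continuousOn
  have hγ0 : γ ≠ 0 := by linarith
  have hfin := hΩ.isFiniteMeasure
  -- The first equation expresses g(x,m) through Δu and |∇u|^γ, both bounded because u is C² up to
  -- the boundary; m itself may be unbounded.
  have hbound : ∃ C, ∀ᵐ x ∂(volume.restrict Ω), ‖g x (m x)‖ ≤ C := by
    obtain ⟨C, hC⟩ := hwb.bounded_fderiv
    obtain ⟨C', hC'⟩ := (hΩ.isC1Bounded_norm_rpow hγ hw).bounded
    refine ⟨N * C + 1 / γ * C', ?_⟩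
    filter_upwards [hHJB, ae_restrict_mem hΩ.isOpen.measurableSet] with x hx hxΩ
    rw [← hx, ← hΩ.tr_fderiv_grad hu hxΩ]
    refine (norm_add_le _ _).trans (add_le_add ?_ ?_)
    · rw [norm_neg]
      exact (abs_tr_le _).trans (by gcongr; exact hC x hxΩ)
    · rw [norm_mul, Real.norm_of_nonneg (show 0 ≤ 1 / γ by positivity)]
      gcongr
      exact hC' x hxΩ
  have hadm : IsAdmissible Ω G g m Dm := ⟨hG, hg.continuousOn, hGg, hm, hGm, hGx, hbound⟩
  obtain ⟨mN, tN⟩ := hasTrace_stressNormal hmb hDb hΩ hm hγ hwc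
  obtain ⟨mR, tR⟩ := hasTrace_stressRadial hmb hDb hΩ hm hγ hwc
  have iN := hΩ.integrable_inner_normal tN.1
  have iR := hΩ.integrable_inner_normal tR.1
  have iG : Integrable (fun x => G x (mb x) * ⟪outerNormal Ω x, x⟫_ℝ) (surfaceMeasure Ω) := by
    simpa only [inner_smul_right] using
      hΩ.integrable_inner_normal (hΩ.integrable_smul_id (hadm.integrable_boundary hΩ hmb))
  -- The first boundary integrand collects the fluxes of the fields parallel to x, the second that
  -- of the remaining part of the stress.
  have e1 : boundaryIntegrand₁ Ω γ G u mb Db = fun x => G x (mb x) * ⟪outerNormal Ω x, x⟫_ℝ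
      + ⟪outerNormal Ω x, stressRadial γ (grad Ω u x) x (mb x) (Db x)⟫_ℝ := by
    ext x
    simp only [boundaryIntegrand₁, stressRadial, inner_add_right, inner_smul_right,
      real_inner_comm x (outerNormal Ω x)]
    ring
  have e2 : boundaryIntegrand₂ Ω γ u mb Db = fun x =>
      ⟪outerNormal Ω x, stressNormal γ (grad Ω u x) x (mb x) (Db x)⟫_ℝ := by
    ext x
    simp only [boundaryIntegrand₂, stressNormal, powerField, inner_add_right, inner_smul_right,
      real_inner_comm (grad Ω u x) (outerNormal Ω x), real_inner_comm (Db x) (outerNormal Ω x),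
      real_inner_comm (Db x) x]
    ring
  refine ⟨e1 ▸ iG.add iR, e2 ▸ iN, ?_⟩
  have hdiv := hasWeakDiv_stress hΩ hγ hu hm hK
  have htr : HasTrace Ω (fun x => stressNormal γ (grad Ω u x) x (m x) (Dm x)
        + stressRadial γ (grad Ω u x) x (m x) (Dm x))
      (fun x => stressNormal γ (grad Ω u x) x (mb x) (Db x)
        + stressRadial γ (grad Ω u x) x (mb x) (Db x)) := by
    have := (tN.prodMk tR hΩ mN mR).clm_apply hΩ (mN.prodMk mR)
      (B := fun _ => ContinuousLinearMap.fst ℝ _ _ + ContinuousLinearMap.snd ℝ _ _)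
      continuousOn_const
    simpa using this
  -- The field G(x,m) x is treated apart from the stress, because its trace is obtained only through
  -- truncations.
  have k1 := hadm.integral_eq_integral_boundary hΩ hmb
  have k2 := hdiv.integral_eq_integral_normal hΩ htr
  simp only [inner_add_right] at k2
  rw [integral_add iN iR] at k2
  rw [e1, e2, integral_add iG iR, ← k1, add_assoc (∫ x in Ω, _),
    add_comm (∫ x, _ ∂(surfaceMeasure Ω)), ← k2]
  have jP : IntegrableOn (fun x => ‖grad Ω u x‖ ^ γ * m x) Ω := by
    simpa only [smul_eq_mul, mul_comm, Function.comp] using integrableOn_smul_continuousOn hΩ hm.integrableOn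
      ((contDiff_norm_rpow hγ).continuous.comp_continuousOn hwc)
  have jw := integrableOn_inner_continuousOn hΩ hm.integrableOn_grad hwc
  have jG : IntegrableOn (fun x => ⟪gradient (fun y => G y (m x)) x, x⟫_ℝ) Ω := by
    simpa only [real_inner_comm, id] using integrableOn_inner_continuousOn hΩ hGx continuousOn_id
  have jT : IntegrableOn (fun x => ⟪gradient (fun y => G y (m x)) x + g x (m x) • Dm x, x⟫_ℝ
      + N * G x (m x)) Ω := by
    have := integrableOn_inner_continuousOn hΩ (hadm.integrableOn_total hΩ.isOpen) continuousOn_id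
    simp only [id] at this
    refine IntegrableOn.add (f := fun x => ⟪gradient (fun y => G y (m x)) x + g x (m x) • Dm x, x⟫_ℝ)
      ?_ (hGm.const_mul _)
    simpa only [real_inner_comm] using this
  have i1 : IntegrableOn (fun x => N * G x (m x) + ⟪gradient (fun y => G y (m x)) x, x⟫_ℝ) Ω :=
    (hGm.const_mul _).add jG
  have i2 : IntegrableOn (fun x => N * G x (m x) + ⟪gradient (fun y => G y (m x)) x, x⟫_ℝ
      + (1 - N / γ) * (‖grad Ω u x‖ ^ γ * m x)) Ω := i1.add (jP.const_mul _)
  rw [← integral_add jT hdiv.integrableOn_div,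
    ← integral_const_mul, ← integral_const_mul, ← integral_const_mul,
    ← integral_add (hGm.const_mul _) jG, ← integral_add i1 (jP.const_mul _),
    ← integral_add i2 (jw.const_mul _)]
  -- Pointwise, the first equation makes the two multiples of ∇m·x in the divergences cancel.
  refine integral_congr_ae ?_
  filter_upwards [hHJB] with x hx
  rw [← hx, inner_add_left, inner_smul_left]
  simp only [conj_trivial]
  ring
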